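/- Let $R$ be a division ring with $\operatorname{char} R\neq 2$ and let $V$ be a left vector space over $R$ of finite dimension $n\ge 3$. For an involution $u\in \mathrm{GL}(V)$ (that is, $u^2=1$) put $S_+(u)=\{x\in V: u(x)=x\}$ and $S_-(u)=\{x\in V: u(x)=-x\}$. For $0\le k\le n$ let $\mathfrak I_k$ be the set of $(k,n-k)$-involutions, i.e. of all involutions $u\in\mathrm{GL}(V)$ with $\dim S_+(u)=k$ and $\dim S_-(u)=n-k$. Suppose that $n\neq 2k$ and let $f:\mathfrak I_k\to\mathfrak I_k$ be a commutativity preserving bijection, i.e. both $f$ and $f^{-1}$ map commuting involutions to commuting involutions. Then there is an automorphism $F$ of the group $\mathrm{GL}(V)$ with $F(u)=f(u)$ for every $u\in\mathfrak I_k$. Moreover, $F$ can be chosen in one of the following two forms: (1) $F(g)=l\,g\,l^{-1}$ for all $g\in\mathrm{GL}(V)$, where $l:V\to V$ is a semilinear automorphism, i.e. an additive bijection with $l(ax)=\sigma(a)l(x)$ for some automorphism $\sigma$ of $R$; (2) $F(g)=s^{-1}\,\check g\,s$ for all $g\in\mathrm{GL}(V)$, where $s:V\to V^*$ is a semilinear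 isomorphism onto the dual space $V^*$ of all linear functionals $V\to R$, regarded as a left vector space over the opposite ring $R^{\mathrm{op}}$ (so $s$ is an additive bijection, semilinear with respect to an isomorphism $R\to R^{\mathrm{op}}$), and $\check g\in \mathrm{GL}(V^*)$, $\check g(\xi)=\xi\circ g^{-1}$, is the contragredient of $g$. -/

import Mathlib

section LinearInvolutions

variable {R V : Type*} [DivisionRing R] [AddCommGroup V] [Module R V]

/-- `S₊(u)`: the subspace of all `x` with `u x = x`. -/
def plusSpace (u : LinearMap.GeneralLinearGroup R V) : Submodule R V :=
  LinearMap.eqLocus (u : V →ₗ[R] V) LinearMap.id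

/-- `S₋(u)`: the subspace of all `x` with `u x = -x`. -/
def minusSpace (u : LinearMap.GeneralLinearGroup R V) : Submodule R V :=
  LinearMap.eqLocus (u : V →ₗ[R] V) (-LinearMap.id)

variable (R V) in
/-- The set of `(k, n - k)`-involutions of `V`, where `n = dim V`. -/
def kInvolutions (k : ℕ) : Set (LinearMap.GeneralLinearGroup R V) :=
  {u | u * u = 1 ∧ Module.finrank R (plusSpace u) = k ∧
    Module.finrank R (minusSpace u) = Module.finrank R V - k}

/-- A bijection `f` of a subset of a group is commutativity preserving if both `f` and its inverse
map commuting elements to commuting elements. -/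
def CommutativityPreserving {G : Type*} [Group G] {S : Set G} (f : S ≃ S) : Prop :=
  (∀ u v : S, Commute (u : G) (v : G) → Commute (f u : G) (f v : G)) ∧
  (∀ u v : S, Commute (u : G) (v : G) → Commute (f.symm u : G) (f.symm v : G))

/-- The contragredient of `g ∈ GL(V)`, acting on the dual space `V* = (V →ₗ[R] R)` by
`ξ ↦ ξ ∘ g⁻¹`. For a left vector space `V` over `R`, the dual is a right vector space over `R`,
that is, a left vector space over the opposite ring. -/
def contragredient (g : LinearMap.GeneralLinearGroup R V) :
    LinearMap.GeneralLinearGroup Rᵐᵒᵖ (V →ₗ[R] R) where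
  val :=
    { toFun := fun ξ => ξ ∘ₗ (g⁻¹ : LinearMap.GeneralLinearGroup R V).val
      map_add' := fun _ _ => rfl
      map_smul' := fun _ _ => rfl }
  inv :=
    { toFun := fun ξ => ξ ∘ₗ g.val
      map_add' := fun _ _ => rfl
      map_smul' := fun _ _ => rfl }
  val_inv := by
    ext ξ x
    change ξ ((g.val * (g⁻¹).val) x) = ξ x
    rw [Units.mul_inv]
    rfl
  inv_val := by
    ext ξ x
    change ξ (((g⁻¹).val * g.val) x) = ξ x
    rw [Units.inv_mul]
    rfl

end LinearInvolutions

/-!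
Commutativity preserving bijections of the set `𝔍ₖ` of `(k, n - k)`-involutions are induced by
automorphisms of `GL(V)`. An involution is the same as the ordered pair of its complementary
eigenspaces for `1` and `-1`, so the task is to recover these subspaces from the commutation
relation.

*Adjacency.* Maximal sets of pairwise commuting involutions are the sets of involutions which are
diagonal in a basis. In such a set, the subsets maximal among those with a larger commutant are the
sets of involutions which agree in sign at two given basis vectors `b i`, `b j`; this needs
`n ≠ 2 * k`, see `exists_signs`. An involution commuting with such a subset differs from a diagonal
one only in the plane of `b i` and `b j`. Among the pairs `(u, v)` obtained in this way, those for
which the commutant of `{u, v}` is maximal are the pairs with `v = u + ξ(·) x`, where `x` lies in an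
eigenspace of `u` on which `ξ` vanishes (`AdjacentPair.exists_shear`, `adjacentPair_of_rankOne`).
Adjacency is thus defined by the commutation relation alone, and adjacent involutions share an
eigenspace.

*Signs.* Triangles of adjacent involutions and the connectedness of the set of involutions with a
given eigenspace show that `f` respects the relation of sharing an eigenspace, and either keeps the
two signs everywhere or exchanges them everywhere (`exists_sign_signSpace_map_iff`).

*Signs kept.* Replacing `f` by `u ↦ -f (-u)` if necessary, assume `2 * k < n`. Then `f` induces a
bijection of the `k`-dimensional subspaces. If `k = 1`, it preserves collinearity, because the
eigenspaces for `-1` are the hyperplanes. If `k ≥ 2`, it preserves the relation of meeting in a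
subspace of dimension `k - 1`, and the set of all `S ⊇ N`, with `dim N = k - 1`, goes to a set of the
same kind: inside a frame such a set becomes a family of at least `k + 2` sets of size `k` meeting
pairwise in `k - 1` elements, which has to be a sunflower (`inter_subset_of_card_inter`). The
bijection therefore descends to subspaces of dimension `k - 1`, and so on down to lines, where the
fundamental theorem of projective geometry (`exists_semilinear_of_collineation`) provides a
semilinear map `l`. The eigenspace of `f u` for `-1` is determined by its complements, hence
`f u = l u l⁻¹` (`SignPreserving.exists_semilinear`).

*Signs exchanged.* The contragredient identifies the involutions of `V` with those of the dual space
and exchanges signs as well, since it turns eigenspaces into annihilators. So the previous case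
applies to the composition of `f⁻¹` with the contragredient. For this reason everything is set up
for two vector spaces over two division rings.
-/

open LinearMap (GeneralLinearGroup)

/-! ### Eigenspaces of involutions -/

section SignSpaces

variable {R V : Type*} [DivisionRing R] [AddCommGroup V] [Module R V]

theorem exists_add_of_codisjoint {S U : Submodule R V} (h : Codisjoint S U) (x : V) :
    ∃ y z, y ∈ S ∧ z ∈ U ∧ y + z = x := by
  have hx : x ∈ S ⊔ U := by rw [h.eq_top]; trivial
  obtain ⟨y, hy, z, hz, rfl⟩ := Submodule.mem_sup.mp hx
  exact ⟨y, z, hy, hz, rfl⟩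

theorem map_sign_smul {M N F : Type*} [AddCommGroup M] [AddCommGroup N] [FunLike F M N]
    [AddMonoidHomClass F M N] (g : F) (ε : ℤˣ) (x : M) : g (ε • x) = ε • g x := by
  rcases Int.units_eq_one_or ε with rfl | rfl <;> simp

theorem sign_smul_smul {M : Type*} [AddCommGroup M] (ε : ℤˣ) (x : M) : ε • ε • x = x := by
  rw [smul_smul, Int.units_mul_self, one_smul]

theorem sign_eq_or_eq_neg (ε δ : ℤˣ) : ε = δ ∨ ε = -δ := by
  revert ε δ; decide

theorem sign_ne_iff {ε δ : ℤˣ} : ε ≠ δ ↔ ε = -δ := by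
  revert ε δ; decide

/-- The subspace of all `x` with `u x = ε x`, for a sign `ε`. -/
def signSpace (u : GeneralLinearGroup R V) (ε : ℤˣ) : Submodule R V where
  carrier := {x | u.1 x = ε • x}
  add_mem' {x y} hx hy := by
    simp only [Set.mem_ofPred_eq] at *
    rw [map_add, hx, hy, smul_add]
  zero_mem' := by simp
  smul_mem' a x hx := by
    simp only [Set.mem_ofPred_eq] at *
    rw [map_smul, hx, smul_comm]

theorem mem_signSpace {u : GeneralLinearGroup R V} {ε : ℤˣ} {x : V} :
    x ∈ signSpace u ε ↔ u.1 x = ε • x := Iff.rfl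

theorem signSpace_one (u : GeneralLinearGroup R V) : signSpace u 1 = plusSpace u := by
  ext x; simp [mem_signSpace, plusSpace]

theorem signSpace_neg_one (u : GeneralLinearGroup R V) : signSpace u (-1) = minusSpace u := by
  ext x; simp [mem_signSpace, minusSpace]

theorem commute_iff_apply {u v : GeneralLinearGroup R V} :
    Commute u v ↔ ∀ x, u.1 (v.1 x) = v.1 (u.1 x) := by
  constructor
  · intro h x
    have := congrArg (fun g : GeneralLinearGroup R V => g.1 x) h.eq
    simpa using this
  · intro h
    exact Units.ext (LinearMap.ext h)

theorem GeneralLinearGroup.ext_apply {u v : GeneralLinearGroup R V} (h : ∀ x, u.1 x = v.1 x) :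
    u = v := Units.ext (LinearMap.ext h)

theorem GeneralLinearGroup.mul_self_eq_one_iff {u : GeneralLinearGroup R V} :
    u * u = 1 ↔ ∀ x, u.1 (u.1 x) = x := by
  constructor
  · intro h x
    have := congrArg (fun g : GeneralLinearGroup R V => g.1 x) h
    simpa using this
  · intro h
    exact GeneralLinearGroup.ext_apply (by simpa using h)

theorem eq_zero_of_self_eq_neg (h2 : (2 : R) ≠ 0) {x : V} (h : x = -x) : x = 0 := by
  have : (2 : R) • x = 0 := by rw [two_smul]; nth_rw 1 [h]; simp
  exact (smul_eq_zero.mp this).resolve_left h2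

theorem eq_zero_of_sign_smul_eq (h2 : (2 : R) ≠ 0) {ε : ℤˣ} {x : V} (h : ε • x = (-ε) • x) :
    x = 0 := by
  have h' := congrArg (ε • ·) h
  simp only [Units.neg_smul, smul_neg, sign_smul_smul] at h'
  exact eq_zero_of_self_eq_neg h2 h'

theorem disjoint_signSpace (h2 : (2 : R) ≠ 0) (u : GeneralLinearGroup R V) (ε : ℤˣ) :
    Disjoint (signSpace u ε) (signSpace u (-ε)) := by
  rw [Submodule.disjoint_def]
  intro x hx hx'
  exact eq_zero_of_sign_smul_eq h2 (hx.symm.trans hx')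

theorem isCompl_signSpace (h2 : (2 : R) ≠ 0) {u : GeneralLinearGroup R V} (hu : u * u = 1)
    (ε : ℤˣ) : IsCompl (signSpace u ε) (signSpace u (-ε)) := by
  refine ⟨disjoint_signSpace h2 u ε, ?_⟩
  rw [codisjoint_iff, eq_top_iff]
  intro x _
  rw [GeneralLinearGroup.mul_self_eq_one_iff] at hu
  have hx : x = (2⁻¹ : R) • (x + ε • u.1 x) + (2⁻¹ : R) • (x - ε • u.1 x) := by
    rw [← smul_add, add_add_sub_cancel, ← two_smul R x, smul_smul, inv_mul_cancel₀ h2, one_smul]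
  rw [hx]
  refine Submodule.add_mem_sup (Submodule.smul_mem _ _ ?_) (Submodule.smul_mem _ _ ?_)
  · rw [mem_signSpace, map_add, map_sign_smul, hu, smul_add, sign_smul_smul, add_comm]
  · rw [mem_signSpace, map_sub, map_sign_smul, hu, smul_sub, Units.neg_smul, Units.neg_smul,
      sign_smul_smul]
    abel

theorem finrank_signSpace_add [FiniteDimensional R V] (h2 : (2 : R) ≠ 0)
    {u : GeneralLinearGroup R V} (hu : u * u = 1) (ε : ℤˣ) :
    Module.finrank R (signSpace u ε) + Module.finrank R (signSpace u (-ε)) =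
      Module.finrank R V :=
  Submodule.finrank_add_eq_of_isCompl (isCompl_signSpace h2 hu ε)

theorem mem_kInvolutions_iff [FiniteDimensional R V] (h2 : (2 : R) ≠ 0) {k : ℕ}
    {u : GeneralLinearGroup R V} :
    u ∈ kInvolutions R V k ↔ u * u = 1 ∧ Module.finrank R (signSpace u 1) = k := by
  constructor
  · rintro ⟨h, h', -⟩
    exact ⟨h, by rwa [signSpace_one]⟩
  · rintro ⟨h, h'⟩
    refine ⟨h, by rwa [← signSpace_one], ?_⟩
    rw [← signSpace_neg_one]
    have := finrank_signSpace_add h2 h 1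
    omega

theorem eq_of_signSpace_eq (h2 : (2 : R) ≠ 0) {u v : GeneralLinearGroup R V} (hu : u * u = 1)
    {ε : ℤˣ} (h : signSpace u ε = signSpace v ε) (h' : signSpace u (-ε) = signSpace v (-ε)) :
    u = v := by
  apply GeneralLinearGroup.ext_apply
  intro x
  obtain ⟨y, z, hy, hz, rfl⟩ := exists_add_of_codisjoint
    (isCompl_signSpace h2 hu ε).codisjoint x
  have hy' := hy
  have hz' := hz
  rw [h] at hy'
  rw [h'] at hz'
  rw [mem_signSpace] at hy hz hy' hz'
  rw [map_add, map_add, hy, hz, hy', hz']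

/-- A linear involution as an element of the general linear group. -/
def mkInvolution (g : V →ₗ[R] V) (hg : ∀ x, g (g x) = x) : GeneralLinearGroup R V :=
  ⟨g, g, LinearMap.ext hg, LinearMap.ext hg⟩

theorem mkInvolution_mul_self (g : V →ₗ[R] V) (hg : ∀ x, g (g x) = x) :
    mkInvolution g hg * mkInvolution g hg = 1 :=
  GeneralLinearGroup.mul_self_eq_one_iff.mpr hg

theorem exists_signSpace_eq (h2 : (2 : R) ≠ 0) {S U : Submodule R V} (h : IsCompl S U) (ε : ℤˣ) :
    ∃ u : GeneralLinearGroup R V, u * u = 1 ∧ signSpace u ε = S ∧ signSpace u (-ε) = U := by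
  obtain ⟨g, hS, hU⟩ : ∃ g : V →ₗ[R] V, (∀ x ∈ S, g x = ε • x) ∧ ∀ x ∈ U, g x = (-ε) • x := by
    refine ⟨LinearMap.ofIsCompl h (ε • S.subtype) ((-ε) • U.subtype), fun x hx => ?_,
      fun x hx => ?_⟩
    · exact LinearMap.ofIsCompl_apply_left h (⟨x, hx⟩ : S)
    · exact LinearMap.ofIsCompl_apply_right h (⟨x, hx⟩ : U)
  have hg : ∀ x, g (g x) = x := by
    intro x
    obtain ⟨y, z, hy, hz, rfl⟩ := exists_add_of_codisjoint h.codisjoint x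
    rw [map_add, map_add, hS y hy, hU z hz, map_sign_smul, map_sign_smul, hS y hy, hU z hz,
      sign_smul_smul, sign_smul_smul]
  refine ⟨mkInvolution g hg, mkInvolution_mul_self g hg, ?_, ?_⟩
  · apply le_antisymm
    · intro x hx
      obtain ⟨y, z, hy, hz, rfl⟩ := exists_add_of_codisjoint h.codisjoint x
      have hx' : g (y + z) = ε • (y + z) := hx
      rw [map_add, hS y hy, hU z hz, smul_add, add_right_inj] at hx'
      rw [eq_zero_of_sign_smul_eq h2 hx'.symm, add_zero]
      exact hy
    · exact fun x hx => hS x hx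
  · apply le_antisymm
    · intro x hx
      obtain ⟨y, z, hy, hz, rfl⟩ := exists_add_of_codisjoint h.codisjoint x
      have hx' : g (y + z) = (-ε) • (y + z) := hx
      rw [map_add, hS y hy, hU z hz, smul_add, add_left_inj] at hx'
      rw [eq_zero_of_sign_smul_eq h2 hx', zero_add]
      exact hz
    · exact fun x hx => hU x hx

/-- If the image of `N` lies in the `ε`-eigenspace of `u` and `N` vanishes on this eigenspace, then
`u + N` is again a `(k, n - k)`-involution with the same `ε`-eigenspace. -/
theorem exists_add_smulRight [FiniteDimensional R V] (h2 : (2 : R) ≠ 0) {k : ℕ}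
    (u : kInvolutions R V k) (ε : ℤˣ) (N : V →ₗ[R] V) (hN : ∀ x ∈ signSpace u.1 ε, N x = 0)
    (hN' : ∀ x, N x ∈ signSpace u.1 ε) :
    ∃ v : kInvolutions R V k, (∀ x, v.1.1 x = u.1.1 x + N x) ∧
      signSpace v.1 ε = signSpace u.1 ε := by
  have hu := ((mem_kInvolutions_iff h2).mp u.2).1
  have hu' := GeneralLinearGroup.mul_self_eq_one_iff.mp hu
  have hNu : ∀ x, N (u.1.1 x) = (-ε) • N x := by
    intro x
    obtain ⟨y, z, hy, hz, rfl⟩ := exists_add_of_codisjoint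
      (isCompl_signSpace h2 hu ε).codisjoint x
    rw [map_add, map_add, map_add, hN y hy, mem_signSpace.mp hy, mem_signSpace.mp hz,
      map_sign_smul, map_sign_smul, hN y hy, smul_zero, zero_add, zero_add]
  have hg : ∀ x, (u.1.1 + N) ((u.1.1 + N) x) = x := by
    intro x
    simp only [LinearMap.add_apply, map_add]
    rw [hu', hNu, hN _ (hN' x), mem_signSpace.mp (hN' x), Units.neg_smul]
    abel
  have hε : signSpace (mkInvolution _ hg) ε = signSpace u.1 ε := by
    apply le_antisymm
    · intro x hx
      obtain ⟨y, z, hy, hz, rfl⟩ := exists_add_of_codisjoint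
        (isCompl_signSpace h2 hu ε).codisjoint x
      have hx' : u.1.1 (y + z) + N (y + z) = ε • (y + z) := hx
      rw [map_add, map_add, mem_signSpace.mp hy, mem_signSpace.mp hz, hN y hy, smul_add, zero_add,
        add_assoc, add_right_inj] at hx'
      have hz2 : z ∈ signSpace u.1 ε := by
        have h3 : z + z ∈ signSpace u.1 ε := by
          have : z + z = ε • N z := by
            rw [← sub_eq_iff_eq_add'.mpr hx'.symm, smul_sub, Units.neg_smul, smul_neg,
              sign_smul_smul]
            abel
          rw [this, Units.smul_def]
          exact zsmul_mem (hN' z) _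
        rw [← two_smul R z] at h3
        exact (Submodule.smul_mem_iff _ h2).mp h3
      exact add_mem hy hz2
    · intro x hx
      change u.1.1 x + N x = ε • x
      rw [hN x hx, add_zero]
      exact hx
  refine ⟨⟨mkInvolution _ hg, ?_⟩, fun x => rfl, hε⟩
  have hv := mkInvolution_mul_self _ hg
  rw [mem_kInvolutions_iff h2]
  refine ⟨hv, ?_⟩
  have hk := ((mem_kInvolutions_iff h2).mp u.2).2
  rcases Int.units_eq_one_or ε with rfl | rfl
  · rw [hε, hk]
  · have h3 := finrank_signSpace_add h2 hu (-1)
    have h4 := finrank_signSpace_add h2 hv (-1)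
    rw [hε] at h4
    rw [neg_neg] at h3 h4
    omega

end SignSpaces

/-! ### Commuting involutions and their common eigenbases -/

section CommutingInvolutions

section Relation

variable {α β : Type*}

/-- The set of all elements related to every element of `X`; for the commutation relation this is
the centralizer of `X` inside the given set of involutions. -/
def commutant (r : α → α → Prop) (X : Set α) : Set α := {w | ∀ x ∈ X, r w x}

/-- The relation by which a basis and a pair of its vectors are expressed through commutation:
`u` and `v` are unrelated, but `v` is related to all elements of `X`, where `u ∈ M` for a
self-commutant set `M ⊇ X`, and `X` is maximal among the subsets of `M` whose commutant is not `M`.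
-/
def NearlyCommuting (r : α → α → Prop) (u v : α) : Prop :=
  ¬ r u v ∧ ∃ M X : Set α, commutant r M = M ∧ X ⊆ M ∧ u ∈ M ∧ v ∈ commutant r X ∧
    commutant r X ≠ M ∧ ∀ Y, X ⊆ Y → Y ⊆ M → commutant r Y ≠ M → Y ⊆ X

/-- Nearly commuting pairs with the largest possible commutant. For `(k, n - k)`-involutions these
are the pairs which differ by a linear map of rank one and share an eigenspace. -/
def AdjacentPair (r : α → α → Prop) (u v : α) : Prop :=
  NearlyCommuting r u v ∧ ∀ u' v', NearlyCommuting r u' v' →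
    commutant r {u, v} ⊆ commutant r {u', v'} → commutant r {u', v'} ⊆ commutant r {u, v}

variable {r : α → α → Prop} {s : β → β → Prop}

theorem mem_commutant_pair {u v w : α} : w ∈ commutant r {u, v} ↔ r w u ∧ r w v := by
  simp [commutant]

theorem commutant_image (e : r ≃r s) (X : Set α) :
    commutant s (e '' X) = e '' commutant r X := by
  ext w
  obtain ⟨w, rfl⟩ := e.surjective w
  simp [commutant, e.map_rel_iff]

theorem NearlyCommuting.map (e : r ≃r s) {u v : α} (h : NearlyCommuting r u v) :
    NearlyCommuting s (e u) (e v) := by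
  obtain ⟨h, M, X, hM, hXM, hu, hv, hX, hmax⟩ := h
  refine ⟨by rwa [e.map_rel_iff], e '' M, e '' X, by rw [commutant_image, hM],
    Set.image_mono hXM, Set.mem_image_of_mem e hu, ?_, ?_, ?_⟩
  · rw [commutant_image]
    exact Set.mem_image_of_mem e hv
  · rw [commutant_image]
    exact fun h => hX (e.injective.image_injective h)
  · intro Y hXY hYM hY
    obtain ⟨Y, rfl⟩ := e.surjective.image_surjective Y
    rw [Set.image_subset_image_iff e.injective] at *
    refine hmax Y hXY hYM fun h => hY ?_
    rw [commutant_image, h]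

theorem AdjacentPair.map (e : r ≃r s) {u v : α} (h : AdjacentPair r u v) :
    AdjacentPair s (e u) (e v) := by
  refine ⟨h.1.map e, fun u' v' h' hs => ?_⟩
  obtain ⟨u', rfl⟩ := e.surjective u'
  obtain ⟨v', rfl⟩ := e.surjective v'
  have h'' := h'.map e.symm
  simp only [RelIso.symm_apply_apply] at h''
  rw [← Set.image_pair, ← Set.image_pair, commutant_image, commutant_image,
    Set.image_subset_image_iff e.injective] at *
  exact h.2 u' v' h'' hs

end Relation

variable {R V : Type*} [DivisionRing R] [AddCommGroup V] [Module R V]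

section SignInvolution

variable {ι : Type*}

/-- The involution which multiplies the basis vector `b i` by the sign `s i`. -/
noncomputable def signInvolution (b : Module.Basis ι R V) (s : ι → ℤˣ) : GeneralLinearGroup R V :=
  mkInvolution (b.constr ℕ fun i => s i • b i) (by
    intro x
    have : (b.constr ℕ fun i => s i • b i) ∘ₗ (b.constr ℕ fun i => s i • b i) =
        (LinearMap.id : V →ₗ[R] V) := by
      refine b.ext fun i => ?_
      simp only [LinearMap.comp_apply, Module.Basis.constr_basis, map_sign_smul, sign_smul_smul,
        LinearMap.id_apply]
    exact congrArg (fun g : V →ₗ[R] V => g x) this)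

theorem signInvolution_basis (b : Module.Basis ι R V) (s : ι → ℤˣ) (i : ι) :
    (signInvolution b s).1 (b i) = s i • b i :=
  b.constr_basis ℕ _ i

theorem signInvolution_mul_self (b : Module.Basis ι R V) (s : ι → ℤˣ) :
    signInvolution b s * signInvolution b s = 1 :=
  mkInvolution_mul_self _ _

theorem eq_signInvolution {b : Module.Basis ι R V} {s : ι → ℤˣ} {u : GeneralLinearGroup R V}
    (h : ∀ i, u.1 (b i) = s i • b i) : u = signInvolution b s :=
  Units.ext (b.ext fun i => by rw [h, signInvolution_basis])

theorem coord_signInvolution (b : Module.Basis ι R V) (s : ι → ℤˣ) (x : V) (i : ι) :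
    b.coord i ((signInvolution b s).1 x) = s i • b.coord i x := by
  have : b.coord i ∘ₗ (signInvolution b s).1 = s i • b.coord i := by
    refine b.ext fun j => ?_
    rw [LinearMap.comp_apply, signInvolution_basis, map_sign_smul, LinearMap.smul_apply]
    by_cases h : j = i
    · rw [h]
    · simp [h]
  exact congrArg (fun g : V →ₗ[R] R => g x) this

theorem commute_signInvolution (b : Module.Basis ι R V) (s t : ι → ℤˣ) :
    Commute (signInvolution b s) (signInvolution b t) := by
  refine Units.ext (b.ext fun i => ?_)
  change (signInvolution b s).1 ((signInvolution b t).1 (b i)) =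
    (signInvolution b t).1 ((signInvolution b s).1 (b i))
  simp only [signInvolution_basis, map_sign_smul]
  exact smul_comm _ _ _

/-- The span of the basis vectors with index in `F`. -/
noncomputable def coordSpace (b : Module.Basis ι R V) (F : Finset ι) : Submodule R V :=
  Submodule.span R (b '' F)

theorem mem_coordSpace {b : Module.Basis ι R V} {F : Finset ι} {x : V} :
    x ∈ coordSpace b F ↔ ∀ i ∉ F, b.coord i x = 0 := by
  rw [coordSpace, Module.Basis.mem_span_image]
  simp only [Set.subset_def, Finset.mem_coe, Finsupp.mem_support_iff, Module.Basis.coord_apply]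
  exact forall_congr' fun i => not_imp_comm

theorem finrank_coordSpace (b : Module.Basis ι R V) (F : Finset ι) :
    Module.finrank R (coordSpace b F) = F.card := by
  have h : LinearIndependent R fun i : F => b i :=
    b.linearIndependent.comp _ Subtype.val_injective
  have := finrank_span_eq_card h
  rw [Fintype.card_coe] at this
  have himage : b '' F = Set.range fun i : F => b i := by
    ext x; simp
  rw [← this, coordSpace, himage]

theorem coordSpace_inf [DecidableEq ι] (b : Module.Basis ι R V) (F G : Finset ι) :
    coordSpace b F ⊓ coordSpace b G = coordSpace b (F ∩ G) := by
  ext x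
  simp only [Submodule.mem_inf, mem_coordSpace, Finset.mem_inter]
  refine ⟨fun h i hi => ?_, fun h => ⟨fun i hi => h i (fun h => hi h.1), fun i hi =>
    h i (fun h => hi h.2)⟩⟩
  by_cases hF : i ∈ F
  · exact h.2 i fun hG => hi ⟨hF, hG⟩
  · exact h.1 i hF

theorem coordSpace_mono (b : Module.Basis ι R V) {F G : Finset ι} (h : F ⊆ G) :
    coordSpace b F ≤ coordSpace b G :=
  Submodule.span_mono (Set.image_mono (by exact_mod_cast h))

variable [Fintype ι]

theorem signSpace_signInvolution (h2 : (2 : R) ≠ 0) (b : Module.Basis ι R V) (s : ι → ℤˣ)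
    (ε : ℤˣ) : signSpace (signInvolution b s) ε = coordSpace b {i | s i = ε} := by
  ext x
  have hext : (signInvolution b s).1 x = ε • x ↔
      ∀ i, b.coord i ((signInvolution b s).1 x) = b.coord i (ε • x) := b.ext_elem_iff
  rw [mem_coordSpace, mem_signSpace, hext]
  refine forall_congr' fun i => ?_
  rw [coord_signInvolution, map_sign_smul, Finset.mem_filter_univ]
  constructor
  · intro h hi
    rw [sign_ne_iff.mp hi] at h
    exact eq_zero_of_sign_smul_eq h2 h.symm
  · intro h
    by_cases hi : s i = ε
    · rw [hi]
    · rw [h hi, smul_zero, smul_zero]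

theorem signInvolution_mem_iff (h2 : (2 : R) ≠ 0) (b : Module.Basis ι R V) (s : ι → ℤˣ) {k : ℕ} :
    signInvolution b s ∈ kInvolutions R V k ↔ (Finset.univ.filter fun i => s i = 1).card = k := by
  have := b.finiteDimensional_of_finite
  rw [mem_kInvolutions_iff h2, signSpace_signInvolution h2, finrank_coordSpace]
  exact and_iff_right (signInvolution_mul_self b s)

end SignInvolution

/-! ### Simultaneous diagonalization -/

section Diagonalization

variable [FiniteDimensional R V]

/-- A subspace invariant under a set of commuting involutions is spanned by common eigenvectors: it
is the sum of its intersections with the eigenspaces of any of them, which are invariant, and of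
smaller dimension unless the involution acts by a sign. -/
theorem le_span_common_eigenvectors (h2 : (2 : R) ≠ 0) (M : Set (GeneralLinearGroup R V))
    (hM : ∀ u ∈ M, u * u = 1) (hc : ∀ u ∈ M, ∀ v ∈ M, Commute u v) (d : ℕ) :
    ∀ W : Submodule R V, Module.finrank R W = d → (∀ u ∈ M, ∀ x ∈ W, u.1 x ∈ W) →
      W ≤ Submodule.span R {x | ∀ u ∈ M, ∃ ε : ℤˣ, u.1 x = ε • x} := by
  induction d using Nat.strong_induction_on with
  | _ d ih =>
    intro W hd hW
    by_cases h : ∀ u ∈ M, ∃ ε : ℤˣ, W ≤ signSpace u ε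
    · refine fun x hx => Submodule.subset_span fun u hu => ?_
      obtain ⟨ε, hε⟩ := h u hu
      exact ⟨ε, hε hx⟩
    · push Not at h
      obtain ⟨u, hu, hε⟩ := h
      have key : ∀ ε, W ⊓ signSpace u ε ≤
          Submodule.span R {x | ∀ u ∈ M, ∃ ε : ℤˣ, u.1 x = ε • x} := by
        intro ε
        refine ih _ ?_ _ rfl ?_
        · rw [← hd]
          exact Submodule.finrank_lt_finrank_of_lt (inf_lt_left.mpr (hε ε))
        · rintro v hv x ⟨hx, hx'⟩
          refine ⟨hW v hv x hx, ?_⟩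
          have hx' : u.1 x = ε • x := hx'
          change u.1 (v.1 x) = ε • v.1 x
          rw [commute_iff_apply.mp (hc u hu v hv), hx', map_sign_smul]
      refine le_trans (fun x hx => ?_) (sup_le (key 1) (key (-1)))
      have hux := hW u hu x hx
      have huu := GeneralLinearGroup.mul_self_eq_one_iff.mp (hM u hu)
      have h3 : x = (2⁻¹ : R) • (x + u.1 x) + (2⁻¹ : R) • (x - u.1 x) := by
        rw [← smul_add, add_add_sub_cancel, ← two_smul R x, smul_smul, inv_mul_cancel₀ h2,
          one_smul]
      rw [h3]
      refine Submodule.add_mem_sup (Submodule.smul_mem _ _ ⟨add_mem hx hux, ?_⟩)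
        (Submodule.smul_mem _ _ ⟨sub_mem hx hux, ?_⟩)
      · change u.1 _ = _
        rw [map_add, huu, one_smul, add_comm]
      · change u.1 _ = _
        rw [map_sub, huu, Units.neg_smul, one_smul, neg_sub]

/-- Commuting involutions are simultaneously diagonalizable. -/
theorem exists_basis_signInvolution (h2 : (2 : R) ≠ 0) {n : ℕ} (hn : Module.finrank R V = n)
    (M : Set (GeneralLinearGroup R V)) (hM : ∀ u ∈ M, u * u = 1)
    (hc : ∀ u ∈ M, ∀ v ∈ M, Commute u v) :
    ∃ b : Module.Basis (Fin n) R V, ∀ u ∈ M, ∃ s, u = signInvolution b s := by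
  have hspan := le_span_common_eigenvectors h2 M hM hc _ ⊤ rfl fun _ _ _ _ => trivial
  let b := Module.Basis.ofSpan hspan
  have : Fintype ((linearIndepOn_empty R id).extend
      (Set.empty_subset {x : V | ∀ u ∈ M, ∃ ε : ℤˣ, u.1 x = ε • x})) :=
    FiniteDimensional.fintypeBasisIndex b
  have hcard := Module.finrank_eq_card_basis b
  let e := Fintype.equivFinOfCardEq (hcard.symm.trans hn)
  refine ⟨b.reindex e, fun u hu => ?_⟩
  have h : ∀ i, ∃ ε : ℤˣ, u.1 ((b.reindex e) i) = ε • (b.reindex e) i := by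
    intro i
    rw [Module.Basis.reindex_apply]
    exact Module.Basis.ofSpan_subset hspan ⟨e.symm i, rfl⟩ u hu
  choose s hs using h
  exact ⟨s, eq_signInvolution hs⟩

end Diagonalization

end CommutingInvolutions

/-! ### Nearly commuting pairs -/

section NearlyCommutingPairs

variable {R V : Type*} [DivisionRing R] [AddCommGroup V] [Module R V]

section Signs

variable {ι : Type*} [Fintype ι] [DecidableEq ι] {n k : ℕ}

theorem exists_signs_of_finset {k : ℕ} (A B : Finset ι) (hAB : Disjoint A B) (hA : A.card ≤ k)
    (hB : k + B.card ≤ Fintype.card ι) :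
    ∃ s : ι → ℤˣ, (Finset.univ.filter fun i => s i = 1).card = k ∧ (∀ i ∈ A, s i = 1) ∧
      ∀ i ∈ B, s i = -1 := by
  obtain ⟨C, hAC, hCB, hC⟩ := Finset.exists_subsuperset_card_eq
    (Finset.subset_compl_iff_disjoint_right.mpr hAB) hA (by rw [Finset.card_compl]; omega)
  refine ⟨fun i => if i ∈ C then 1 else -1, ?_, fun i hi => by simp [hAC hi], fun i hi => ?_⟩
  · rw [← hC]
    congr 1
    ext i
    by_cases h : i ∈ C <;> simp [h]
  · have : i ∉ C := fun h => Finset.mem_compl.mp (hCB h) hi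
    simp [this]

theorem exists_signs_ne (hι : Fintype.card ι = n) (hk : 0 < k) (hkn : k < n) {i j : ι}
    (hij : i ≠ j) :
    ∃ s : ι → ℤˣ, (Finset.univ.filter fun i => s i = 1).card = k ∧ s i ≠ s j := by
  obtain ⟨s, hs, hi, hj⟩ := exists_signs_of_finset (k := k) {i} {j} (by simpa using hij)
    (by rw [Finset.card_singleton]; omega) (by simp; omega)
  refine ⟨s, hs, ?_⟩
  rw [hi i (by simp), hj j (by simp)]
  decide

/-- If `n ≠ 2k`, the `k`-subsets of an `n`-element set which do not separate `i` from `j` still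
separate any other pair of elements. -/
theorem exists_signs (hι : Fintype.card ι = n) (hn : 3 ≤ n) (hk : 0 < k) (hkn : k < n)
    (hnk : n ≠ 2 * k) {i j l p : ι} (hij : i ≠ j) (hlp : l ≠ p) (h1 : ¬ (l = i ∧ p = j))
    (h2 : ¬ (l = j ∧ p = i)) :
    ∃ s : ι → ℤˣ, (Finset.univ.filter fun i => s i = 1).card = k ∧ s i = s j ∧ s l ≠ s p := by
  wlog hl : l ≠ i ∧ l ≠ j generalizing l p
  · obtain ⟨s, hs, hs1, hs2⟩ := this hlp.symm (by tauto) (by tauto) (by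
      constructor <;> rintro rfl <;> apply hl <;> constructor <;> rintro rfl <;> tauto)
    exact ⟨s, hs, hs1, hs2.symm⟩
  obtain ⟨hli, hlj⟩ := hl
  have fin : ∀ A B : Finset ι, Disjoint A B → A.card ≤ k → k + B.card ≤ n →
      (({i, j} ⊆ A) ∨ {i, j} ⊆ B) → ((l ∈ A ∧ p ∈ B) ∨ l ∈ B ∧ p ∈ A) →
      ∃ s : ι → ℤˣ, (Finset.univ.filter fun i => s i = 1).card = k ∧ s i = s j ∧ s l ≠ s p := by
    intro A B hAB hA hB h3 h4
    obtain ⟨s, hs, hsA, hsB⟩ := exists_signs_of_finset A B hAB hA (by omega)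
    refine ⟨s, hs, ?_, ?_⟩
    · rcases h3 with h3 | h3
      · rw [hsA i (h3 (by simp)), hsA j (h3 (by simp))]
      · rw [hsB i (h3 (by simp)), hsB j (h3 (by simp))]
    · rcases h4 with h4 | h4
      · rw [hsA l h4.1, hsB p h4.2]; decide
      · rw [hsB l h4.1, hsA p h4.2]; decide
  by_cases hp : p = i ∨ p = j
  · by_cases h : k + 2 ≤ n
    · refine fin {l} {i, j} (by simp [hli, hlj]) (by rw [Finset.card_singleton]; omega) ?_ (by simp) ?_
      · rw [Finset.card_pair hij]; omega
      · left; rcases hp with rfl | rfl <;> simp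
    · refine fin {i, j} {l} (by simp [hli, hlj]) ?_ (by simp; omega) (by simp) ?_
      · rw [Finset.card_pair hij]; omega
      · right; rcases hp with rfl | rfl <;> simp
  · push Not at hp
    have h4 : 4 ≤ n := by
      rw [← hι]
      have : ({i, j, l, p} : Finset ι).card = 4 := by
        rw [Finset.card_insert_of_notMem (by simp [hij, hli.symm, hp.1.symm]),
          Finset.card_insert_of_notMem (by simp [hlj.symm, hp.2.symm]), Finset.card_pair hlp]
      rw [← this]
      exact Finset.card_le_univ _
    by_cases h : k + 3 ≤ n
    · refine fin {l} {i, j, p} (by simp [hli, hlj, hlp]) (by rw [Finset.card_singleton]; omega) ?_ ?_ (by simp)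
      · rw [Finset.card_insert_of_notMem (by simp [hij, hp.1.symm]),
          Finset.card_pair hp.2.symm]
        omega
      · right; intro x; simp; tauto
    · refine fin {i, j, l} {p} (by simp [hp, hlp.symm]) ?_ (by simp; omega) ?_ (by simp)
      · rw [Finset.card_insert_of_notMem (by simp [hij, hli.symm]),
          Finset.card_pair hlj.symm]
        omega
      · left; intro x; simp; tauto

end Signs

/-- The commutation relation on the set of `(k, n - k)`-involutions. A relation isomorphism between
two such sets, possibly of different vector spaces, is called a commutation isomorphism below. -/
def InvolutionsCommute {k : ℕ} (u v : kInvolutions R V k) : Prop := Commute u.1 v.1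

section Frame

variable {ι : Type*} {k : ℕ}

theorem coord_eq_zero_of_commute (h2 : (2 : R) ≠ 0) {b : Module.Basis ι R V} {s : ι → ℤˣ}
    {w : GeneralLinearGroup R V} (h : Commute w (signInvolution b s)) {l p : ι}
    (hlp : s l ≠ s p) : b.coord p (w.1 (b l)) = 0 := by
  have h1 := congrArg (b.coord p) (commute_iff_apply.mp h (b l))
  rw [signInvolution_basis, map_sign_smul, map_sign_smul, coord_signInvolution,
    sign_ne_iff.mp hlp] at h1
  exact eq_zero_of_sign_smul_eq h2 h1.symm

theorem eq_smul_of_coord_eq_zero {b : Module.Basis ι R V} {l : ι} {x : V}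
    (h : ∀ p, p ≠ l → b.coord p x = 0) : x = b.coord l x • b l := by
  classical
  refine b.ext_elem fun p => ?_
  change b.coord p x = b.coord p _
  rw [map_smul]
  by_cases hp : p = l
  · subst hp; simp
  · rw [h p hp]; simp [Ne.symm hp]

theorem exists_sign_of_mul_self_eq_one {c : R} (h : c * c = 1) {M : Type*} [AddCommGroup M]
    [Module R M] : ∃ ε : ℤˣ, ∀ x : M, c • x = ε • x := by
  rcases mul_self_eq_one_iff.mp h with rfl | rfl
  · exact ⟨1, fun x => by simp⟩
  · exact ⟨-1, fun x => by simp⟩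

theorem exists_sign_of_coord_eq_zero {b : Module.Basis ι R V} {w : GeneralLinearGroup R V}
    (hw : w * w = 1) {l : ι} (h : ∀ p, p ≠ l → b.coord p (w.1 (b l)) = 0) :
    ∃ ε : ℤˣ, w.1 (b l) = ε • b l := by
  have h1 := eq_smul_of_coord_eq_zero h
  have h3 := GeneralLinearGroup.mul_self_eq_one_iff.mp hw (b l)
  rw [h1, map_smul, h1, smul_smul] at h3
  have h4 := congrArg (b.coord l) h3
  simp only [map_smul, Module.Basis.coord_apply, Module.Basis.repr_self, Finsupp.single_eq_same,
    smul_eq_mul, mul_one] at h4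
  obtain ⟨ε, hε⟩ := exists_sign_of_mul_self_eq_one h4 (M := V)
  exact ⟨ε, by rw [h1]; exact hε _⟩

/-- The `(k, n - k)`-involutions which are diagonal in the basis `b`. -/
def frameInvolutions (b : Module.Basis ι R V) (k : ℕ) : Set (kInvolutions R V k) :=
  {u | ∃ s, u.1 = signInvolution b s}

/-- The `(k, n - k)`-involutions which are diagonal in the basis `b` and have the same sign at
`b i` and `b j`. -/
def pairInvolutions (b : Module.Basis ι R V) (k : ℕ) (i j : ι) : Set (kInvolutions R V k) :=
  {u | ∃ s, s i = s j ∧ u.1 = signInvolution b s}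

theorem pairInvolutions_subset (b : Module.Basis ι R V) (k : ℕ) (i j : ι) :
    pairInvolutions b k i j ⊆ frameInvolutions b k :=
  fun _ ⟨s, _, h⟩ => ⟨s, h⟩

theorem subset_commutant_frameInvolutions (b : Module.Basis ι R V) {X : Set (kInvolutions R V k)}
    (hX : X ⊆ frameInvolutions b k) :
    frameInvolutions b k ⊆ commutant InvolutionsCommute X := by
  rintro u ⟨s, hs⟩ v hv
  obtain ⟨t, ht⟩ := hX hv
  rw [InvolutionsCommute, hs, ht]
  exact commute_signInvolution b s t

theorem mem_frameInvolutions_of_coord {b : Module.Basis ι R V} {w : kInvolutions R V k}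
    (h : ∀ l p, p ≠ l → b.coord p (w.1.1 (b l)) = 0) : w ∈ frameInvolutions b k := by
  choose s hs using fun l => exists_sign_of_coord_eq_zero w.2.1 (h l)
  exact ⟨s, eq_signInvolution hs⟩

/-- If `b i` and `b j` belong to different eigenspaces of `u`, then adding the elementary map
`x ↦ c (x j) (b i)` to `u` produces another involution with the same eigenspace at `b i`. -/
theorem exists_shear [FiniteDimensional R V] (h2 : (2 : R) ≠ 0) {b : Module.Basis ι R V}
    [Fintype ι] {s : ι → ℤˣ} {u : kInvolutions R V k} (hu : u.1 = signInvolution b s) {i j : ι}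
    (hij : s i ≠ s j) (c : R) :
    ∃ v : kInvolutions R V k, (∀ x, v.1.1 x = u.1.1 x + b.coord j x • c • b i) ∧
      signSpace v.1 (s i) = signSpace u.1 (s i) := by
  refine exists_add_smulRight h2 u (s i) ((b.coord j).smulRight (c • b i)) ?_ ?_
  · intro x hx
    rw [hu, signSpace_signInvolution h2, mem_coordSpace] at hx
    rw [LinearMap.smulRight_apply, hx j (by simpa using hij.symm), zero_smul]
  · intro x
    rw [LinearMap.smulRight_apply]
    refine Submodule.smul_mem _ _ (Submodule.smul_mem _ _ ?_)
    rw [hu]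
    exact signInvolution_basis b s i

theorem exists_frameInvolution [Fintype ι] (h2 : (2 : R) ≠ 0) (b : Module.Basis ι R V) {s : ι → ℤˣ}
    (hs : (Finset.univ.filter fun i => s i = 1).card = k) :
    ∃ w : kInvolutions R V k, w.1 = signInvolution b s :=
  ⟨⟨_, (signInvolution_mem_iff h2 b s).mpr hs⟩, rfl⟩

theorem not_commute_shear (h2 : (2 : R) ≠ 0) {b : Module.Basis ι R V} {s : ι → ℤˣ}
    {u v : kInvolutions R V k} (hu : u.1 = signInvolution b s) {i j : ι} (hij : s i ≠ s j) {c : R}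
    (hc : c ≠ 0) (hv : ∀ x, v.1.1 x = u.1.1 x + b.coord j x • c • b i) :
    ¬ InvolutionsCommute u v := by
  intro h
  have h1 := coord_eq_zero_of_commute h2 (s := s) (w := v.1) (b := b) (l := j) (p := i)
    (by rw [← hu]; exact h.symm) hij.symm
  have hne : j ≠ i := fun h => hij (by rw [h])
  rw [hv, hu, signInvolution_basis] at h1
  simp [hne] at h1
  exact hc h1

theorem shear_mem_commutant {b : Module.Basis ι R V} {s : ι → ℤˣ} {u v : kInvolutions R V k}
    (hu : u.1 = signInvolution b s) {i j : ι} {c : R}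
    (hv : ∀ x, v.1.1 x = u.1.1 x + b.coord j x • c • b i) :
    v ∈ commutant InvolutionsCommute (pairInvolutions b k i j) := by
  rintro w ⟨t, ht, hw⟩
  refine commute_iff_apply.mpr fun x => ?_
  have h1 := commute_iff_apply.mp (commute_signInvolution b s t) x
  rw [hv, hv, hw, hu, h1, coord_signInvolution, map_add, map_smul, map_smul, signInvolution_basis,
    ← ht, smul_comm c, smul_comm _ (t i), smul_assoc]

variable [Fintype ι] [DecidableEq ι] {n : ℕ}

/-- An involution commuting with all diagonal involutions which agree at `b i` and `b j` has no
matrix entries off the diagonal other than those at `(i, j)` and `(j, i)`. -/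
theorem coord_eq_zero_of_mem_commutant (h2 : (2 : R) ≠ 0) (hι : Fintype.card ι = n) (hn : 3 ≤ n)
    (hk : 0 < k) (hkn : k < n) (hnk : n ≠ 2 * k) {b : Module.Basis ι R V} {i j : ι} (hij : i ≠ j)
    {v : kInvolutions R V k}
    (hv : v ∈ commutant InvolutionsCommute (pairInvolutions b k i j)) {l p : ι} (hlp : l ≠ p)
    (h3 : ¬ (l = i ∧ p = j)) (h4 : ¬ (l = j ∧ p = i)) : b.coord p (v.1.1 (b l)) = 0 := by
  obtain ⟨s, hs, hsij, hslp⟩ := exists_signs hι hn hk hkn hnk hij hlp h3 h4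
  obtain ⟨w, hw⟩ := exists_frameInvolution h2 b hs
  refine coord_eq_zero_of_commute h2 (s := s) ?_ hslp
  rw [← hw]
  exact hv w ⟨s, hsij, hw⟩

/-- The diagonal involutions separate the basis vectors, so that only diagonal involutions commute
with all of them. -/
theorem commutant_frameInvolutions (h2 : (2 : R) ≠ 0) (hι : Fintype.card ι = n)
    (hk : 0 < k) (hkn : k < n) (b : Module.Basis ι R V) :
    commutant InvolutionsCommute (frameInvolutions b k) = frameInvolutions b k := by
  refine subset_antisymm (fun w hw => mem_frameInvolutions_of_coord fun l p hlp => ?_)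
    (subset_commutant_frameInvolutions b subset_rfl)
  obtain ⟨s, hs, hslp⟩ := exists_signs_ne hι hk hkn hlp.symm
  obtain ⟨v, hv⟩ := exists_frameInvolution h2 b hs
  refine coord_eq_zero_of_commute h2 (s := s) ?_ hslp
  rw [← hv]
  exact hw v ⟨s, hv⟩

/-- The witnesses are the diagonal involutions and those among them which agree at `b i` and `b j`. A
diagonal involution which separates `b i` from `b j` reduces the commutant to the diagonal. -/
theorem nearlyCommuting_shear [FiniteDimensional R V] (h2 : (2 : R) ≠ 0)
    (hι : Fintype.card ι = n) (hn : 3 ≤ n)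
    (hk : 0 < k) (hkn : k < n) (hnk : n ≠ 2 * k) {b : Module.Basis ι R V} {s : ι → ℤˣ}
    {u v : kInvolutions R V k} (hu : u.1 = signInvolution b s) {i j : ι} (hij : s i ≠ s j) {c : R}
    (hc : c ≠ 0) (hv : ∀ x, v.1.1 x = u.1.1 x + b.coord j x • c • b i) :
    NearlyCommuting InvolutionsCommute u v := by
  have hne : i ≠ j := fun h => hij (by rw [h])
  have hnc := not_commute_shear h2 hu hij hc hv
  have hvX := shear_mem_commutant hu hv
  refine ⟨hnc, frameInvolutions b k, pairInvolutions b k i j,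
    commutant_frameInvolutions h2 hι hk hkn b, pairInvolutions_subset b k i j, ⟨s, hu⟩, hvX, ?_, ?_⟩
  · intro h
    rw [h] at hvX
    exact hnc (subset_commutant_frameInvolutions b subset_rfl ⟨s, hu⟩ v hvX)
  · intro Y hXY hYM hY
    by_contra hcon
    obtain ⟨y, hy, hyX⟩ := Set.not_subset.mp hcon
    obtain ⟨t, ht⟩ := hYM hy
    have htij : t i ≠ t j := fun h => hyX ⟨t, h, ht⟩
    refine hY (subset_antisymm (fun w hw => mem_frameInvolutions_of_coord fun l p hlp => ?_)
      (subset_commutant_frameInvolutions b hYM))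
    have hwy : Commute w.1 (signInvolution b t) := by
      rw [← ht]
      exact hw y hy
    by_cases h3 : l = i ∧ p = j
    · exact coord_eq_zero_of_commute h2 hwy (by rwa [h3.1, h3.2])
    by_cases h4 : l = j ∧ p = i
    · exact coord_eq_zero_of_commute h2 hwy (by rw [h4.1, h4.2]; exact htij.symm)
    exact coord_eq_zero_of_mem_commutant h2 hι hn hk hkn hnk hne (fun x hx => hw x (hXY hx))
      hlp.symm h3 h4

end Frame

/-- A nearly commuting pair is diagonal with equal signs up to a pair of vectors of some basis. -/
theorem NearlyCommuting.exists_basis [FiniteDimensional R V] (h2 : (2 : R) ≠ 0) {n k : ℕ}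
    (hV : Module.finrank R V = n)
    (hk : 0 < k) (hkn : k < n) {u v : kInvolutions R V k}
    (h : NearlyCommuting InvolutionsCommute u v) :
    ∃ (b : Module.Basis (Fin n) R V) (s : Fin n → ℤˣ) (i j : Fin n), u.1 = signInvolution b s ∧
      s i ≠ s j ∧ v ∈ commutant InvolutionsCommute (pairInvolutions b k i j) := by
  obtain ⟨huv, M, X, hM, hXM, hu, hv, hX, hmax⟩ := h
  obtain ⟨b, hb⟩ := exists_basis_signInvolution h2 hV (Subtype.val '' M)
    (by rintro _ ⟨w, -, rfl⟩; exact w.2.1)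
    (by
      rintro _ ⟨w, hw, rfl⟩ _ ⟨w', hw', rfl⟩
      rw [← hM] at hw
      exact hw w' hw')
  have hMb : M = frameInvolutions b k := by
    have h1 : M ⊆ frameInvolutions b k := fun w hw => hb _ ⟨w, hw, rfl⟩
    refine subset_antisymm h1 ?_
    conv_rhs => rw [← hM]
    exact subset_commutant_frameInvolutions b h1
  subst hMb
  obtain ⟨w, hw, hwM⟩ : ∃ w ∈ commutant InvolutionsCommute X, w ∉ frameInvolutions b k := by
    by_contra! hcon
    exact hX (subset_antisymm hcon (subset_commutant_frameInvolutions b hXM))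
  obtain ⟨i, j, hij, hc⟩ : ∃ l p, p ≠ l ∧ b.coord p (w.1.1 (b l)) ≠ 0 := by
    by_contra! hcon
    exact hwM (mem_frameInvolutions_of_coord hcon)
  have hXij : X ⊆ pairInvolutions b k i j := by
    intro x hx
    obtain ⟨s, hs⟩ := hXM hx
    refine ⟨s, ?_, hs⟩
    by_contra hne
    refine hc (coord_eq_zero_of_commute h2 (s := s) ?_ hne)
    rw [← hs]
    exact hw x hx
  have hijX : pairInvolutions b k i j ⊆ X := by
    refine hmax _ hXij (pairInvolutions_subset b k i j) fun h => ?_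
    obtain ⟨s, hs, hsij⟩ := exists_signs_ne (Fintype.card_fin n) hk hkn hij.symm
    obtain ⟨u', hu'⟩ := exists_frameInvolution h2 b hs
    obtain ⟨v', hv', -⟩ := exists_shear h2 hu' hsij 1
    have hv'M := shear_mem_commutant hu' hv'
    rw [h] at hv'M
    exact not_commute_shear h2 hu' hsij one_ne_zero hv'
      (subset_commutant_frameInvolutions b subset_rfl ⟨s, hu'⟩ v' hv'M)
  obtain ⟨s, hs⟩ := hu
  refine ⟨b, s, i, j, hs, fun h => ?_, fun x hx => hv x (hijX hx)⟩
  exact huv (Commute.symm (hv u (hijX ⟨s, h, hs⟩)))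

end NearlyCommutingPairs

/-! ### The involutions which commute with the commutant of an adjacent pair -/

section Bicommutant

variable {R V : Type*} [DivisionRing R] [AddCommGroup V] [Module R V]

variable {ι : Type*} [Fintype ι] [DecidableEq ι] {n k : ℕ}

/-- If `u` is diagonal and `v` is diagonal up to the pair `b i, b j`, the matrix entry `q` of `v` at
`(i, j)` is recovered from `u` and `v`: the map `x ↦ 4 s i (x j) q (b i)` equals
`(u v - v u) (1 - s i u)`, hence commutes with everything that commutes with `u` and `v`. -/
theorem commute_elementary_of_commute (h2 : (2 : R) ≠ 0) (hι : Fintype.card ι = n) (hn : 3 ≤ n)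
    (hk : 0 < k) (hkn : k < n) (hnk : n ≠ 2 * k) {b : Module.Basis ι R V} {s : ι → ℤˣ}
    {u v w : kInvolutions R V k} (hu : u.1 = signInvolution b s) {i j : ι} (hij : s i ≠ s j)
    (hv : v ∈ commutant InvolutionsCommute (pairInvolutions b k i j))
    (hwu : InvolutionsCommute w u) (hwv : InvolutionsCommute w v) (x : V) :
    w.1.1 (b.coord j x • b.coord i (v.1.1 (b j)) • b i) =
      b.coord j (w.1.1 x) • b.coord i (v.1.1 (b j)) • b i := by
  have hne : i ≠ j := fun h => hij (by rw [h])
  set D : V →ₗ[R] V := (u.1.1 * v.1.1 - v.1.1 * u.1.1) * (1 - s i • u.1.1) with hD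
  have key : ∀ y, D y = (4 : ℕ) • s i • (b.coord j y • b.coord i (v.1.1 (b j)) • b i) := by
    intro y
    have : D = (4 : ℕ) • s i • (b.coord j).smulRight (b.coord i (v.1.1 (b j)) • b i) := by
      refine b.ext fun l => b.ext_elem fun p => ?_
      change b.coord p _ = b.coord p _
      have h3 : D (b l) = (u.1.1 (v.1.1 (b l)) - s l • v.1.1 (b l)) -
          (s i * s l) • (u.1.1 (v.1.1 (b l)) - s l • v.1.1 (b l)) := by
        simp only [hD, Module.End.mul_apply, LinearMap.sub_apply, Module.End.one_apply, map_sub,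
          LinearMap.smul_apply, hu, signInvolution_basis, map_sign_smul, mul_smul, smul_sub]
      have h4 : b.coord p (D (b l)) = (s p • b.coord p (v.1.1 (b l)) - s l • b.coord p (v.1.1 (b l))) -
          (s i * s l) • (s p • b.coord p (v.1.1 (b l)) - s l • b.coord p (v.1.1 (b l))) := by
        rw [h3]
        simp only [map_sub, map_sign_smul]
        rw [hu, coord_signInvolution]
      rw [h4]
      simp only [LinearMap.smul_apply, LinearMap.smulRight_apply, map_nsmul, map_sign_smul,
        map_smul]
      by_cases h5 : l = j ∧ p = i
      · obtain ⟨rfl, rfl⟩ := h5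
        rw [sign_ne_iff.mp hij.symm]
        simp only [Units.neg_smul, mul_neg, Int.units_mul_self, one_smul, Module.Basis.coord_apply,
          Module.Basis.repr_self, Finsupp.single_eq_same, smul_eq_mul, one_mul, mul_one]
        abel
      · by_cases h6 : p = l
        · subst h6
          have : b.coord j (b p) • b.coord i (v.1.1 (b j)) • b.coord p (b i) = 0 := by
            by_cases h7 : p = j
            · subst h7; simp [hne]
            · simp [h7]
          rw [this]
          simp
        · have h7 : b.coord j (b l) • b.coord i (v.1.1 (b j)) • b.coord p (b i) = 0 := by
            by_cases h7 : l = j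
            · have h8 : p ≠ i := fun h => h5 ⟨h7, h⟩
              simp [h8.symm]
            · simp [h7]
          rw [h7, smul_zero, smul_zero]
          by_cases h8 : l = i ∧ p = j
          · rw [h8.1, Int.units_mul_self, one_smul, sub_self]
          · rw [coord_eq_zero_of_mem_commutant h2 hι hn hk hkn hnk hne hv (Ne.symm h6) h8 h5]
            simp
    rw [this]
    rfl
  have hwD : w.1.1 (D x) = D (w.1.1 x) := by
    have hu' := commute_iff_apply.mp hwu
    have hv' := commute_iff_apply.mp hwv
    simp only [hD, Module.End.mul_apply, LinearMap.sub_apply, Module.End.one_apply, map_sub,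
      LinearMap.smul_apply, map_sign_smul, hu', hv']
  rw [key, key, map_nsmul, map_sign_smul] at hwD
  have h4 : ((4 : ℕ) : R) ≠ 0 := by
    have : ((4 : ℕ) : R) = 2 * 2 := by norm_num
    rw [this]
    exact mul_ne_zero h2 h2
  rw [← Nat.cast_smul_eq_nsmul R, ← Nat.cast_smul_eq_nsmul R] at hwD
  exact MulAction.injective (s i) (smul_right_injective V h4 hwD)

variable [FiniteDimensional R V]

/-- The bicommutant of a pair of involutions which differ by the elementary map
`x ↦ c (x j) (b i)` consists of involutions of the same shape. -/
theorem eq_shear_of_mem_bicommutant (h2 : (2 : R) ≠ 0) (hι : Fintype.card ι = n) (hn : 3 ≤ n)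
    (hk : 0 < k) (hkn : k < n) (hnk : n ≠ 2 * k) {b : Module.Basis ι R V} {s : ι → ℤˣ}
    {u u' v : kInvolutions R V k} (hu : u.1 = signInvolution b s) {i j : ι} (hij : s i ≠ s j)
    {c : R} (hu' : ∀ x, u'.1.1 x = u.1.1 x + b.coord j x • c • b i)
    (hv : v ∈ commutant InvolutionsCommute (commutant InvolutionsCommute {u, u'})) :
    ∃ q : R, ∀ x, v.1.1 x = u.1.1 x + b.coord j x • q • b i := by
  have hne : i ≠ j := fun h => hij (by rw [h])
  have hvX : v ∈ commutant InvolutionsCommute (pairInvolutions b k i j) := by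
    rintro w ⟨t, ht, hw⟩
    refine hv w (mem_commutant_pair.mpr ⟨?_, Commute.symm (shear_mem_commutant hu hu' w ⟨t, ht, hw⟩)⟩)
    rw [InvolutionsCommute, hw, hu]
    exact commute_signInvolution b t s
  have hcoord : ∀ {l p}, l ≠ p → ¬ (l = i ∧ p = j) → ¬ (l = j ∧ p = i) →
      b.coord p (v.1.1 (b l)) = 0 :=
    fun h h3 h4 => coord_eq_zero_of_mem_commutant h2 hι hn hk hkn hnk hne hvX h h3 h4
  -- `v` commutes with the elementary map taking `b q` to `b p` whenever this map commutes with
  -- `u` and `u'`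
  have helem : ∀ p q, p ≠ q → s p = s q → ¬ (q = i ∧ p = j) → ¬ (q = j ∧ p = i) → q ≠ i → p ≠ j →
      ∀ x, b.coord q (v.1.1 x) • b p = b.coord q x • v.1.1 (b p) := by
    intro p q hpq hspq h3 h4 hqi hpj x
    obtain ⟨t, ht, htij, htpq⟩ := exists_signs hι hn hk hkn hnk hne hpq.symm h3 h4
    obtain ⟨w, hw⟩ := exists_frameInvolution h2 b ht
    obtain ⟨w', hw', -⟩ := exists_shear h2 hw htpq.symm 1
    have hwu : Commute w.1 u.1 := by
      rw [hw, hu]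
      exact commute_signInvolution b t s
    have hwu' : Commute w.1 u'.1 := Commute.symm (shear_mem_commutant hu hu' w ⟨t, htij, hw⟩)
    have hwu'' := commute_iff_apply.mp hwu
    have hw'u : InvolutionsCommute w' u := by
      refine commute_iff_apply.mpr fun y => ?_
      have h7 : u.1.1 (b p) = s p • b p := by rw [hu, signInvolution_basis]
      have h8 : b.coord q (u.1.1 y) = s q • b.coord q y := by rw [hu, coord_signInvolution]
      rw [hw', hw', hwu'', map_add, map_smul, one_smul, h7, h8, hspq,
        smul_comm _ (s q), smul_assoc]
    have hw'u' : InvolutionsCommute w' u' := by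
      refine commute_iff_apply.mpr fun y => ?_
      have h7 : u'.1.1 (b p) = s p • b p := by
        rw [hu', hu, signInvolution_basis]; simp [hpj]
      have h8 : b.coord q (u'.1.1 y) = s q • b.coord q y := by
        rw [hu', hu, map_add, coord_signInvolution]; simp [hqi.symm]
      rw [hw', hw', commute_iff_apply.mp hwu', map_add, map_smul, one_smul, h7, h8, hspq,
        smul_comm _ (s q), smul_assoc]
    have h5 := commute_iff_apply.mp (hv w (mem_commutant_pair.mpr ⟨hwu, hwu'⟩)) x
    have h6 := commute_iff_apply.mp (hv w' (mem_commutant_pair.mpr ⟨hw'u, hw'u'⟩)) x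
    rw [hw', hw', map_add, map_smul, one_smul, h5, add_right_inj] at h6
    exact h6.symm
  -- a vector `b l` in the eigenspace of `b i`
  have hsame_i : ∀ l, l ≠ i → s l = s i → ∀ x, b.coord l (v.1.1 x) • b i =
      b.coord l x • v.1.1 (b i) := by
    intro l hli hs
    have hlj : l ≠ j := fun h => hij (by rw [← hs, h])
    exact helem i l hli.symm hs.symm (fun h => hli h.1) (fun h => hlj h.1) hli hne
  -- a vector `b l` in the eigenspace of `b j`
  have hsame_j : ∀ l, l ≠ j → s l = s j → ∀ x, b.coord j (v.1.1 x) • b l =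
      b.coord j x • v.1.1 (b l) := by
    intro l hlj hs
    have hli : l ≠ i := fun h => hij (by rw [← hs, h])
    exact helem l j hlj hs (fun h => hne h.1.symm) (fun h => hli h.2) hne.symm hlj
  have hji : b.coord j (v.1.1 (b i)) = 0 := by
    obtain ⟨l, hl⟩ : ∃ l, l ∉ ({i, j} : Finset ι) := by
      by_contra! hcon
      have := Finset.card_le_card (fun x _ => hcon x : Finset.univ ⊆ ({i, j} : Finset ι))
      rw [Finset.card_univ, hι, Finset.card_pair hne] at this
      omega
    have hli : l ≠ i := fun h => hl (by simp [h])
    have hlj : l ≠ j := fun h => hl (by simp [h])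
    rcases sign_eq_or_eq_neg (s l) (s i) with h | h
    · have h3 := congrArg (b.coord j) (hsame_i l hli h (b l))
      rw [map_smul, map_smul] at h3
      simpa [hne] using h3.symm
    · rw [sign_ne_iff.mp hij, neg_neg] at h
      have h3 := congrArg (b.coord l) (hsame_j l hlj h (b i))
      rw [map_smul, map_smul] at h3
      simpa [hne] using h3
  have hvv := GeneralLinearGroup.mul_self_eq_one_iff.mp v.2.1
  have hdiag : ∀ l, l ≠ j → ∃ ε : ℤˣ, v.1.1 (b l) = ε • b l := by
    intro l hlj
    refine exists_sign_of_coord_eq_zero v.2.1 fun p hp => ?_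
    by_cases h3 : l = i ∧ p = j
    · rw [h3.1, h3.2, hji]
    · exact hcoord hp.symm h3 (fun h => hlj h.1)
  obtain ⟨ε, hε⟩ := hdiag i hne
  have hvj : v.1.1 (b j) = b.coord i (v.1.1 (b j)) • b i + b.coord j (v.1.1 (b j)) • b j := by
    refine b.ext_elem fun p => ?_
    change b.coord p _ = b.coord p _
    rw [map_add, map_smul, map_smul]
    by_cases hpj : p = j
    · subst hpj; simp [hne]
    by_cases hpi : p = i
    · subst hpi; simp [hne.symm]
    rw [hcoord (Ne.symm hpj) (fun h => hne h.1.symm) (fun h => hpi h.2)]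
    simp [Ne.symm hpj, Ne.symm hpi]
  set q := b.coord i (v.1.1 (b j)) with hq
  set d := b.coord j (v.1.1 (b j)) with hd
  obtain ⟨δ, hδ⟩ : ∃ δ : ℤˣ, d • b j = δ • b j := by
    have h3 := congrArg (b.coord j) (hvv (b j))
    rw [hvj, map_add, map_smul, map_smul, hε, hvj] at h3
    simp [hne] at h3
    obtain ⟨δ, hδ⟩ := exists_sign_of_mul_self_eq_one h3 (M := V)
    exact ⟨δ, hδ _⟩
  have hsign_i : ∀ l, s l = s i → v.1.1 (b l) = ε • b l := by
    intro l hl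
    by_cases hli : l = i
    · rw [hli, hε]
    have hlj : l ≠ j := fun h => hij (by rw [← hl, h])
    obtain ⟨ε', hε'⟩ := hdiag l hlj
    have h3 := hsame_i l hli hl (b l)
    rw [hε', hε, map_sign_smul] at h3
    have h4 : ε' = ε := by
      by_contra hcon
      rw [sign_ne_iff.mp hcon] at h3
      simp only [Module.Basis.coord_apply, Module.Basis.repr_self, Finsupp.single_eq_same,
        smul_assoc, one_smul] at h3
      exact b.ne_zero i (eq_zero_of_sign_smul_eq h2 h3.symm)
    rw [hε', h4]
  have hsign_j : ∀ l, l ≠ j → s l = s j → v.1.1 (b l) = δ • b l := by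
    intro l hlj hl
    have h3 := hsame_j l hlj hl (b j)
    have h4 : d = δ • (1 : R) := by
      have := congrArg (b.coord j) hδ
      rw [map_smul, map_sign_smul] at this
      simpa using this
    rw [← hd, h4] at h3
    simpa using h3.symm
  -- `v` is `± u` plus a multiple of the elementary map, unless the signs on both eigenspaces agree
  have hform : ∀ η : ℤˣ, ε = η * s i → δ = η * s j → ∀ x, v.1.1 x =
      (signInvolution b fun l => η * s l).1 x + b.coord j x • q • b i := by
    intro η h3 h4 x
    have : v.1.1 = (signInvolution b fun l => η * s l).1 + (b.coord j).smulRight (q • b i) := by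
      refine b.ext fun l => ?_
      rw [LinearMap.add_apply, signInvolution_basis, LinearMap.smulRight_apply]
      by_cases hlj : l = j
      · subst hlj
        rw [hvj, hδ, h4]
        simp [add_comm]
      · rcases sign_eq_or_eq_neg (s l) (s i) with h | h
        · rw [hsign_i l h, h3, h]; simp [hlj]
        · rw [sign_ne_iff.mp hij, neg_neg] at h
          rw [hsign_j l hlj h, h4, h]; simp [hlj]
    rw [this]
    rfl
  have hsj : s j = -s i := by rw [sign_ne_iff.mp hij, neg_neg]
  rcases sign_eq_or_eq_neg δ ε with h | h
  · exfalso
    have hq0 : q • b i = 0 := by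
      have h3 := hvv (b j)
      rw [hvj, hδ, h, map_add, map_smul, map_sign_smul, hε, hvj, hδ, h, smul_add, sign_smul_smul,
        smul_comm q ε, ← add_assoc, add_eq_right, ← two_smul R] at h3
      exact (smul_eq_zero_iff_eq ε).mp ((smul_eq_zero.mp h3).resolve_left h2)
    have hvε : v.1 = signInvolution b fun _ => ε := by
      refine eq_signInvolution fun l => ?_
      by_cases hlj : l = j
      · rw [hlj, hvj, hδ, hq0, zero_add, h]
      · rcases sign_eq_or_eq_neg (s l) (s i) with h' | h'
        · exact hsign_i l h'
        · rw [sign_ne_iff.mp hij, neg_neg] at h'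
          rw [hsign_j l hlj h', h]
    have h3 := v.2
    rw [hvε, signInvolution_mem_iff h2] at h3
    rcases Int.units_eq_one_or ε with rfl | rfl
    · simp [hι] at h3
      omega
    · simp at h3
      omega
  · rcases sign_eq_or_eq_neg ε (s i) with h' | h'
    · refine ⟨q, fun x => ?_⟩
      rw [hform 1 (by rw [h', one_mul]) (by rw [h, h', hsj, one_mul]) x, hu]
      simp
    · exfalso
      have hform' := hform (-1) (by rw [h']; simp) (by rw [h, h', hsj]; simp)
      have hcard : (Finset.univ.filter fun l => -1 * s l = 1).card = n - k := by
        have h3 := u.2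
        rw [hu, signInvolution_mem_iff h2] at h3
        have h4 := Finset.card_filter_add_card_filter_not (s := Finset.univ) fun l => s l = 1
        have h5 : (Finset.univ.filter fun l => ¬ s l = 1) =
            Finset.univ.filter fun l => -1 * s l = 1 := by
          ext l
          rcases Int.units_eq_one_or (s l) with hl | hl <;> simp [hl]
        rw [h5, h3, Finset.card_univ, hι] at h4
        omega
      obtain ⟨u₁, hu₁⟩ := exists_frameInvolution h2 b hcard
      obtain ⟨v₁, hv₁, -⟩ := exists_shear h2 hu₁ (i := i) (j := j) (by simpa using hij) q
      have hvv₁ : v.1 = v₁.1 := GeneralLinearGroup.ext_apply fun x => by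
        rw [hform', hv₁, hu₁]
      have h3 := ((mem_kInvolutions_iff h2).mp v.2).2
      have h4 := ((mem_kInvolutions_iff h2).mp v₁.2).2
      rw [hvv₁] at h3
      omega

end Bicommutant

/-! ### Adjacent pairs differ by a transvection of a common frame -/

section AdjacentPairs

variable {R V : Type*} [DivisionRing R] [AddCommGroup V] [Module R V] [FiniteDimensional R V]

section Adjacent

variable {ι : Type*} [Fintype ι] [DecidableEq ι] {n k : ℕ}

/-- If the commutant of another nearly commuting pair `u', v'` contains that of `u, v`, then `u'` and
`v'` lie in the bicommutant of `u, v`, so that their difference is a nonzero elementary map at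
`(i, j)`. Hence everything that commutes with `u'` and `v'` commutes with `u` and `v`. -/
theorem adjacentPair_shear (h2 : (2 : R) ≠ 0) (hι : Fintype.card ι = n) (hn : 3 ≤ n)
    (hk : 0 < k) (hkn : k < n) (hnk : n ≠ 2 * k) {b : Module.Basis ι R V} {s : ι → ℤˣ}
    {u v : kInvolutions R V k} (hu : u.1 = signInvolution b s) {i j : ι} (hij : s i ≠ s j) {c : R}
    (hc : c ≠ 0) (hv : ∀ x, v.1.1 x = u.1.1 x + b.coord j x • c • b i) :
    AdjacentPair InvolutionsCommute u v := by
  have hne : i ≠ j := fun h => hij (by rw [h])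
  refine ⟨nearlyCommuting_shear h2 hι hn hk hkn hnk hu hij hc hv, fun u' v' h hsub => ?_⟩
  have hbi : ∀ x ∈ ({u', v'} : Set (kInvolutions R V k)), x ∈ commutant InvolutionsCommute
      (commutant InvolutionsCommute {u, v}) := by
    intro x hx w hw
    exact Commute.symm (hsub hw x hx)
  obtain ⟨q, hq⟩ := eq_shear_of_mem_bicommutant h2 hι hn hk hkn hnk hu hij hv (hbi u' (by simp))
  obtain ⟨q', hq'⟩ := eq_shear_of_mem_bicommutant h2 hι hn hk hkn hnk hu hij hv (hbi v' (by simp))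
  have hqq : q' - q ≠ 0 := by
    intro h0
    rw [sub_eq_zero] at h0
    have : u' = v' := Subtype.ext (GeneralLinearGroup.ext_apply fun x => by rw [hq, hq', h0])
    exact h.1 (this ▸ Commute.refl _)
  intro w hw
  obtain ⟨hwu, hwv⟩ := mem_commutant_pair.mp hw
  have h1 : ∀ x, b.coord j x • (q' - q) • w.1.1 (b i) =
      b.coord j (w.1.1 x) • (q' - q) • b i := by
    intro x
    have h3 := commute_iff_apply.mp hwu x
    have h4 := commute_iff_apply.mp hwv x
    rw [hq, hq, map_add, map_smul, map_smul] at h3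
    rw [hq', hq', map_add, map_smul, map_smul] at h4
    rw [sub_smul, sub_smul, smul_sub, smul_sub]
    have h5 := congrArg₂ (· - ·) h4 h3
    simpa only [add_sub_add_left_eq_sub] using h5
  -- `b i` is an eigenvector of `w`
  have hwi : ∃ δ : ℤˣ, w.1.1 (b i) = δ • b i := by
    refine exists_sign_of_coord_eq_zero w.2.1 fun p hp => ?_
    have h3 := congrArg (b.coord p) (h1 (b j))
    simp only [map_smul, Module.Basis.coord_apply, Module.Basis.repr_self, Finsupp.single_eq_same,
      smul_eq_mul, one_mul, Finsupp.single_apply, hp.symm, if_false, mul_zero] at h3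
    exact (mul_eq_zero.mp h3).resolve_left hqq
  obtain ⟨δ, hδ⟩ := hwi
  have h5 : ∀ x, b.coord j (w.1.1 x) = δ • b.coord j x := by
    intro x
    have h3 := h1 x
    rw [hδ, smul_comm _ δ, smul_comm _ δ, smul_smul, smul_smul] at h3
    have h4 := congrArg (b.coord i) h3
    rw [map_sign_smul, map_smul, map_smul] at h4
    simp only [Module.Basis.coord_apply, Module.Basis.repr_self,
      Finsupp.single_eq_same, smul_eq_mul, mul_one] at h4
    rw [← smul_mul_assoc] at h4
    exact (mul_right_cancel₀ hqq h4).symm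
  have h6 : ∀ x (d : R), w.1.1 (b.coord j x • d • b i) = b.coord j (w.1.1 x) • d • b i := by
    intro x d
    rw [map_smul, map_smul, hδ, h5, smul_comm d, smul_comm _ δ, smul_assoc]
  have hwu0 : InvolutionsCommute w u := by
    refine commute_iff_apply.mpr fun x => ?_
    have h3 := commute_iff_apply.mp hwu x
    rw [hq, hq, map_add, h6, add_left_inj] at h3
    exact h3
  refine mem_commutant_pair.mpr ⟨hwu0, commute_iff_apply.mpr fun x => ?_⟩
  rw [hv, hv, map_add, h6, commute_iff_apply.mp hwu0]

end Adjacent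

variable {n k : ℕ}

/-- Conversely to `adjacentPair_shear`, a nearly commuting pair has a nonzero matrix entry at `(i, j)`,
say, and its commutant is contained in that of the pair formed with this entry alone. If the latter
is not larger, then `v` lies in the bicommutant of this pair. -/
theorem AdjacentPair.exists_shear (h2 : (2 : R) ≠ 0) (hV : Module.finrank R V = n) (hn : 3 ≤ n)
    (hk : 0 < k) (hkn : k < n) (hnk : n ≠ 2 * k) {u v : kInvolutions R V k}
    (h : AdjacentPair InvolutionsCommute u v) :
    ∃ (b : Module.Basis (Fin n) R V) (s : Fin n → ℤˣ) (i j : Fin n) (c : R),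
      u.1 = signInvolution b s ∧ s i ≠ s j ∧ c ≠ 0 ∧
      ∀ x, v.1.1 x = u.1.1 x + b.coord j x • c • b i := by
  have hι := Fintype.card_fin n
  obtain ⟨b, s, i, j, hu, hij, hv⟩ := h.1.exists_basis h2 hV hk hkn
  obtain ⟨i, j, c, hij, hc, hv, hcij⟩ : ∃ (i j : Fin n) (c : R), s i ≠ s j ∧ c ≠ 0 ∧
      v ∈ commutant InvolutionsCommute (pairInvolutions b k i j) ∧
      c = b.coord i (v.1.1 (b j)) := by
    by_cases hq : b.coord i (v.1.1 (b j)) = 0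
    · by_cases hr : b.coord j (v.1.1 (b i)) = 0
      · exfalso
        have hne : i ≠ j := fun h => hij (by rw [h])
        have hvf : v ∈ frameInvolutions b k := mem_frameInvolutions_of_coord fun l p hlp => by
          by_cases h3 : l = i ∧ p = j
          · rw [h3.1, h3.2, hr]
          by_cases h4 : l = j ∧ p = i
          · rw [h4.1, h4.2, hq]
          exact coord_eq_zero_of_mem_commutant h2 hι hn hk hkn hnk hne hv hlp.symm h3 h4
        exact h.1.1 (subset_commutant_frameInvolutions b subset_rfl ⟨s, hu⟩ v hvf)
      · refine ⟨j, i, _, hij.symm, hr, ?_, rfl⟩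
        rintro x ⟨t, ht, hx⟩
        exact hv x ⟨t, ht.symm, hx⟩
    · exact ⟨i, j, _, hij, hq, hv, rfl⟩
  obtain ⟨v', hv', -⟩ := _root_.exists_shear h2 hu hij c
  have hsub : commutant InvolutionsCommute {u, v} ⊆ commutant InvolutionsCommute {u, v'} := by
    intro w hw
    obtain ⟨hwu, hwv⟩ := mem_commutant_pair.mp hw
    refine mem_commutant_pair.mpr ⟨hwu, commute_iff_apply.mpr fun x => ?_⟩
    rw [hv', hv', map_add, commute_iff_apply.mp hwu, hcij,
      commute_elementary_of_commute h2 hι hn hk hkn hnk hu hij hv hwu hwv x]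
  have hsub' := h.2 u v' (nearlyCommuting_shear h2 hι hn hk hkn hnk hu hij hc hv') hsub
  obtain ⟨q, hq⟩ := eq_shear_of_mem_bicommutant h2 hι hn hk hkn hnk hu hij hv' (v := v)
    fun w hw => Commute.symm (mem_commutant_pair.mp (hsub' hw)).2
  refine ⟨b, s, i, j, q, hu, hij, ?_, hq⟩
  rintro rfl
  refine h.1.1 ?_
  have : v = u := Subtype.ext (GeneralLinearGroup.ext_apply fun x => by rw [hq]; simp)
  rw [this]
  exact Commute.refl _

/-- Adding a rank one map with image in an eigenspace and vanishing on this eigenspace produces an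
adjacent pair. -/
theorem adjacentPair_of_rankOne (h2 : (2 : R) ≠ 0) (hV : Module.finrank R V = n) (hn : 3 ≤ n)
    (hk : 0 < k) (hkn : k < n) (hnk : n ≠ 2 * k) {u v : kInvolutions R V k} {ε : ℤˣ} {x : V}
    (hx : x ∈ signSpace u.1 ε) (hx0 : x ≠ 0) {ξ : V →ₗ[R] R} (hξ : ∀ y ∈ signSpace u.1 ε, ξ y = 0)
    (hξ0 : ξ ≠ 0) (hv : ∀ y, v.1.1 y = u.1.1 y + ξ y • x) :
    AdjacentPair InvolutionsCommute u v := by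
  classical
  have hcompl := isCompl_signSpace h2 u.2.1 ε
  obtain ⟨y, hy, hy1⟩ : ∃ y ∈ signSpace u.1 (-ε), ξ y = 1 := by
    obtain ⟨z, hz⟩ : ∃ z, ξ z ≠ 0 := by
      by_contra! hcon
      exact hξ0 (LinearMap.ext hcon)
    obtain ⟨p, q, hp, hq, rfl⟩ := exists_add_of_codisjoint hcompl.codisjoint z
    rw [map_add, hξ p hp, zero_add] at hz
    exact ⟨(ξ q)⁻¹ • q, Submodule.smul_mem _ _ hq, by rw [map_smul, smul_eq_mul,
      inv_mul_cancel₀ hz]⟩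
  set t : Set V := (signSpace u.1 ε : Set V) ∪ ({y} ∪
    (signSpace u.1 (-ε) ⊓ LinearMap.ker ξ : Submodule R V)) with ht
  have hst : {x, y} ⊆ t := by
    rintro z (rfl | rfl)
    · exact Or.inl hx
    · exact Or.inr (Or.inl rfl)
  have hxy : x ≠ y := by
    rintro rfl
    rw [hξ x hx] at hy1
    exact zero_ne_one hy1
  have hli : LinearIndepOn R id {x, y} := by
    rw [LinearIndepOn.pair_iff _ hxy]
    intro a c hac
    have h3 := congrArg ξ hac
    simp only [id, map_add, map_smul, hξ x hx, hy1, smul_eq_mul, mul_one, mul_zero, zero_add,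
      map_zero] at h3
    subst h3
    refine ⟨?_, rfl⟩
    simp only [id, zero_smul, add_zero] at hac
    exact (smul_eq_zero.mp hac).resolve_right hx0
  have hspan : ⊤ ≤ Submodule.span R t := by
    intro z _
    obtain ⟨p, q, hp, hq, rfl⟩ := exists_add_of_codisjoint hcompl.codisjoint z
    refine add_mem (Submodule.subset_span (Or.inl hp)) ?_
    rw [show q = ξ q • y + (q - ξ q • y) by abel]
    refine add_mem (Submodule.smul_mem _ _ (Submodule.subset_span (Or.inr (Or.inl rfl))))
      (Submodule.subset_span (Or.inr (Or.inr ⟨sub_mem hq (Submodule.smul_mem _ _ hy), ?_⟩)))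
    change ξ _ = 0
    rw [map_sub, map_smul, hy1, smul_eq_mul, mul_one, sub_self]
  obtain ⟨ι, b, hbt, ⟨i, hi⟩, ⟨j, hj⟩⟩ : ∃ (ι : Set V) (b : Module.Basis ι R V),
      (∀ l, b l ∈ t) ∧ (∃ i, b i = x) ∧ ∃ j, b j = y :=
    ⟨_, Module.Basis.extendLe hli hst hspan,
      fun l => Module.Basis.extendLe_subset hli hst hspan ⟨l, rfl⟩,
      Module.Basis.subset_extendLe hli hst hspan (by simp),
      Module.Basis.subset_extendLe hli hst hspan (by simp)⟩
  have : Fintype ι := FiniteDimensional.fintypeBasisIndex b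
  have hdiag : ∀ l, ∃ δ : ℤˣ, u.1.1 (b l) = δ • b l := by
    intro l
    rcases hbt l with h | h | h
    · exact ⟨ε, h⟩
    · exact ⟨-ε, by rw [h]; exact hy⟩
    · exact ⟨-ε, h.1⟩
  choose s hs using hdiag
  have hξb : ξ = b.coord j := by
    refine b.ext fun l => ?_
    by_cases hl : l = j
    · rw [hl, hj, hy1, ← hj]; simp
    · rw [Module.Basis.coord_apply, Module.Basis.repr_self, Finsupp.single_eq_of_ne (Ne.symm hl)]
      rcases hbt l with h | h | h
      · exact hξ _ h
      · exact absurd (b.injective (h.trans hj.symm)) hl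
      · exact h.2
  have hsi : s i = ε := by
    by_contra hcon
    have h3 := hs i
    rw [hi, mem_signSpace.mp hx, sign_ne_iff.mp hcon] at h3
    exact hx0 (eq_zero_of_sign_smul_eq h2 h3)
  have hsj : s j = -ε := by
    by_contra hcon
    have h3 := hs j
    rw [hj, mem_signSpace.mp hy, sign_ne_iff.mp hcon, neg_neg, ← hj] at h3
    exact b.ne_zero j (eq_zero_of_sign_smul_eq h2 h3.symm)
  refine adjacentPair_shear h2 ((Module.finrank_eq_card_basis b).symm.trans hV) hn hk hkn hnk
    (eq_signInvolution hs) (i := i) (j := j) ?_ one_ne_zero (fun z => ?_)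
  · rw [hsi, hsj, sign_ne_iff, neg_neg]
  · rw [hv, hξb, one_smul, hi]

end AdjacentPairs

/-! ### Paths and triangles of adjacent involutions with a common eigenspace -/

section CommonEigenspaces

variable {R V : Type*} [DivisionRing R] [AddCommGroup V] [Module R V] [FiniteDimensional R V]
variable {n k : ℕ}

theorem finrank_signSpace_eq (h2 : (2 : R) ≠ 0) (hV : Module.finrank R V = n)
    (u : kInvolutions R V k) (ε : ℤˣ) :
    Module.finrank R (signSpace u.1 ε) = if ε = 1 then k else n - k := by
  have h1 := ((mem_kInvolutions_iff h2).mp u.2).2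
  rcases Int.units_eq_one_or ε with rfl | rfl
  · simpa using h1
  · have h3 := finrank_signSpace_add h2 u.2.1 1
    rw [if_neg (by decide)]
    omega

theorem signSpace_ne_bot (h2 : (2 : R) ≠ 0) (hV : Module.finrank R V = n) (hk : 0 < k)
    (hkn : k < n) (u : kInvolutions R V k) (ε : ℤˣ) : signSpace u.1 ε ≠ ⊥ := by
  intro h
  have h1 := finrank_signSpace_eq h2 hV u ε
  rw [h, finrank_bot] at h1
  split_ifs at h1 <;> omega

theorem signSpace_ne_top (h2 : (2 : R) ≠ 0) (hV : Module.finrank R V = n) (hk : 0 < k)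
    (hkn : k < n) (u : kInvolutions R V k) (ε : ℤˣ) : signSpace u.1 ε ≠ ⊤ := by
  intro h
  have h1 := finrank_signSpace_eq h2 hV u ε
  rw [h, finrank_top] at h1
  split_ifs at h1 <;> omega

omit [FiniteDimensional R V] in
theorem kInvolutions_eq_of_signSpace_eq (h2 : (2 : R) ≠ 0) {u v : kInvolutions R V k} {ε δ : ℤˣ}
    (hεδ : ε ≠ δ) (h : signSpace u.1 ε = signSpace v.1 ε) (h' : signSpace u.1 δ = signSpace v.1 δ) :
    u = v := by
  rw [sign_ne_iff.mp hεδ.symm] at h'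
  exact Subtype.ext (eq_of_signSpace_eq h2 u.2.1 h h')

theorem exists_kInvolution (h2 : (2 : R) ≠ 0) {S U : Submodule R V} (h : IsCompl S U)
    (hS : Module.finrank R S = k) :
    ∃ u : kInvolutions R V k, signSpace u.1 1 = S ∧ signSpace u.1 (-1) = U := by
  obtain ⟨u, hu, h1, h3⟩ := exists_signSpace_eq h2 h 1
  exact ⟨⟨u, (mem_kInvolutions_iff h2).mpr ⟨hu, by rw [h1, hS]⟩⟩, h1, h3⟩

omit [FiniteDimensional R V] in
theorem AdjacentPair.ne {u v : kInvolutions R V k} (h : AdjacentPair InvolutionsCommute u v) :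
    u ≠ v := by
  rintro rfl
  exact h.1.1 (Commute.refl _)

theorem AdjacentPair.exists_signSpace_eq (h2 : (2 : R) ≠ 0) (hV : Module.finrank R V = n)
    (hn : 3 ≤ n) (hk : 0 < k) (hkn : k < n) (hnk : n ≠ 2 * k) {u v : kInvolutions R V k}
    (h : AdjacentPair InvolutionsCommute u v) : ∃ ε, signSpace u.1 ε = signSpace v.1 ε := by
  obtain ⟨b, s, i, j, c, hu, hij, -, hv⟩ := h.exists_shear h2 hV hn hk hkn hnk
  obtain ⟨v', hv', h3⟩ := _root_.exists_shear h2 hu hij c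
  have : v = v' := Subtype.ext (GeneralLinearGroup.ext_apply fun x => by rw [hv, hv'])
  exact ⟨s i, by rw [this, h3]⟩

/-- `v` arises from `u` by adding a map `y ↦ ξ y • x` with `x` in the `ε`-eigenspace of `u` and `ξ`
vanishing on this eigenspace; so `v` has the same `ε`-eigenspace. -/
def RankOneStep (ε : ℤˣ) (u v : kInvolutions R V k) : Prop :=
  ∃ (x : V) (ξ : V →ₗ[R] R), x ∈ signSpace u.1 ε ∧ (∀ y ∈ signSpace u.1 ε, ξ y = 0) ∧
    ∀ y, v.1.1 y = u.1.1 y + ξ y • x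

theorem RankOneStep.signSpace_eq (h2 : (2 : R) ≠ 0) {ε : ℤˣ} {u v : kInvolutions R V k}
    (h : RankOneStep ε u v) : signSpace v.1 ε = signSpace u.1 ε := by
  obtain ⟨x, ξ, hx, hξ, hv⟩ := h
  obtain ⟨v', hv', h3⟩ := exists_add_smulRight h2 u ε (ξ.smulRight x)
    (fun y hy => by rw [LinearMap.smulRight_apply, hξ y hy, zero_smul])
    (fun y => Submodule.smul_mem _ _ hx)
  have : v = v' := Subtype.ext (GeneralLinearGroup.ext_apply fun x => by rw [hv, hv']; rfl)
  rw [this, h3]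

theorem exists_rankOneStep (h2 : (2 : R) ≠ 0) {ε : ℤˣ} {u : kInvolutions R V k} {x : V}
    {ξ : V →ₗ[R] R} (hx : x ∈ signSpace u.1 ε) (hξ : ∀ y ∈ signSpace u.1 ε, ξ y = 0) :
    ∃ v : kInvolutions R V k, ∀ y, v.1.1 y = u.1.1 y + ξ y • x := by
  obtain ⟨v', hv', -⟩ := exists_add_smulRight h2 u ε (ξ.smulRight x)
    (fun y hy => by rw [LinearMap.smulRight_apply, hξ y hy, zero_smul])
    (fun y => Submodule.smul_mem _ _ hx)
  exact ⟨v', hv'⟩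

theorem RankOneStep.symm (h2 : (2 : R) ≠ 0) {ε : ℤˣ} {u v : kInvolutions R V k}
    (h : RankOneStep ε u v) : RankOneStep ε v u := by
  have h3 := h.signSpace_eq h2
  obtain ⟨x, ξ, hx, hξ, hv⟩ := h
  refine ⟨x, -ξ, by rwa [h3], fun y hy => ?_, fun y => ?_⟩
  · rw [h3] at hy
    rw [LinearMap.neg_apply, hξ y hy, neg_zero]
  · rw [hv, LinearMap.neg_apply, neg_smul]
    abel

theorem RankOneStep.eq_or_adjacentPair (h2 : (2 : R) ≠ 0) (hV : Module.finrank R V = n)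
    (hn : 3 ≤ n) (hk : 0 < k) (hkn : k < n) (hnk : n ≠ 2 * k) {ε : ℤˣ} {u v : kInvolutions R V k}
    (h : RankOneStep ε u v) : u = v ∨ AdjacentPair InvolutionsCommute u v := by
  obtain ⟨x, ξ, hx, hξ, hv⟩ := h
  by_cases h0 : x = 0 ∨ ξ = 0
  · left
    refine Subtype.ext (GeneralLinearGroup.ext_apply fun y => ?_)
    rw [hv]
    rcases h0 with rfl | rfl <;> simp
  · push Not at h0
    exact Or.inr (adjacentPair_of_rankOne h2 hV hn hk hkn hnk hx h0.1 hξ h0.2 hv)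

/-- Each eigenspace of an involution belongs to a further involution as well. -/
theorem exists_rankOneStep_ne (h2 : (2 : R) ≠ 0) (hV : Module.finrank R V = n)
    (hn : 3 ≤ n) (hk : 0 < k) (hkn : k < n) (hnk : n ≠ 2 * k) (ε : ℤˣ) (u : kInvolutions R V k) :
    ∃ v, RankOneStep ε u v ∧ u ≠ v := by
  obtain ⟨x, hx, hx0⟩ := Submodule.exists_mem_ne_zero_of_ne_bot
    (signSpace_ne_bot h2 hV hk hkn u ε)
  obtain ⟨ξ, hξ0, hξ⟩ := Submodule.exists_le_ker_of_lt_top _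
    (lt_top_iff_ne_top.mpr (signSpace_ne_top h2 hV hk hkn u ε))
  obtain ⟨v, hv⟩ := exists_rankOneStep h2 hx (fun y hy => hξ hy)
  exact ⟨v, ⟨x, ξ, hx, fun y hy => hξ hy, hv⟩,
    (adjacentPair_of_rankOne h2 hV hn hk hkn hnk hx hx0 (fun y hy => hξ hy) hξ0 hv).ne⟩

/-- Two involutions with a common eigenspace are connected by rank one steps keeping it. -/
theorem reflTransGen_rankOneStep (h2 : (2 : R) ≠ 0) {ε : ℤˣ} {u v : kInvolutions R V k}
    (h : signSpace v.1 ε = signSpace u.1 ε) : Relation.ReflTransGen (RankOneStep ε) u v := by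
  classical
  obtain ⟨b, hb⟩ := exists_basis_signInvolution h2 rfl {u.1} (by rintro _ rfl; exact u.2.1)
    (by rintro _ rfl _ rfl; exact Commute.refl _)
  obtain ⟨s, hs⟩ := hb u.1 rfl
  set N : V →ₗ[R] V := v.1.1 - u.1.1 with hN
  have hN0 : ∀ y ∈ signSpace u.1 ε, N y = 0 := by
    intro y hy
    have hy' := hy
    rw [← h] at hy'
    rw [hN, LinearMap.sub_apply, mem_signSpace.mp hy, mem_signSpace.mp hy', sub_self]
  have hNε : ∀ y, N y ∈ signSpace u.1 ε := by
    intro y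
    obtain ⟨p, q, hp, hq, rfl⟩ := exists_add_of_codisjoint (isCompl_signSpace h2 u.2.1 ε).codisjoint y
    rw [map_add, hN0 p hp, zero_add, ← h, mem_signSpace, hN, LinearMap.sub_apply, map_sub,
      GeneralLinearGroup.mul_self_eq_one_iff.mp v.2.1, mem_signSpace.mp hq, map_sign_smul, smul_sub, Units.neg_smul,
      Units.neg_smul, smul_neg, sign_smul_smul]
    abel
  have key : ∀ J : Finset (Fin (Module.finrank R V)), ∃ w : kInvolutions R V k,
      (∀ y, w.1.1 y = u.1.1 y + ∑ j ∈ J, b.coord j y • N (b j)) ∧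
      signSpace w.1 ε = signSpace u.1 ε ∧ Relation.ReflTransGen (RankOneStep ε) u w := by
    intro J
    induction J using Finset.induction_on with
    | empty => exact ⟨u, by simp, rfl, Relation.ReflTransGen.refl⟩
    | insert j J hj ih =>
      obtain ⟨w, hw, hwε, huw⟩ := ih
      by_cases hsj : s j = ε
      · refine ⟨w, fun y => ?_, hwε, huw⟩
        rw [Finset.sum_insert hj, hN0 (b j), smul_zero, zero_add, hw]
        rw [mem_signSpace, hs, signInvolution_basis, hsj]
      · have hx : N (b j) ∈ signSpace w.1 ε := by rw [hwε]; exact hNε _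
        have hξ : ∀ y ∈ signSpace w.1 ε, b.coord j y = 0 := by
          intro y hy
          rw [hwε, hs, signSpace_signInvolution h2, mem_coordSpace] at hy
          exact hy j (by simpa using hsj)
        obtain ⟨w', hw'⟩ := exists_rankOneStep h2 hx hξ
        have hstep : RankOneStep ε w w' := ⟨_, _, hx, hξ, hw'⟩
        refine ⟨w', fun y => ?_, (hstep.signSpace_eq h2).trans hwε, huw.tail hstep⟩
        rw [hw', hw, Finset.sum_insert hj]
        abel
  obtain ⟨w, hw, -, huw⟩ := key Finset.univ
  have : v = w := by
    refine Subtype.ext (GeneralLinearGroup.ext_apply fun y => ?_)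
    rw [hw]
    have h3 : ∑ j, b.coord j y • N (b j) = N y := by
      conv_rhs => rw [← b.sum_repr y]
      rw [map_sum]
      exact Finset.sum_congr rfl fun j _ => by rw [map_smul]; rfl
    rw [h3, hN, LinearMap.sub_apply, add_sub_cancel]
  rwa [this]

omit [FiniteDimensional R V] in
/-- If `a ≠ b` share the `δ`-eigenspace, and `c` shares some eigenspace with each of them, then all
three share the `δ`-eigenspace. -/
theorem signSpace_eq_of_triangle (h2 : (2 : R) ≠ 0) {a b c : kInvolutions R V k} {δ : ℤˣ}
    (hab : a ≠ b) (h : signSpace a.1 δ = signSpace b.1 δ)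
    (hac : ∃ γ, signSpace a.1 γ = signSpace c.1 γ) (hbc : ∃ γ, signSpace b.1 γ = signSpace c.1 γ) :
    signSpace a.1 δ = signSpace c.1 δ := by
  obtain ⟨γ, hac⟩ := hac
  obtain ⟨γ', hbc⟩ := hbc
  by_contra hcon
  have h3 : γ ≠ δ := fun h => hcon (h ▸ hac)
  have h4 : γ' ≠ δ := fun h' => hcon (h.trans (h' ▸ hbc))
  rw [sign_ne_iff] at h3 h4
  subst h3 h4
  refine hab (kInvolutions_eq_of_signSpace_eq h2 (ε := δ) (δ := -δ) ?_ h (hac.trans hbc.symm))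
  rw [sign_ne_iff, neg_neg]

/-- Two subspaces of the same dimension have a common complement. -/
theorem exists_common_isCompl (d : ℕ) : ∀ S T : Submodule R V,
    Module.finrank R S + d = Module.finrank R V → Module.finrank R T + d = Module.finrank R V →
    ∃ C, IsCompl S C ∧ IsCompl T C := by
  induction d with
  | zero =>
    intro S T hS hT
    rw [Submodule.eq_top_of_finrank_eq hS, Submodule.eq_top_of_finrank_eq hT]
    exact ⟨⊥, isCompl_top_bot, isCompl_top_bot⟩
  | succ d ih =>
    intro S T hS hT
    have hlt : ∀ W : Submodule R V, Module.finrank R W + (d + 1) = Module.finrank R V → W ≠ ⊤ := by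
      rintro W hW rfl
      rw [finrank_top] at hW
      omega
    obtain ⟨x, hxS, hxT⟩ : ∃ x, x ∉ S ∧ x ∉ T := by
      by_contra! hcon
      have hST : ∀ x, x ∈ S ∨ x ∈ T := fun x => or_iff_not_imp_left.mpr (hcon x)
      obtain ⟨y, -, hy⟩ := SetLike.exists_of_lt (lt_top_iff_ne_top.mpr (hlt S hS))
      obtain ⟨z, -, hz⟩ := SetLike.exists_of_lt (lt_top_iff_ne_top.mpr (hlt T hT))
      have hyT := (hST y).resolve_left hy
      have hzS := (hST z).resolve_right hz
      rcases hST (y + z) with h | h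
      · exact hy ((Submodule.add_mem_iff_left S hzS).mp h)
      · exact hz ((Submodule.add_mem_iff_right T hyT).mp h)
    have hx0 : x ≠ 0 := fun h => hxS (h ▸ zero_mem S)
    have hdisj : ∀ W : Submodule R V, x ∉ W → Disjoint W (Submodule.span R {x}) := fun W hW =>
      (Submodule.disjoint_span_singleton' hx0).mpr hW
    have hrank : ∀ W : Submodule R V, x ∉ W →
        Module.finrank R (W ⊔ Submodule.span R {x} : Submodule R V) = Module.finrank R W + 1 := by
      intro W hW
      have h3 := Submodule.finrank_sup_add_finrank_inf_eq W (Submodule.span R {x})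
      rw [(hdisj W hW).eq_bot, finrank_bot, finrank_span_singleton hx0, add_zero] at h3
      exact h3
    obtain ⟨C, hSC, hTC⟩ := ih (S ⊔ Submodule.span R {x}) (T ⊔ Submodule.span R {x})
      (by rw [hrank S hxS]; omega) (by rw [hrank T hxT]; omega)
    have hcompl : ∀ W : Submodule R V, x ∉ W → IsCompl (W ⊔ Submodule.span R {x}) C →
        IsCompl W (Submodule.span R {x} ⊔ C) := by
      intro W hW h
      refine ⟨?_, ?_⟩
      · exact (hdisj W hW).disjoint_sup_right_of_disjoint_sup_left h.disjoint
      · rw [codisjoint_iff, ← sup_assoc]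
        exact h.sup_eq_top
    exact ⟨_, hcompl S hxS hSC, hcompl T hxT hTC⟩

end CommonEigenspaces

/-! ### A commutation isomorphism keeps or exchanges the signs of eigenspaces -/

section SignsOfEigenspaces

variable {R V : Type*} [DivisionRing R] [AddCommGroup V] [Module R V] [FiniteDimensional R V]
variable {R' V' : Type*} [DivisionRing R'] [AddCommGroup V'] [Module R' V']
  [FiniteDimensional R' V']
variable {n k : ℕ}

/-- Along all rank one steps from `u` which keep the `ε`-eigenspace, the images under a commutation
isomorphism keep the eigenspace of one and the same sign. -/
theorem signSpace_map_eq_of_rankOneStep (h2 : (2 : R) ≠ 0) (h2' : (2 : R') ≠ 0)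
    (hV : Module.finrank R V = n) (hV' : Module.finrank R' V' = n) (hn : 3 ≤ n) (hk : 0 < k)
    (hkn : k < n) (hnk : n ≠ 2 * k)
    (f : (InvolutionsCommute (R := R) (V := V) (k := k)) ≃r
      (InvolutionsCommute (R := R') (V := V') (k := k)))
    {ε δ : ℤˣ} {u v w : kInvolutions R V k} (huv : RankOneStep ε u v) (hne : u ≠ v)
    (h : signSpace (f u).1 δ = signSpace (f v).1 δ) (huw : RankOneStep ε u w) :
    signSpace (f u).1 δ = signSpace (f w).1 δ := by
  have hshare : ∀ {a b : kInvolutions R V k}, RankOneStep ε a b →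
      ∃ γ, signSpace (f a).1 γ = signSpace (f b).1 γ := by
    intro a b hab
    rcases hab.eq_or_adjacentPair h2 hV hn hk hkn hnk with rfl | hab
    · exact ⟨1, rfl⟩
    · exact (hab.map f).exists_signSpace_eq h2' hV' hn hk hkn hnk
  obtain ⟨x, ξ, hx, hξ, hv⟩ := id huv
  obtain ⟨y, ζ, hy, hζ, hw⟩ := id huw
  -- the intermediate involution which takes its functional from `v` and its vector from `w`
  obtain ⟨m, hm⟩ := exists_rankOneStep h2 hy hξ
  have hum : RankOneStep ε u m := ⟨y, ξ, hy, hξ, hm⟩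
  have hum' := hum.signSpace_eq h2
  have hv' := huv.signSpace_eq h2
  have hvm : RankOneStep ε v m := by
    refine ⟨y - x, ξ, ?_, ?_, fun z => ?_⟩
    · rw [hv']; exact sub_mem hy hx
    · rw [hv']; exact hξ
    · rw [hm, hv, smul_sub]; abel
  have hmw : RankOneStep ε m w := by
    refine ⟨y, ζ - ξ, ?_, fun z hz => ?_, fun z => ?_⟩
    · rw [hum']; exact hy
    · rw [hum'] at hz
      rw [LinearMap.sub_apply, hζ z hz, hξ z hz, sub_zero]
    · rw [hm, hw, LinearMap.sub_apply, sub_smul]; abel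
  have h3 := signSpace_eq_of_triangle h2' (f.injective.ne hne) h (hshare hum) (hshare hvm)
  by_cases hmu : u = m
  · -- then `y = 0`, so that `w = u`
    have hξ0 : ∃ z, ξ z ≠ 0 := by
      by_contra! hcon
      refine hne (Subtype.ext (GeneralLinearGroup.ext_apply fun z => ?_))
      rw [hv, hcon, zero_smul, add_zero]
    obtain ⟨z, hz⟩ := hξ0
    have h4 := hm z
    rw [← hmu, eq_comm, add_eq_left] at h4
    have hy0 := (smul_eq_zero.mp h4).resolve_left hz
    have : u = w := Subtype.ext (GeneralLinearGroup.ext_apply fun z => by rw [hw, hy0]; simp)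
    rw [← this]
  · exact signSpace_eq_of_triangle h2' (f.injective.ne hmu) h3 (hshare huw) (hshare hmw)

/-- Involutions with the same `ε`-eigenspace as `u` are mapped to involutions sharing the eigenspace
of one and the same sign. -/
theorem exists_sign_signSpace_map (h2 : (2 : R) ≠ 0) (h2' : (2 : R') ≠ 0)
    (hV : Module.finrank R V = n) (hV' : Module.finrank R' V' = n) (hn : 3 ≤ n) (hk : 0 < k)
    (hkn : k < n) (hnk : n ≠ 2 * k)
    (f : (InvolutionsCommute (R := R) (V := V) (k := k)) ≃r
      (InvolutionsCommute (R := R') (V := V') (k := k))) (u : kInvolutions R V k) (ε : ℤˣ) :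
    ∃ δ : ℤˣ, ∀ v : kInvolutions R V k, signSpace v.1 ε = signSpace u.1 ε →
      signSpace (f u).1 δ = signSpace (f v).1 δ := by
  obtain ⟨v₀, huv₀, hne₀⟩ := exists_rankOneStep_ne h2 hV hn hk hkn hnk ε u
  obtain ⟨δ, hδ⟩ : ∃ δ, signSpace (f u).1 δ = signSpace (f v₀).1 δ :=
    (((huv₀.eq_or_adjacentPair h2 hV hn hk hkn hnk).resolve_left hne₀).map f).exists_signSpace_eq
      h2' hV' hn hk hkn hnk
  refine ⟨δ, fun v hv => ?_⟩
  have key : signSpace (f u).1 δ = signSpace (f v).1 δ ∧ ∀ w, RankOneStep ε v w →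
      signSpace (f v).1 δ = signSpace (f w).1 δ := by
    refine Relation.ReflTransGen.trans_induction_on (motive := fun {a b} _ =>
      (∀ w, RankOneStep ε a w → signSpace (f a).1 δ = signSpace (f w).1 δ) →
      signSpace (f a).1 δ = signSpace (f b).1 δ ∧
      ∀ w, RankOneStep ε b w → signSpace (f b).1 δ = signSpace (f w).1 δ)
      (reflTransGen_rankOneStep h2 hv) ?_ ?_ ?_ ?_
    · exact fun a ha => ⟨rfl, ha⟩
    · intro a b hab ha
      refine ⟨ha b hab, ?_⟩
      by_cases hne : a = b
      · exact hne ▸ ha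
      · intro w hw
        exact signSpace_map_eq_of_rankOneStep h2 h2' hV hV' hn hk hkn hnk f (hab.symm h2)
          (Ne.symm hne) (ha b hab).symm hw
    · intro a b c _ _ hab hbc ha
      obtain ⟨h3, h4⟩ := hab ha
      obtain ⟨h5, h6⟩ := hbc h4
      exact ⟨h3.trans h5, h6⟩
    · intro w hw
      exact signSpace_map_eq_of_rankOneStep h2 h2' hV hV' hn hk hkn hnk f huv₀ hne₀ hδ hw
  exact key.1

/-- A commutation isomorphism either preserves or exchanges the two relations of sharing the
`1`-eigenspace and of sharing the `-1`-eigenspace. -/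
theorem exists_sign_forall_signSpace_map (h2 : (2 : R) ≠ 0) (h2' : (2 : R') ≠ 0)
    (hV : Module.finrank R V = n) (hV' : Module.finrank R' V' = n) (hn : 3 ≤ n) (hk : 0 < k)
    (hkn : k < n) (hnk : n ≠ 2 * k)
    (f : (InvolutionsCommute (R := R) (V := V) (k := k)) ≃r
      (InvolutionsCommute (R := R') (V := V') (k := k))) :
    ∃ η : ℤˣ, ∀ (u v : kInvolutions R V k) (ε : ℤˣ), signSpace u.1 ε = signSpace v.1 ε →
      signSpace (f u).1 (η * ε) = signSpace (f v).1 (η * ε) := by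
  have hex : ∀ (u : kInvolutions R V k) (ε : ℤˣ), ∃ v, u ≠ v ∧ signSpace v.1 ε = signSpace u.1 ε :=
    fun u ε => by
      obtain ⟨v, huv, hne⟩ := exists_rankOneStep_ne h2 hV hn hk hkn hnk ε u
      exact ⟨v, hne, huv.signSpace_eq h2⟩
  -- the sign `η` at a single involution
  have hloc : ∀ u : kInvolutions R V k, ∃ η : ℤˣ, ∀ (v : kInvolutions R V k) (ε : ℤˣ),
      signSpace v.1 ε = signSpace u.1 ε →
      signSpace (f u).1 (η * ε) = signSpace (f v).1 (η * ε) := by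
    intro u
    obtain ⟨δ₁, h₁⟩ := exists_sign_signSpace_map h2 h2' hV hV' hn hk hkn hnk f u 1
    obtain ⟨δ₂, h₂⟩ := exists_sign_signSpace_map h2 h2' hV hV' hn hk hkn hnk f u (-1)
    have hδ : δ₁ ≠ δ₂ := by
      rintro rfl
      obtain ⟨v₁, hv₁, hv₁'⟩ := hex u 1
      obtain ⟨v₂, hv₂, hv₂'⟩ := hex u (-1)
      obtain ⟨γ, hγ⟩ := exists_sign_signSpace_map h2' h2 hV' hV hn hk hkn hnk f.symm (f u) δ₁
      have h3 := hγ (f v₁) (h₁ v₁ hv₁').symm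
      have h4 := hγ (f v₂) (h₂ v₂ hv₂').symm
      simp only [RelIso.symm_apply_apply] at h3 h4
      rcases Int.units_eq_one_or γ with rfl | rfl
      · exact hv₂ (kInvolutions_eq_of_signSpace_eq h2 (by decide) h4 hv₂'.symm)
      · exact hv₁ (kInvolutions_eq_of_signSpace_eq h2 (by decide) h3 hv₁'.symm)
    rw [sign_ne_iff] at hδ
    refine ⟨δ₁, fun v ε hv => ?_⟩
    rcases Int.units_eq_one_or ε with rfl | rfl
    · rw [mul_one]; exact h₁ v hv
    · rw [hδ, neg_mul_neg, mul_one]; exact h₂ v hv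
  -- it is constant along involutions sharing an eigenspace
  have hstep : ∀ (u v : kInvolutions R V k) (ε : ℤˣ), signSpace v.1 ε = signSpace u.1 ε →
      ∀ η : ℤˣ, (∀ (w : kInvolutions R V k) (ε : ℤˣ), signSpace w.1 ε = signSpace u.1 ε →
        signSpace (f u).1 (η * ε) = signSpace (f w).1 (η * ε)) →
      ∀ (w : kInvolutions R V k) (ε : ℤˣ), signSpace w.1 ε = signSpace v.1 ε →
        signSpace (f v).1 (η * ε) = signSpace (f w).1 (η * ε) := by
    intro u v ε huv η hη
    by_cases hne : u = v
    · rwa [← hne]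
    obtain ⟨η', hη'⟩ := hloc v
    suffices η' = η by rwa [← this]
    by_contra hcon
    refine hne (f.injective (kInvolutions_eq_of_signSpace_eq h2' (ε := η * ε) (δ := η' * ε) ?_
      (hη v ε huv) (hη' u ε huv.symm).symm))
    exact fun h => hcon (mul_right_cancel h).symm
  obtain ⟨u₀⟩ : Nonempty (kInvolutions R V k) := by
    obtain ⟨b⟩ : Nonempty (Module.Basis (Fin n) R V) := ⟨Module.finBasisOfFinrankEq R V hV⟩
    obtain ⟨s, hs, -⟩ := exists_signs_ne (Fintype.card_fin n) hk hkn
      (i := ⟨0, by omega⟩) (j := ⟨1, by omega⟩) (by simp)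
    exact ⟨⟨_, (signInvolution_mem_iff h2 b s).mpr hs⟩⟩
  obtain ⟨η, hη⟩ := hloc u₀
  refine ⟨η, fun u v ε huv => ?_⟩
  have hrank : ∀ w : kInvolutions R V k, Module.finrank R (signSpace w.1 1) + (n - k) =
      Module.finrank R V := by
    intro w
    rw [finrank_signSpace_eq h2 hV, if_pos rfl]
    omega
  obtain ⟨C, hC₀, hC⟩ := exists_common_isCompl (n - k) _ _ (hrank u₀) (hrank u)
  obtain ⟨w₁, h₁, h₁'⟩ := exists_kInvolution h2 hC₀ ((mem_kInvolutions_iff h2).mp u₀.2).2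
  obtain ⟨w₂, h₂, h₂'⟩ := exists_kInvolution h2 hC ((mem_kInvolutions_iff h2).mp u.2).2
  have hη₁ := hstep u₀ w₁ 1 h₁ η hη
  have hη₂ := hstep w₁ w₂ (-1) (h₂'.trans h₁'.symm) η hη₁
  exact hstep w₂ u 1 h₂.symm η hη₂ v ε huv.symm

end SignsOfEigenspaces

/-! ### The fundamental theorem of projective geometry -/

section ProjectiveGeometry

variable {R V : Type*} [DivisionRing R] [AddCommGroup V] [Module R V]
variable {R' V' : Type*} [DivisionRing R'] [AddCommGroup V'] [Module R' V']

theorem smul_add_smul_eq_zero {x y : V} (hx : x ≠ 0) (hy : y ∉ Submodule.span R {x}) {a b : R}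
    (h : a • x + b • y = 0) : a = 0 ∧ b = 0 := by
  have hb : b = 0 := by
    by_contra hb
    refine hy (Submodule.mem_span_singleton.mpr ⟨-(b⁻¹ * a), ?_⟩)
    rw [eq_neg_of_add_eq_zero_left h |> fun h' => show -(b⁻¹ * a) • x = -(b⁻¹ • a • x) by
      rw [neg_smul, mul_smul], eq_neg_of_add_eq_zero_left h, smul_neg, neg_neg, smul_smul,
      inv_mul_cancel₀ hb, one_smul]
  subst hb
  rw [zero_smul, add_zero] at h
  exact ⟨(smul_eq_zero.mp h).resolve_right hx, rfl⟩

theorem smul_add_smul_add_smul_eq_zero {x y z : V} (hz : z ∉ Submodule.span R {x, y}) (hx : x ≠ 0)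
    (hy : y ∉ Submodule.span R {x}) {a b c : R} (h : c • z + a • x + b • y = 0) :
    c = 0 ∧ a = 0 ∧ b = 0 := by
  have hc : c = 0 := by
    by_contra hc
    refine hz ?_
    have h1 : z = (-(c⁻¹ * a)) • x + (-(c⁻¹ * b)) • y := by
      have h3 : c • z = -(a • x) - b • y := by
        rw [add_assoc] at h
        rw [eq_neg_of_add_eq_zero_left h]
        abel
      rw [← one_smul R z, ← inv_mul_cancel₀ hc, mul_smul, h3, smul_sub, smul_neg, smul_smul,
        smul_smul, neg_smul, neg_smul, sub_eq_add_neg]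
    exact Submodule.mem_span_pair.mpr ⟨_, _, h1.symm⟩
  subst hc
  rw [zero_smul, zero_add] at h
  exact ⟨rfl, smul_add_smul_eq_zero hx hy h⟩

/-- The fundamental theorem of projective geometry in terms of representing vectors: a map
`g : V → V'` inducing a collineation between the projective spaces of `V` and `V'`, which are not
lines, coincides up to scalar factors with a semilinear bijection. -/
theorem exists_semilinear_of_collineation (hdim : ∀ x y : V, ∃ z, z ∉ Submodule.span R {x, y})
    (g : V → V') (hg0 : ∀ x, g x = 0 ↔ x = 0)
    (hg : ∀ x y z, z ∈ Submodule.span R {x, y} ↔ g z ∈ Submodule.span R' {g x, g y})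
    (hsurj : ∀ y, ∃ (x : V) (c : R'), y = c • g x) :
    ∃ (σ : R ≃+* R') (l : V ≃+ V'), (∀ (a : R) (x : V), l (a • x) = σ a • l x) ∧
      ∀ x, ∃ c : R', c ≠ 0 ∧ l x = c • g x := by
  classical
  have hg1 : ∀ x z, z ∈ Submodule.span R {x} ↔ g z ∈ Submodule.span R' {g x} := by
    intro x z
    have := hg x x z
    rwa [Set.pair_eq_singleton, Set.pair_eq_singleton] at this
  obtain ⟨e, he⟩ := hdim 0 0
  have he0 : e ≠ 0 := fun h => he (by rw [h]; exact zero_mem _)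
  obtain ⟨ξ, hξ0, -⟩ := Submodule.exists_le_ker_of_notMem
    (p := (⊥ : Submodule R V)) (v := e) (by simpa using he0)
  wlog hξe : ξ e = 1 generalizing e
  · refine this ((ξ e)⁻¹ • e) ?_ ?_ ?_ ?_
    · intro h
      exact he ((Submodule.smul_mem_iff _ (inv_ne_zero hξ0)).mp h)
    · exact smul_ne_zero (inv_ne_zero hξ0) he0
    · rw [map_smul, smul_eq_mul, inv_mul_cancel₀ hξ0]; exact one_ne_zero
    · rw [map_smul, smul_eq_mul, inv_mul_cancel₀ hξ0]
  have heH : ∀ h k, ξ h = 0 → ξ k = 0 → e ∉ Submodule.span R {h, k} := by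
    intro h k hh hk he
    obtain ⟨a, b, hab⟩ := Submodule.mem_span_pair.mp he
    rw [← hab, map_add, map_smul, map_smul, hh, hk, smul_zero, smul_zero, add_zero] at hξe
    exact zero_ne_one hξe
  have heH1 : ∀ h, ξ h = 0 → e ∉ Submodule.span R {h} := by
    intro h hh
    have := heH h h hh hh
    rwa [Set.pair_eq_singleton] at this
  -- normalization of the representing vectors of the points of the hyperplane `ξ = 0`
  have hex : ∀ h, ∃ y : V', ξ h = 0 → (h = 0 → y = 0) ∧ (∃ c : R', c ≠ 0 ∧ y = c • g h) ∧
      ∃ d : R', d ≠ 0 ∧ g (e + h) = d • (g e + y) := by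
    intro h
    by_cases hh : ξ h = 0
    · by_cases h0 : h = 0
      · refine ⟨0, fun _ => ⟨fun _ => rfl, ⟨1, one_ne_zero, ?_⟩, 1, one_ne_zero, ?_⟩⟩
        · rw [h0, (hg0 0).mpr rfl, smul_zero]
        · rw [h0, add_zero, add_zero, one_smul]
      · have h1 : e + h ∈ Submodule.span R {e, h} :=
          Submodule.mem_span_pair.mpr ⟨1, 1, by simp⟩
        rw [hg] at h1
        obtain ⟨α, β, hαβ⟩ := Submodule.mem_span_pair.mp h1
        have hα : α ≠ 0 := by
          rintro rfl
          rw [zero_smul, zero_add] at hαβ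
          have h3 : e + h ∈ Submodule.span R {h} :=
            (hg1 _ _).mpr (Submodule.mem_span_singleton.mpr ⟨β, hαβ⟩)
          exact heH1 h hh
            ((Submodule.add_mem_iff_left _ (Submodule.mem_span_singleton_self h)).mp h3)
        have hβ : β ≠ 0 := by
          rintro rfl
          rw [zero_smul, add_zero] at hαβ
          have h3 : e + h ∈ Submodule.span R {e} :=
            (hg1 _ _).mpr (Submodule.mem_span_singleton.mpr ⟨α, hαβ⟩)
          have h4 := (Submodule.add_mem_iff_right _ (Submodule.mem_span_singleton_self e)).mp h3
          obtain ⟨a, rfl⟩ := Submodule.mem_span_singleton.mp h4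
          rw [map_smul, hξe, smul_eq_mul, mul_one] at hh
          exact h0 (by rw [hh, zero_smul])
        refine ⟨(α⁻¹ * β) • g h, fun _ => ⟨fun h => absurd h h0,
          ⟨_, mul_ne_zero (inv_ne_zero hα) hβ, rfl⟩, α, hα, ?_⟩⟩
        rw [smul_add, smul_smul, ← mul_assoc, mul_inv_cancel₀ hα, one_mul, hαβ]
    · exact ⟨0, fun h => absurd h hh⟩
  choose l hl using hex
  have hl0 : l 0 = 0 := (hl 0 (map_zero ξ)).1 rfl
  have hlg : ∀ h, ξ h = 0 → ∃ c : R', c ≠ 0 ∧ l h = c • g h := fun h hh => (hl h hh).2.1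
  have hle : ∀ h, ξ h = 0 → ∃ d : R', d ≠ 0 ∧ g (e + h) = d • (g e + l h) :=
    fun h hh => (hl h hh).2.2
  have hlne : ∀ h, ξ h = 0 → h ≠ 0 → l h ≠ 0 := by
    intro h hh h0
    obtain ⟨c, hc, hlc⟩ := hlg h hh
    rw [hlc]
    exact smul_ne_zero hc fun h' => h0 ((hg0 h).mp h')
  have hlspan : ∀ h k z, ξ h = 0 → ξ k = 0 → ξ z = 0 → z ∈ Submodule.span R {h, k} →
      ∃ a b : R', l z = a • l h + b • l k := by
    intro h k z hh hk hz hzs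
    obtain ⟨a, b, hab⟩ := Submodule.mem_span_pair.mp ((hg _ _ _).mp hzs)
    obtain ⟨c, hc, hlc⟩ := hlg h hh
    obtain ⟨c', hc', hlc'⟩ := hlg k hk
    obtain ⟨d, hd, hld⟩ := hlg z hz
    refine ⟨d * a * c⁻¹, d * b * c'⁻¹, ?_⟩
    rw [hld, hlc, hlc', ← hab, smul_add, smul_smul, smul_smul, smul_smul, smul_smul,
      inv_mul_cancel_right₀ hc, inv_mul_cancel_right₀ hc']
  have hI2 : ∀ h, ξ h = 0 → h ≠ 0 → ∀ {a b : R'}, a • g e + b • l h = 0 → a = 0 ∧ b = 0 := by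
    intro h hh h0 a b hab
    obtain ⟨c, hc, hlc⟩ := hlg h hh
    rw [hlc, smul_smul, add_comm] at hab
    have h3 := smul_add_smul_eq_zero (fun h' => h0 ((hg0 h).mp h'))
      (fun h' => heH1 h hh ((hg1 _ _).mpr h')) hab
    exact ⟨h3.2, (mul_eq_zero.mp h3.1).resolve_right hc⟩
  have hI3 : ∀ h k, ξ h = 0 → ξ k = 0 → h ≠ 0 → k ∉ Submodule.span R {h} → ∀ {a b c : R'},
      a • g e + b • l h + c • l k = 0 → a = 0 ∧ b = 0 ∧ c = 0 := by
    intro h k hh hk h0 hkh a b c habc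
    obtain ⟨d, hd, hld⟩ := hlg h hh
    obtain ⟨d', hd', hld'⟩ := hlg k hk
    rw [hld, hld', smul_smul, smul_smul] at habc
    have h3 := smul_add_smul_add_smul_eq_zero (fun h' => heH h k hh hk ((hg _ _ _).mpr h'))
      (fun h' => h0 ((hg0 h).mp h')) (fun h' => hkh ((hg1 _ _).mpr h')) habc
    exact ⟨h3.1, (mul_eq_zero.mp h3.2.1).resolve_right hd,
      (mul_eq_zero.mp h3.2.2).resolve_right hd'⟩
  have hthird : ∀ h, ∃ z, ξ z = 0 ∧ z ∉ Submodule.span R {h} := by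
    intro h
    obtain ⟨z, hz⟩ := hdim e h
    refine ⟨z - ξ z • e, by rw [map_sub, map_smul, hξe, smul_eq_mul, mul_one, sub_self],
      fun hz' => hz ?_⟩
    obtain ⟨a, ha⟩ := Submodule.mem_span_singleton.mp hz'
    exact Submodule.mem_span_pair.mpr ⟨ξ z, a, by rw [ha]; abel⟩
  -- additivity on independent vectors: the point `e + h + k` lies on two lines
  have hadd1 : ∀ h k, ξ h = 0 → ξ k = 0 → h ≠ 0 → k ∉ Submodule.span R {h} →
      l (h + k) = l h + l k := by
    intro h k hh hk h0 hkh
    have hhk : ξ (h + k) = 0 := by rw [map_add, hh, hk, add_zero]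
    obtain ⟨d₁, hd₁, h₁⟩ := hle h hh
    obtain ⟨d₂, hd₂, h₂⟩ := hle k hk
    obtain ⟨d, hd, h₃⟩ := hle (h + k) hhk
    obtain ⟨c₁, hc₁, hlc₁⟩ := hlg h hh
    obtain ⟨c₂, hc₂, hlc₂⟩ := hlg k hk
    obtain ⟨p, q, hpq⟩ := hlspan h k (h + k) hh hk hhk
      (Submodule.mem_span_pair.mpr ⟨1, 1, by simp⟩)
    have hm₁ : e + (h + k) ∈ Submodule.span R {e + h, k} :=
      Submodule.mem_span_pair.mpr ⟨1, 1, by simp [add_assoc]⟩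
    have hm₂ : e + (h + k) ∈ Submodule.span R {e + k, h} :=
      Submodule.mem_span_pair.mpr ⟨1, 1, by simp only [one_smul]; abel⟩
    rw [hg] at hm₁ hm₂
    obtain ⟨α, β, hαβ⟩ := Submodule.mem_span_pair.mp hm₁
    obtain ⟨γ, δ, hγδ⟩ := Submodule.mem_span_pair.mp hm₂
    have hgk : g k = c₂⁻¹ • l k := by rw [hlc₂, inv_smul_smul₀ hc₂]
    have hgh : g h = c₁⁻¹ • l h := by rw [hlc₁, inv_smul_smul₀ hc₁]
    rw [h₁, hgk, h₃, hpq] at hαβ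
    rw [h₂, hgh, h₃, hpq] at hγδ
    have e₁ : (d - α * d₁) • g e + (d * p - α * d₁) • l h + (d * q - β * c₂⁻¹) • l k = 0 := by
      rw [← sub_eq_zero] at hαβ
      rw [← neg_eq_zero, ← hαβ]
      simp only [sub_smul, smul_add, mul_smul]
      abel
    have e₂ : (d - γ * d₂) • g e + (d * p - δ * c₁⁻¹) • l h + (d * q - γ * d₂) • l k = 0 := by
      rw [← sub_eq_zero] at hγδ
      rw [← neg_eq_zero, ← hγδ]
      simp only [sub_smul, smul_add, mul_smul]
      abel
    obtain ⟨h4, h5, -⟩ := hI3 h k hh hk h0 hkh e₁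
    obtain ⟨h6, -, h7⟩ := hI3 h k hh hk h0 hkh e₂
    have hp : p = 1 := mul_left_cancel₀ hd (by
      rw [sub_eq_zero] at h4 h5; rw [h5, ← h4, mul_one])
    have hq : q = 1 := mul_left_cancel₀ hd (by
      rw [sub_eq_zero] at h6 h7; rw [h7, ← h6, mul_one])
    rw [hpq, hp, hq, one_smul, one_smul]
  have hadd : ∀ h k, ξ h = 0 → ξ k = 0 → l (h + k) = l h + l k := by
    intro h k hh hk
    by_cases h0 : h = 0
    · rw [h0, zero_add, hl0, zero_add]
    by_cases hkh : k ∈ Submodule.span R {h}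
    swap
    · exact hadd1 h k hh hk h0 hkh
    by_cases k0 : k = 0
    · rw [k0, add_zero, hl0, add_zero]
    -- a vector independent of both reduces to the independent case
    obtain ⟨z, hz, hzh⟩ := hthird h
    have hhk : ξ (h + k) = 0 := by rw [map_add, hh, hk, add_zero]
    have hkz : ξ (k + z) = 0 := by rw [map_add, hk, hz, add_zero]
    have hmem : ∀ y ∈ Submodule.span R {h}, z ∉ Submodule.span R {y} := by
      intro y hy hzy
      exact hzh ((Submodule.span_singleton_le_iff_mem _ _).mpr hy hzy)
    have h1 : l (h + k + z) = l (h + k) + l z := by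
      by_cases hs : h + k = 0
      · rw [hs, zero_add, hl0, zero_add]
      · exact hadd1 _ _ hhk hz hs
          (hmem _ (add_mem (Submodule.mem_span_singleton_self h) hkh))
    have h3 : l (h + (k + z)) = l h + l (k + z) := by
      refine hadd1 _ _ hh hkz h0 fun h' => hzh ?_
      exact (Submodule.add_mem_iff_right _ hkh).mp h'
    rw [hadd1 k z hk hz k0 (hmem k hkh), ← add_assoc, ← add_assoc, h1] at h3
    exact add_right_cancel h3
  -- the scalar factors
  have hs : ∀ h (a : R), ∃ s : R', ξ h = 0 → l (a • h) = s • l h := by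
    intro h a
    by_cases hh : ξ h = 0
    · obtain ⟨p, q, hpq⟩ := hlspan h h (a • h) hh hh (by rw [map_smul, hh, smul_zero])
        (Submodule.smul_mem _ _ (Submodule.subset_span (by simp)))
      exact ⟨p + q, fun _ => by rw [hpq, add_smul]⟩
    · exact ⟨0, fun h => absurd h hh⟩
  choose s hs using hs
  have hs_indep : ∀ h k a, ξ h = 0 → ξ k = 0 → h ≠ 0 → k ∉ Submodule.span R {h} →
      s h a = s k a := by
    intro h k a hh hk h0 hkh
    have hhk : ξ (h + k) = 0 := by rw [map_add, hh, hk, add_zero]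
    have hah : ξ (a • h) = 0 := by rw [map_smul, hh, smul_zero]
    have hak : ξ (a • k) = 0 := by rw [map_smul, hk, smul_zero]
    have h1 := hs (h + k) a hhk
    rw [smul_add, hadd _ _ hah hak, hadd _ _ hh hk, hs h a hh, hs k a hk] at h1
    have h3 : (0 : R') • g e + (s h a - s (h + k) a) • l h + (s k a - s (h + k) a) • l k = 0 := by
      rw [smul_add, ← sub_eq_zero] at h1
      rw [← h1]
      simp only [sub_smul, zero_smul]
      abel
    obtain ⟨-, h4, h5⟩ := hI3 h k hh hk h0 hkh h3
    rw [sub_eq_zero] at h4 h5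
    rw [h4, h5]
  obtain ⟨h₀, hh₀, hh₀0⟩ := hthird 0
  have h₀0 : h₀ ≠ 0 := fun h => hh₀0 (by rw [h]; exact zero_mem _)
  have hsσ : ∀ h a, ξ h = 0 → l (a • h) = s h₀ a • l h := by
    intro h a hh
    by_cases h0 : h = 0
    · rw [h0, smul_zero, hl0, smul_zero]
    have : s h a = s h₀ a := by
      by_cases hmem : h ∈ Submodule.span R {h₀}
      · obtain ⟨z, hz, hzh⟩ := hthird h₀
        rw [hs_indep h z a hh hz h0 fun h' => hzh
            ((Submodule.span_singleton_le_iff_mem _ _).mpr hmem h'),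
          hs_indep h₀ z a hh₀ hz h₀0 hzh]
      · exact (hs_indep h₀ h a hh₀ hh h₀0 hmem).symm
    rw [← this, hs h a hh]
  have hsmul0 : ∀ a, ξ (a • h₀) = 0 := fun a => by rw [map_smul, hh₀, smul_zero]
  have hcancel : ∀ {a b : R'}, a • l h₀ = b • l h₀ → a = b := fun h =>
    smul_left_injective R' (hlne h₀ hh₀ h₀0) h
  let σ₀ : R →+* R' :=
    { toFun := s h₀
      map_one' := hcancel (by rw [← hsσ _ _ hh₀, one_smul, one_smul])
      map_mul' := fun a b => hcancel (by
        rw [← hsσ _ _ hh₀, mul_smul, hsσ _ _ (hsmul0 b), hsσ _ _ hh₀, mul_smul])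
      map_zero' := hcancel (by rw [← hsσ _ _ hh₀, zero_smul, zero_smul, hl0])
      map_add' := fun a b => hcancel (by
        rw [← hsσ _ _ hh₀, add_smul, hadd _ _ (hsmul0 a) (hsmul0 b), hsσ _ _ hh₀, hsσ _ _ hh₀,
          add_smul]) }
  have hσ₀ : ∀ h a, ξ h = 0 → l (a • h) = σ₀ a • l h := hsσ
  have hσsurj : Function.Surjective σ₀ := by
    intro c
    obtain ⟨x, d, hx⟩ := hsurj (g e + c • l h₀)
    have hd : d ≠ 0 := by
      rintro rfl
      rw [zero_smul, ← one_smul R' (g e)] at hx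
      exact one_ne_zero (hI2 h₀ hh₀ h₀0 hx).1
    have hgx : g x = d⁻¹ • g e + (d⁻¹ * c) • l h₀ := by
      rw [mul_smul, ← smul_add, hx, inv_smul_smul₀ hd]
    obtain ⟨c₀, hc₀, hlc₀⟩ := hlg h₀ hh₀
    have hxs : x ∈ Submodule.span R {e, h₀} := by
      rw [hg, hgx, hlc₀, smul_smul]
      exact Submodule.mem_span_pair.mpr ⟨_, _, rfl⟩
    obtain ⟨p, r, hpr⟩ := Submodule.mem_span_pair.mp hxs
    have hp : p ≠ 0 := by
      rintro rfl
      rw [zero_smul, zero_add] at hpr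
      have h3 : x ∈ Submodule.span R {h₀} := Submodule.mem_span_singleton.mpr ⟨r, hpr⟩
      rw [hg1] at h3
      obtain ⟨t, ht⟩ := Submodule.mem_span_singleton.mp h3
      have hgh : g h₀ = c₀⁻¹ • l h₀ := by rw [hlc₀, inv_smul_smul₀ hc₀]
      have h4 : d⁻¹ • g e + (d⁻¹ * c - t * c₀⁻¹) • l h₀ = 0 := by
        rw [sub_smul, mul_smul t, ← hgh, ht, hgx]
        abel
      exact inv_ne_zero hd (hI2 h₀ hh₀ h₀0 h4).1
    have hxa : x ∈ Submodule.span R {e + (p⁻¹ * r) • h₀} := by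
      refine Submodule.mem_span_singleton.mpr ⟨p, ?_⟩
      rw [smul_add, smul_smul, mul_inv_cancel_left₀ hp, hpr]
    rw [hg1] at hxa
    obtain ⟨t, ht⟩ := Submodule.mem_span_singleton.mp hxa
    obtain ⟨d', hd', hd''⟩ := hle _ (hsmul0 (p⁻¹ * r))
    rw [hd'', hσ₀ _ _ hh₀, hgx] at ht
    have h4 : (t * d' - d⁻¹) • g e + (t * d' * σ₀ (p⁻¹ * r) - d⁻¹ * c) • l h₀ = 0 := by
      rw [← sub_eq_zero] at ht
      rw [← ht]
      simp only [sub_smul, smul_add, mul_smul]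
      abel
    obtain ⟨h5, h6⟩ := hI2 h₀ hh₀ h₀0 h4
    rw [sub_eq_zero] at h5 h6
    rw [h5] at h6
    exact ⟨_, mul_left_cancel₀ (inv_ne_zero hd) h6⟩
  let σ : R ≃+* R' := RingEquiv.ofBijective σ₀ ⟨σ₀.injective, hσsurj⟩
  have hσ : ∀ h a, ξ h = 0 → l (a • h) = σ a • l h := hsσ
  have hproj : ∀ x, ξ (x - ξ x • e) = 0 := fun x => by
    rw [map_sub, map_smul, hξe, smul_eq_mul, mul_one, sub_self]
  let L : V →+ V' := AddMonoidHom.mk' (fun x => σ (ξ x) • g e + l (x - ξ x • e)) (by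
    intro x y
    have : x + y - ξ (x + y) • e = (x - ξ x • e) + (y - ξ y • e) := by
      rw [map_add, add_smul]; abel
    rw [this, hadd _ _ (hproj x) (hproj y), map_add, map_add, add_smul]
    abel)
  have hL : ∀ x, L x = σ (ξ x) • g e + l (x - ξ x • e) := fun _ => rfl
  have hLsmul : ∀ (a : R) (x : V), L (a • x) = σ a • L x := by
    intro a x
    have : a • x - ξ (a • x) • e = a • (x - ξ x • e) := by
      rw [map_smul, smul_sub, smul_assoc]
    rw [hL, hL, this, hσ _ _ (hproj x), map_smul, smul_eq_mul, map_mul, smul_add, mul_smul]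
  have hLg : ∀ x, ∃ c : R', c ≠ 0 ∧ L x = c • g x := by
    intro x
    by_cases hx : ξ x = 0
    · obtain ⟨c, hc, hlc⟩ := hlg x hx
      exact ⟨c, hc, by rw [hL, hx, map_zero, zero_smul, zero_add, zero_smul, sub_zero, hlc]⟩
    · set y := (ξ x)⁻¹ • x with hy
      have hxy : x = ξ x • y := by rw [hy, smul_inv_smul₀ hx]
      have hξy : ξ y = 1 := by rw [hy, map_smul, smul_eq_mul, inv_mul_cancel₀ hx]
      obtain ⟨d, hd, hdy⟩ := hle _ (hproj y)
      have hLy : L y = g e + l (y - ξ y • e) := by rw [hL, hξy, map_one, one_smul]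
      have hey : e + (y - ξ y • e) = y := by rw [hξy, one_smul]; abel
      rw [hey, ← hLy] at hdy
      have hyx : y ∈ Submodule.span R {x} := Submodule.mem_span_singleton.mpr ⟨_, rfl⟩
      rw [hg1] at hyx
      obtain ⟨t, ht⟩ := Submodule.mem_span_singleton.mp hyx
      have ht0 : t ≠ 0 := by
        rintro rfl
        rw [zero_smul, eq_comm, hg0] at ht
        rw [ht, map_zero] at hξy
        exact zero_ne_one hξy
      refine ⟨σ (ξ x) * (d⁻¹ * t), mul_ne_zero (by simpa using hx)
        (mul_ne_zero (inv_ne_zero hd) ht0), ?_⟩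
      conv_lhs => rw [hxy]
      rw [hLsmul, mul_smul, mul_smul, ht, hdy, inv_smul_smul₀ hd]
  have hLinj : Function.Injective L := by
    rw [injective_iff_map_eq_zero]
    intro x hx
    obtain ⟨c, hc, hLc⟩ := hLg x
    rw [hx, eq_comm] at hLc
    exact (hg0 x).mp ((smul_eq_zero.mp hLc).resolve_left hc)
  have hLsurj : Function.Surjective L := by
    intro y
    obtain ⟨x, c, rfl⟩ := hsurj y
    obtain ⟨d, hd, hLd⟩ := hLg x
    refine ⟨σ.symm (c * d⁻¹) • x, ?_⟩
    rw [hLsmul, RingEquiv.apply_symm_apply, hLd, smul_smul, inv_mul_cancel_right₀ hd]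
  exact ⟨σ, AddEquiv.ofBijective L ⟨hLinj, hLsurj⟩, hLsmul, hLg⟩

end ProjectiveGeometry

/-! ### Grassmannians and their bijections -/

section Grassmannians

variable {R V : Type*} [DivisionRing R] [AddCommGroup V] [Module R V] [FiniteDimensional R V]
variable {R' V' : Type*} [DivisionRing R'] [AddCommGroup V'] [Module R' V']
  [FiniteDimensional R' V']

variable (R V) in
/-- The Grassmannian of `j`-dimensional subspaces. -/
abbrev Grass (j : ℕ) : Type _ := {S : Submodule R V // Module.finrank R S = j}

theorem Grass.eq_of_le {j : ℕ} {S T : Grass R V j} (h : S.1 ≤ T.1) : S = T :=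
  Subtype.ext (Submodule.eq_of_le_of_finrank_eq h (S.2.trans T.2.symm))

theorem finrank_sup_span_singleton {N : Submodule R V} {x : V}
    (hx : x ∉ N) :
    Module.finrank R (N ⊔ Submodule.span R {x} : Submodule R V) = Module.finrank R N + 1 := by
  have hx0 : x ≠ 0 := fun h => hx (h ▸ zero_mem N)
  have h := Submodule.finrank_sup_add_finrank_inf_eq N (Submodule.span R {x})
  rw [((Submodule.disjoint_span_singleton' hx0).mpr hx).eq_bot, finrank_bot,
    finrank_span_singleton hx0, add_zero] at h
  exact h

omit [FiniteDimensional R V] in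
theorem exists_notMem_of_finrank_lt {N : Submodule R V}
    (h : Module.finrank R N < Module.finrank R V) : ∃ x, x ∉ N := by
  by_contra! hcon
  rw [(Submodule.eq_top_iff'.mpr hcon), finrank_top] at h
  exact lt_irrefl _ h

theorem finrank_inf_eq {j : ℕ} {A B : Grass R V (j + 1)} (hAB : A ≠ B) {T : Submodule R V}
    (hT : Module.finrank R T = j + 2) (hA : A.1 ≤ T) (hB : B.1 ≤ T) :
    Module.finrank R (A.1 ⊓ B.1 : Submodule R V) = j := by
  have h1 := Submodule.finrank_sup_add_finrank_inf_eq A.1 B.1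
  have h2 := Submodule.finrank_mono (sup_le hA hB)
  have h3 : Module.finrank R (A.1 ⊓ B.1 : Submodule R V) < j + 1 := 
      (Submodule.finrank_lt_finrank_of_lt
        (inf_lt_left.mpr fun h => hAB (Grass.eq_of_le h))).trans_eq A.2
  rw [A.2, B.2] at h1
  omega

theorem finrank_sup_eq {j : ℕ} {M : Grass R V j} {A B : Grass R V (j + 1)} (hAB : A ≠ B)
    (hA : M.1 ≤ A.1) (hB : M.1 ≤ B.1) :
    Module.finrank R (A.1 ⊔ B.1 : Submodule R V) = j + 2 := by
  have h1 := Submodule.finrank_sup_add_finrank_inf_eq A.1 B.1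
  have h2 := Submodule.finrank_mono (le_inf hA hB)
  have h3 : Module.finrank R (A.1 ⊓ B.1 : Submodule R V) < j + 1 := 
      (Submodule.finrank_lt_finrank_of_lt
        (inf_lt_left.mpr fun h => hAB (Grass.eq_of_le h))).trans_eq A.2
  rw [A.2, B.2] at h1
  rw [M.2] at h2
  omega

/-- A subspace is determined by the subspaces of the next dimension which contain it. -/
theorem Grass.eq_of_forall_le {j : ℕ} (hV : j + 1 < Module.finrank R V) {N N' : Grass R V j}
    (hS : ∀ S : Grass R V (j + 1), N.1 ≤ S.1 → N'.1 ≤ S.1) : N' = N := by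
  refine Grass.eq_of_le fun x hx => ?_
  by_contra hxN
  obtain ⟨y, hy⟩ := exists_notMem_of_finrank_lt (N := N.1 ⊔ Submodule.span R {x})
    (by rw [finrank_sup_span_singleton hxN, N.2]; exact hV)
  have hyN : y ∉ N.1 := fun h => hy (Submodule.mem_sup_left h)
  have hxS := hS ⟨_, by rw [finrank_sup_span_singleton hyN, N.2]⟩ le_sup_left hx
  obtain ⟨m, hm, z, hz, hmz⟩ := Submodule.mem_sup.mp hxS
  obtain ⟨a, rfl⟩ := Submodule.mem_span_singleton.mp hz
  have ha : a ≠ 0 := by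
    rintro rfl
    rw [zero_smul, add_zero] at hmz
    exact hxN (hmz ▸ hm)
  refine hy ((Submodule.smul_mem_iff _ ha).mp ?_)
  rw [← add_sub_cancel_left m (a • y), hmz]
  exact sub_mem (Submodule.mem_sup_right (Submodule.mem_span_singleton_self x))
    (Submodule.mem_sup_left hm)

/-- A bijection of Grassmannians which maps the star of each smaller subspace into a star, in both
directions, descends to the next smaller dimension. -/
theorem exists_grass_descend {j : ℕ} (hV : j + 1 < Module.finrank R V)
    (hV' : j + 1 < Module.finrank R' V') (φ : Grass R V (j + 1) ≃ Grass R' V' (j + 1))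
    (h : ∀ N : Grass R V j, ∃ N' : Grass R' V' j, ∀ S, N.1 ≤ S.1 → N'.1 ≤ (φ S).1)
    (h' : ∀ N : Grass R' V' j, ∃ N' : Grass R V j, ∀ S, N.1 ≤ S.1 → N'.1 ≤ (φ.symm S).1) :
    ∃ ψ : Grass R V j ≃ Grass R' V' j, ∀ N S, N.1 ≤ S.1 ↔ (ψ N).1 ≤ (φ S).1 := by
  choose g hg using h
  choose g' hg' using h'
  have hgg : ∀ N, g' (g N) = N := fun N => Grass.eq_of_forall_le hV fun S hS => by
    simpa using hg' _ _ (hg N S hS)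
  have hgg' : ∀ N, g (g' N) = N := fun N => Grass.eq_of_forall_le hV' fun S hS => by
    simpa using hg _ _ (hg' N S hS)
  refine ⟨⟨g, g', hgg, hgg'⟩, fun N S => ⟨hg N S, fun hS => ?_⟩⟩
  have := hg' _ _ hS
  simpa [hgg] using this

/-- A map of Grassmannians maps the star of `N` into a star as soon as it does so for all triples
of subspaces which are independent modulo `N`. -/
theorem exists_star {j : ℕ} (hV : j + 3 ≤ Module.finrank R V)
    (φ : Grass R V (j + 1) → Grass R' V' (j + 1)) (N : Grass R V j)
    (H : ∀ S₁ S₂ S₃ : Grass R V (j + 1), N.1 ≤ S₁.1 → N.1 ≤ S₂.1 → N.1 ≤ S₃.1 → S₁ ≠ S₂ →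
      ¬ S₃.1 ≤ S₁.1 ⊔ S₂.1 →
      Module.finrank R' ((φ S₁).1 ⊓ (φ S₂).1 : Submodule R' V') = j ∧
        (φ S₁).1 ⊓ (φ S₂).1 ≤ (φ S₃).1) :
    ∃ N' : Grass R' V' j, ∀ S, N.1 ≤ S.1 → N'.1 ≤ (φ S).1 := by
  obtain ⟨x, hx⟩ := exists_notMem_of_finrank_lt (N := N.1) (by rw [N.2]; omega)
  have h1 := finrank_sup_span_singleton hx
  obtain ⟨y, hy⟩ := exists_notMem_of_finrank_lt (N := N.1 ⊔ Submodule.span R {x})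
    (by rw [h1, N.2]; omega)
  have h2 := finrank_sup_span_singleton hy
  obtain ⟨z, hz⟩ := exists_notMem_of_finrank_lt
    (N := N.1 ⊔ Submodule.span R {x} ⊔ Submodule.span R {y}) (by rw [h2, h1, N.2]; omega)
  have hyN : y ∉ N.1 := fun h => hy (Submodule.mem_sup_left h)
  have hzN : z ∉ N.1 := fun h => hz (Submodule.mem_sup_left (Submodule.mem_sup_left h))
  set S₀ : Grass R V (j + 1) := ⟨N.1 ⊔ Submodule.span R {x}, by rw [h1, N.2]⟩ with hS₀
  set S₁ : Grass R V (j + 1) := ⟨N.1 ⊔ Submodule.span R {y},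
    by rw [finrank_sup_span_singleton hyN, N.2]⟩ with hS₁
  set S₂ : Grass R V (j + 1) := ⟨N.1 ⊔ Submodule.span R {z},
    by rw [finrank_sup_span_singleton hzN, N.2]⟩ with hS₂
  have hN₀ : N.1 ≤ S₀.1 := le_sup_left
  have hN₁ : N.1 ≤ S₁.1 := le_sup_left
  have hN₂ : N.1 ≤ S₂.1 := le_sup_left
  have hy₁ : y ∈ S₁.1 := Submodule.mem_sup_right (Submodule.mem_span_singleton_self y)
  have hz₂ : z ∈ S₂.1 := Submodule.mem_sup_right (Submodule.mem_span_singleton_self z)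
  have hy₀ : y ∉ S₀.1 := hy
  have hsup₁ : S₀.1 ⊔ S₁.1 = S₀.1 ⊔ Submodule.span R {y} := by
    rw [hS₁, ← sup_assoc, sup_eq_left.mpr hN₀]
  have hsup₂ : S₀.1 ⊔ S₂.1 = S₀.1 ⊔ Submodule.span R {z} := by
    rw [hS₂, ← sup_assoc, sup_eq_left.mpr hN₀]
  have hz₀₁ : z ∉ S₀.1 ⊔ S₁.1 := by rw [hsup₁]; exact hz
  have hz₀ : z ∉ S₀.1 := fun h => hz₀₁ (Submodule.mem_sup_left h)
  have h₀₁ : S₀ ≠ S₁ := fun h => hy₀ (by rw [h]; exact hy₁)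
  have h₀₂ : S₀ ≠ S₂ := fun h => hz₀ (by rw [h]; exact hz₂)
  have hinf : ∀ v ∈ S₀.1 ⊔ S₁.1, v ∈ S₀.1 ⊔ S₂.1 → v ∈ S₀.1 := by
    intro v hv hv'
    rw [hsup₂] at hv'
    obtain ⟨m, hm, w, hw, rfl⟩ := Submodule.mem_sup.mp hv'
    obtain ⟨a, rfl⟩ := Submodule.mem_span_singleton.mp hw
    have h3 := (Submodule.add_mem_iff_right _ (Submodule.mem_sup_left hm)).mp hv
    by_cases ha : a = 0
    · rw [ha, zero_smul, add_zero]; exact hm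
    · exact absurd ((Submodule.smul_mem_iff _ ha).mp h3) hz₀₁
  obtain ⟨hd₁, hle₁⟩ := H S₀ S₁ S₂ hN₀ hN₁ hN₂ h₀₁ fun h => hz₀₁ (h hz₂)
  obtain ⟨hd₂, -⟩ := H S₀ S₂ S₁ hN₀ hN₂ hN₁ h₀₂ fun h =>
    hy₀ (hinf y (Submodule.mem_sup_right hy₁) (h hy₁))
  have heq : (φ S₀).1 ⊓ (φ S₁).1 = (φ S₀).1 ⊓ (φ S₂).1 :=
    Submodule.eq_of_le_of_finrank_eq (le_inf inf_le_left hle₁) (hd₁.trans hd₂.symm)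
  refine ⟨⟨_, hd₁⟩, fun S hS => ?_⟩
  by_cases h3 : S.1 ≤ S₀.1 ⊔ S₁.1
  · by_cases h4 : S.1 ≤ S₀.1 ⊔ S₂.1
    · rw [Grass.eq_of_le (S := S) (T := S₀) fun v hv => hinf v (h3 hv) (h4 hv)]
      exact inf_le_left
    · change (φ S₀).1 ⊓ (φ S₁).1 ≤ _
      rw [heq]
      exact (H S₀ S₂ S hN₀ hN₂ hS h₀₂ h4).2
  · exact (H S₀ S₁ S hN₀ hN₁ hS h₀₁ h3).2

/-- Incidence preserving bijections between Grassmannians of consecutive dimensions satisfy the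
triple condition of `exists_star` in the smaller dimension. -/
theorem triple_of_incidence {j : ℕ} (φ : Grass R V (j + 2) ≃ Grass R' V' (j + 2))
    (ψ : Grass R V (j + 1) ≃ Grass R' V' (j + 1))
    (h : ∀ N S, N.1 ≤ S.1 ↔ (ψ N).1 ≤ (φ S).1) (M : Grass R V j) (N₁ N₂ N₃ : Grass R V (j + 1))
    (h₁ : M.1 ≤ N₁.1) (h₂ : M.1 ≤ N₂.1) (h₃ : M.1 ≤ N₃.1) (h₁₂ : N₁ ≠ N₂)
    (hN : ¬ N₃.1 ≤ N₁.1 ⊔ N₂.1) :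
    Module.finrank R' ((ψ N₁).1 ⊓ (ψ N₂).1 : Submodule R' V') = j ∧
      (ψ N₁).1 ⊓ (ψ N₂).1 ≤ (ψ N₃).1 := by
  have h₁₃ : N₁ ≠ N₃ := fun h => hN (h ▸ le_sup_left)
  have h₂₃ : N₂ ≠ N₃ := fun h => hN (h ▸ le_sup_right)
  have key : ∀ {A B : Grass R V (j + 1)}, M.1 ≤ A.1 → M.1 ≤ B.1 → A ≠ B →
      Module.finrank R' ((ψ A).1 ⊓ (ψ B).1 : Submodule R' V') = j := by
    intro A B hA hB hAB
    exact finrank_inf_eq (ψ.injective.ne hAB) (φ ⟨_, finrank_sup_eq hAB hA hB⟩).2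
      ((h _ _).mp le_sup_left) ((h _ _).mp le_sup_right)
  have k₁₂ := key h₁ h₂ h₁₂
  refine ⟨k₁₂, ?_⟩
  set T := φ ⟨_, finrank_sup_eq h₁₂ h₁ h₂⟩ with hT
  have hT₁ : (ψ N₁).1 ≤ T.1 := (h _ _).mp le_sup_left
  have hT₂ : (ψ N₂).1 ≤ T.1 := (h _ _).mp le_sup_right
  have hT₃ : ¬ (ψ N₃).1 ≤ T.1 := fun h' => hN ((h N₃ ⟨_, finrank_sup_eq h₁₂ h₁ h₂⟩).mpr h')
  have hlt : Module.finrank R' ((ψ N₃).1 ⊓ T.1 : Submodule R' V') < j + 1 :=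
    (Submodule.finrank_lt_finrank_of_lt (inf_lt_left.mpr hT₃)).trans_eq (ψ N₃).2
  have heq : ∀ {A : Grass R V (j + 1)}, M.1 ≤ A.1 → A ≠ N₃ → (ψ A).1 ≤ T.1 →
      (ψ A).1 ⊓ (ψ N₃).1 = (ψ N₃).1 ⊓ T.1 := by
    intro A hA hA₃ hAT
    refine Submodule.eq_of_le_of_finrank_le (le_inf inf_le_right (inf_le_left.trans hAT)) ?_
    rw [key hA h₃ hA₃]
    omega
  have h4 := (heq h₁ h₁₃ hT₁).trans (heq h₂ h₂₃ hT₂).symm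
  have h5 : (ψ N₁).1 ⊓ (ψ N₃).1 = (ψ N₁).1 ⊓ (ψ N₂).1 := by
    refine Submodule.eq_of_le_of_finrank_eq (le_inf inf_le_left ?_)
      ((key h₁ h₃ h₁₃).trans k₁₂.symm)
    rw [h4]
    exact inf_le_left
  rw [← h5]
  exact inf_le_right

/-- The map `φ` of Grassmannians is induced by the additive bijection `l`. -/
def InducedBy {j : ℕ} (φ : Grass R V j ≃ Grass R' V' j) (l : V ≃+ V') : Prop :=
  ∀ S x, x ∈ S.1 ↔ l x ∈ (φ S).1

theorem exists_grass_mem_le {j : ℕ} (hj : 0 < j) (S : Grass R V (j + 1)) {x : V} (hx : x ∈ S.1) :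
    ∃ N : Grass R V j, x ∈ N.1 ∧ N.1 ≤ S.1 := by
  have hlt : Submodule.span R {(⟨x, hx⟩ : S.1)} < ⊤ := by
    rw [lt_top_iff_ne_top]
    intro h
    have h1 := finrank_span_le_card (R := R) {(⟨x, hx⟩ : S.1)}
    rw [h, finrank_top, S.2] at h1
    simp at h1
    omega
  obtain ⟨ξ, hξ0, hξ⟩ := Submodule.exists_le_ker_of_lt_top _ hlt
  refine ⟨⟨(LinearMap.ker ξ).map S.1.subtype, ?_⟩, ?_, Submodule.map_subtype_le _ _⟩
  · rw [Submodule.finrank_map_subtype_eq]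
    have h1 := LinearMap.finrank_range_add_finrank_ker ξ
    rw [LinearMap.range_eq_top.mpr (LinearMap.surjective hξ0), finrank_top, Module.finrank_self,
      S.2] at h1
    omega
  · exact ⟨⟨x, hx⟩, hξ (Submodule.mem_span_singleton_self _), rfl⟩

/-- A map induced on the subspaces of one dimension is induced on those of the next, which are
unions of smaller ones. -/
theorem InducedBy.of_incidence {j : ℕ} (hj : 0 < j) {φ : Grass R V (j + 1) ≃ Grass R' V' (j + 1)}
    {ψ : Grass R V j ≃ Grass R' V' j} (h : ∀ N S, N.1 ≤ S.1 ↔ (ψ N).1 ≤ (φ S).1) {l : V ≃+ V'}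
    (hl : InducedBy ψ l) : InducedBy φ l := by
  intro S x
  constructor
  · intro hx
    obtain ⟨N, hxN, hNS⟩ := exists_grass_mem_le hj S hx
    exact (h N S).mp hNS ((hl N x).mp hxN)
  · intro hx
    obtain ⟨N', hxN, hNS⟩ := exists_grass_mem_le hj (φ S) hx
    obtain ⟨N, rfl⟩ := ψ.surjective N'
    exact (h N S).mpr hNS ((hl N x).mpr hxN)

omit [FiniteDimensional R' V'] in
/-- The fundamental theorem of projective geometry for bijections of the set of lines through the
origin which preserve collinearity in both directions. -/
theorem exists_inducedBy_of_collineation (hV : 3 ≤ Module.finrank R V)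
    (φ : Grass R V 1 ≃ Grass R' V' 1)
    (h : ∀ P Q T, T.1 ≤ P.1 ⊔ Q.1 ↔ (φ T).1 ≤ (φ P).1 ⊔ (φ Q).1) :
    ∃ (σ : R ≃+* R') (l : V ≃+ V'), (∀ (a : R) (x : V), l (a • x) = σ a • l x) ∧
      InducedBy φ l := by
  classical
  have hex : ∀ x : V, ∃ y : V', (x = 0 → y = 0) ∧ ∀ hx : x ≠ 0,
      y ≠ 0 ∧ (φ ⟨Submodule.span R {x}, finrank_span_singleton hx⟩).1 = Submodule.span R' {y} := by
    intro x
    by_cases hx : x = 0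
    · exact ⟨0, fun _ => rfl, fun h => absurd hx h⟩
    · obtain ⟨y, hy0, hy⟩ := finrank_eq_one_iff'.mp
        (φ ⟨Submodule.span R {x}, finrank_span_singleton hx⟩).2
      refine ⟨y, fun h => absurd h hx, fun _ => ⟨by simpa using hy0, le_antisymm ?_ ?_⟩⟩
      · intro z hz
        obtain ⟨c, hc⟩ := hy ⟨z, hz⟩
        exact Submodule.mem_span_singleton.mpr ⟨c, congrArg Subtype.val hc⟩
      · exact (Submodule.span_singleton_le_iff_mem _ _).mpr y.2
  choose g hg0 hg1 using hex
  have hg0' : ∀ x, g x = 0 ↔ x = 0 := fun x =>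
    ⟨fun h => by by_contra hx; exact (hg1 x hx).1 h, hg0 x⟩
  have hgne : ∀ x y z, x ≠ 0 → y ≠ 0 →
      (z ∈ Submodule.span R {x, y} ↔ g z ∈ Submodule.span R' {g x, g y}) := by
    intro x y z hx hy
    by_cases hz : z = 0
    · rw [hz, hg0 0 rfl]
      simp only [zero_mem]
    · have h1 := h ⟨_, finrank_span_singleton hx⟩ ⟨_, finrank_span_singleton hy⟩
        ⟨_, finrank_span_singleton hz⟩
      rw [(hg1 x hx).2, (hg1 y hy).2, (hg1 z hz).2, Submodule.span_singleton_le_iff_mem,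
        Submodule.span_singleton_le_iff_mem] at h1
      rwa [Submodule.span_insert, Submodule.span_insert]
  have hg : ∀ x y z, z ∈ Submodule.span R {x, y} ↔ g z ∈ Submodule.span R' {g x, g y} := by
    intro x y z
    by_cases hx : x = 0
    · by_cases hy : y = 0
      · rw [hx, hy, hg0 0 rfl]
        simp [hg0']
      · have := hgne y y z hy hy
        rw [hx, hg0 0 rfl, Submodule.span_insert_zero, Submodule.span_insert_zero]
        simpa using this
    · by_cases hy : y = 0
      · have := hgne x x z hx hx
        rw [hy, hg0 0 rfl, Set.pair_comm, Set.pair_comm (g x), Submodule.span_insert_zero,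
          Submodule.span_insert_zero]
        simpa using this
      · exact hgne x y z hx hy
  have hdim : ∀ x y : V, ∃ z, z ∉ Submodule.span R {x, y} := by
    intro x y
    refine exists_notMem_of_finrank_lt (lt_of_le_of_lt ?_ (Nat.lt_of_succ_le hV))
    have h1 := finrank_span_finset_le_card (R := R) ({x, y} : Finset V)
    rw [Finset.coe_pair] at h1
    exact h1.trans Finset.card_le_two
  have hsurj : ∀ y, ∃ (x : V) (c : R'), y = c • g x := by
    intro y
    by_cases hy : y = 0
    · exact ⟨0, 0, by rw [hy, zero_smul]⟩
    · obtain ⟨P, hP⟩ := φ.surjective ⟨Submodule.span R' {y}, finrank_span_singleton hy⟩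
      obtain ⟨x, hx0, hx⟩ := finrank_eq_one_iff'.mp P.2
      have hx0' : x.1 ≠ 0 := by simpa using hx0
      have hPx : P = ⟨Submodule.span R {x.1}, finrank_span_singleton hx0'⟩ :=
        (Grass.eq_of_le ((Submodule.span_singleton_le_iff_mem _ _).mpr x.2)).symm
      have h3 := (hg1 x.1 hx0').2
      rw [← hPx, hP] at h3
      have hy' : y ∈ Submodule.span R' {g x.1} := by
        rw [← h3]; exact Submodule.mem_span_singleton_self y
      obtain ⟨c, hc⟩ := Submodule.mem_span_singleton.mp hy'
      exact ⟨x.1, c, hc.symm⟩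
  obtain ⟨σ, l, hl, hlg⟩ := exists_semilinear_of_collineation hdim g hg0' hg hsurj
  refine ⟨σ, l, hl, fun P x => ?_⟩
  by_cases hx : x = 0
  · simp [hx]
  have h1 := h P P ⟨_, finrank_span_singleton hx⟩
  rw [sup_idem, sup_idem, (hg1 x hx).2, Submodule.span_singleton_le_iff_mem,
    Submodule.span_singleton_le_iff_mem] at h1
  obtain ⟨c, hc, hlc⟩ := hlg x
  rw [h1, hlc, Submodule.smul_mem_iff _ hc]

/-- Bijections between the Grassmannians of two consecutive dimensions which preserve incidence are
induced by a semilinear bijection: they descend to lines, one dimension at a time. -/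
theorem exists_inducedBy_of_incidence {j : ℕ} (hV : j + 2 < Module.finrank R V)
    (hV' : j + 2 < Module.finrank R' V') (φ : Grass R V (j + 2) ≃ Grass R' V' (j + 2))
    (ψ : Grass R V (j + 1) ≃ Grass R' V' (j + 1))
    (h : ∀ N S, N.1 ≤ S.1 ↔ (ψ N).1 ≤ (φ S).1) :
    ∃ (σ : R ≃+* R') (l : V ≃+ V'), (∀ (a : R) (x : V), l (a • x) = σ a • l x) ∧
      InducedBy φ l := by
  induction j with
  | zero =>
    obtain ⟨σ, l, hl, hψ⟩ := exists_inducedBy_of_collineation (by omega) ψ (by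
      intro P Q T
      by_cases hPQ : P = Q
      · rw [hPQ, sup_idem, sup_idem]
        refine ⟨fun h => (Grass.eq_of_le h) ▸ le_rfl, fun h => ?_⟩
        rw [ψ.injective (Grass.eq_of_le h)]
      · have hS := finrank_sup_eq (M := ⟨⊥, finrank_bot _ _⟩) hPQ bot_le bot_le
        rw [h T ⟨_, hS⟩]
        have : (ψ P).1 ⊔ (ψ Q).1 = (φ ⟨_, hS⟩).1 :=
          Submodule.eq_of_le_of_finrank_eq
            (sup_le ((h _ _).mp le_sup_left) ((h _ _).mp le_sup_right))
            ((finrank_sup_eq (M := ⟨⊥, finrank_bot _ _⟩) (ψ.injective.ne hPQ) bot_le bot_le).trans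
              (φ ⟨_, hS⟩).2.symm)
        rw [this])
    exact ⟨σ, l, hl, hψ.of_incidence one_pos h⟩
  | succ j ih =>
    obtain ⟨χ, hχ⟩ := exists_grass_descend (by omega) (by omega) ψ
      (fun M => exists_star (by omega) ψ M (triple_of_incidence φ ψ h M))
      (fun M => exists_star (by omega) ψ.symm M (triple_of_incidence φ.symm ψ.symm
        (fun N S => by rw [h]; simp) M))
    obtain ⟨σ, l, hl, hψ⟩ := ih (by omega) (by omega) ψ χ hχ
    exact ⟨σ, l, hl, hψ.of_incidence (by omega) h⟩

end Grassmannians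

/-! ### The action on the Grassmannian of eigenspaces for `1` -/

section ActionOnGrassmannian

section Sunflower

variable {α ι : Type*} [DecidableEq α]

/-- A family of at least `j + 3` sets of `j + 1` elements, any two of which meet in exactly `j`
elements, is a sunflower. The other possibility for such a family, all `(j + 1)`-subsets of a set
with `j + 2` elements, is too small. -/
theorem inter_subset_of_card_inter [Fintype ι] {j : ℕ} (hι : j + 3 ≤ Fintype.card ι)
    (F : ι → Finset α) (hF : ∀ p, (F p).card = j + 1)
    (hF' : ∀ p q, p ≠ q → (F p ∩ F q).card = j) {p q r : ι} (hpq : p ≠ q) (hpr : p ≠ r)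
    (hqr : q ≠ r) : F p ∩ F q ⊆ F r := by
  intro x hx
  by_contra hxr
  obtain ⟨hxp, hxq⟩ := Finset.mem_inter.mp hx
  have hU : (F p ∪ F q).card = j + 2 := by
    have h1 := Finset.card_union_add_card_inter (F p) (F q)
    rw [hF, hF, hF' p q hpq] at h1
    omega
  -- two of the sets meet in `E` as soon as a set `E` of `j` elements is contained in both
  have hle : ∀ a b, a ≠ b → ∀ E : Finset α, E.card = j → F a ∩ F b ⊆ E → E = F a ∩ F b :=
    fun a b hab E hE h => (Finset.eq_of_subset_of_card_le h (by rw [hE, hF' a b hab])).symm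
  have herase : ∀ a, x ∈ F a → a ≠ r → (F a).erase x ⊆ F r := by
    intro a hxa har
    rw [hle a r har ((F a).erase x) (by rw [Finset.card_erase_of_mem hxa, hF]; rfl)]
    · exact Finset.inter_subset_right
    · intro y hy
      obtain ⟨hya, hyr⟩ := Finset.mem_inter.mp hy
      exact Finset.mem_erase.mpr ⟨fun h => hxr (h ▸ hyr), hya⟩
  have hr : (F p ∪ F q).erase x = F r := by
    refine Finset.eq_of_subset_of_card_le ?_ ?_
    · rw [Finset.erase_union_distrib]
      exact Finset.union_subset (herase p hxp hpr) (herase q hxq hqr)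
    · rw [Finset.card_erase_of_mem (Finset.mem_union_left _ hxp), hU, hF]
      rfl
  have hrU : F r ⊆ F p ∪ F q := hr ▸ Finset.erase_subset _ _
  have hall : ∀ t, F t ⊆ F p ∪ F q := by
    intro t
    by_contra hcon
    obtain ⟨y, hyt, hy⟩ := Finset.not_subset.mp hcon
    have key : ∀ a, F a ⊆ F p ∪ F q → (F t).erase y ⊆ F a := by
      intro a ha
      have hta : t ≠ a := fun h => hcon (h ▸ ha)
      rw [hle t a hta ((F t).erase y) (by rw [Finset.card_erase_of_mem hyt, hF]; rfl)]
      · exact Finset.inter_subset_right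
      · intro z hz
        obtain ⟨hzt, hza⟩ := Finset.mem_inter.mp hz
        exact Finset.mem_erase.mpr ⟨fun h => hy (h ▸ ha hza), hzt⟩
    have hE : (F t).erase y = F p ∩ F q := by
      refine Finset.eq_of_subset_of_card_le
        (Finset.subset_inter (key p Finset.subset_union_left) (key q Finset.subset_union_right)) ?_
      rw [hF' p q hpq, Finset.card_erase_of_mem hyt, hF]
      rfl
    exact hxr (key r hrU (hE ▸ hx))
  have hinj : Function.Injective F := by
    intro a b hab
    by_contra hne
    have h1 := hF' a b hne
    rw [hab, Finset.inter_self, hF] at h1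
    omega
  have h1 := Finset.card_le_card_of_injOn F (s := Finset.univ)
    (t := (F p ∪ F q).powersetCard (j + 1))
    (fun t _ => Finset.mem_powersetCard.mpr ⟨hall t, hF t⟩) hinj.injOn
  rw [Finset.card_powersetCard, hU, Finset.card_univ, Nat.choose_succ_self_right] at h1
  omega

end Sunflower

variable {R V : Type*} [DivisionRing R] [AddCommGroup V] [Module R V] [FiniteDimensional R V]
variable {R' V' : Type*} [DivisionRing R'] [AddCommGroup V'] [Module R' V']
  [FiniteDimensional R' V']
variable {n k : ℕ}

omit [FiniteDimensional R V] in
theorem basis_mem_coordSpace {ι : Type*} (b : Module.Basis ι R V) {F : Finset ι} {i : ι}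
    (hi : i ∈ F) : b i ∈ coordSpace b F := by
  classical
  rw [mem_coordSpace]
  intro l hl
  rw [Module.Basis.coord_apply, Module.Basis.repr_self, Finsupp.single_apply, if_neg]
  rintro rfl
  exact hl hi

/-- A basis adapted to a subspace and to three vectors which are independent modulo it. -/
theorem exists_basis_coordSpace {j : ℕ} (hV : Module.finrank R V = n) (N : Grass R V j) {x y z : V}
    (hx : x ∉ N.1) (hy : y ∉ N.1 ⊔ Submodule.span R {x})
    (hz : z ∉ N.1 ⊔ Submodule.span R {x} ⊔ Submodule.span R {y}) :
    ∃ (b : Module.Basis (Fin n) R V) (A : Finset (Fin n)) (p q r : Fin n),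
      A.card = j ∧ p ∉ A ∧ q ∉ A ∧ r ∉ A ∧ p ≠ q ∧ p ≠ r ∧ q ≠ r ∧ coordSpace b A = N.1 ∧
      b p = x ∧ b q = y ∧ b r = z := by
  let c := Module.finBasisOfFinrankEq R N.1 N.2
  let v : Fin j → V := fun i => (c i : V)
  have hspan : Submodule.span R (Set.range v) = N.1 := by
    have h1 := congrArg (Submodule.map N.1.subtype) c.span_eq
    rwa [Submodule.map_span, ← Set.range_comp, Submodule.map_top, Submodule.range_subtype] at h1
  have h0 : LinearIndependent R v :=
    c.linearIndependent.map' N.1.subtype (Submodule.ker_subtype _)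
  have h1 := linearIndependent_option'.mpr ⟨h0, (by rwa [hspan] : x ∉ _)⟩
  have hr : ∀ {ι : Type} (w : ι → V) (a : V),
      Submodule.span R (Set.range fun o : Option ι => Option.casesOn' o a w) =
        Submodule.span R (Set.range w) ⊔ Submodule.span R {a} := by
    intro ι w a
    rw [Option.range_eq, Submodule.span_insert, sup_comm]
    rfl
  have h2 := linearIndependent_option'.mpr ⟨h1, (by rwa [hr, hspan] : y ∉ _)⟩
  have h3 := linearIndependent_option'.mpr ⟨h2, (by rwa [hr, hr, hspan] : z ∉ _)⟩
  obtain ⟨b, g, hg, hb⟩ : ∃ (b : Module.Basis (Fin n) R V) (g : Option (Option (Option (Fin j))) →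
      Fin n), Function.Injective g ∧ ∀ o, b (g o) =
        Option.casesOn' o z fun o => Option.casesOn' o y fun o => Option.casesOn' o x v := by
    let B := Module.Basis.extend h3.linearIndepOn_id
    let := FiniteDimensional.fintypeBasisIndex B
    let e := Fintype.equivFinOfCardEq ((Module.finrank_eq_card_basis B).symm.trans hV)
    refine ⟨B.reindex e, fun o => e ⟨_, Module.Basis.subset_extend h3.linearIndepOn_id
      (Set.mem_range_self o)⟩, fun a a' h => h3.injective (congrArg Subtype.val (e.injective h)),
      fun o => ?_⟩
    rw [Module.Basis.reindex_apply, Equiv.symm_apply_apply, Module.Basis.extend_apply_self]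
  let i : Fin j ↪ Fin n := ⟨fun i => g (some (some (some i))), fun a a' h => by simpa using hg h⟩
  have hA : ∀ o, g o ∈ Finset.univ.map i ↔ ∃ a, o = some (some (some a)) := fun o => by
    rw [Finset.mem_map]
    constructor
    · rintro ⟨a, -, ha⟩
      exact ⟨a, (hg ha).symm⟩
    · rintro ⟨a, rfl⟩
      exact ⟨a, Finset.mem_univ _, rfl⟩
  have hcard : (Finset.univ.map i).card = j := by rw [Finset.card_map, Finset.card_fin]
  refine ⟨b, Finset.univ.map i, g (some (some none)), g (some none), g none, hcard, by simp [hA],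
    by simp [hA], by simp [hA], hg.ne (by simp), hg.ne (by simp), hg.ne (by simp),
    ?_, hb _, hb _, hb _⟩
  refine (Submodule.eq_of_le_of_finrank_eq ?_ (by rw [finrank_coordSpace, hcard, N.2])).symm
  rw [← hspan, Submodule.span_le]
  rintro _ ⟨a, rfl⟩
  have h := hb (some (some (some a)))
  change _ = v a at h
  rw [← h]
  exact basis_mem_coordSpace _ ((hA _).mpr ⟨a, rfl⟩)

omit [FiniteDimensional R V] in
theorem Disjoint.of_notMem {P : Grass R V 1} {H : Submodule R V} (h : ¬ P.1 ≤ H) :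
    Disjoint P.1 H := by
  rw [Submodule.disjoint_def]
  intro x hxP hxH
  by_contra hx
  obtain ⟨y, hyP, hyH⟩ := SetLike.not_le_iff_exists.mp h
  obtain ⟨c, hc⟩ := exists_smul_eq_of_finrank_eq_one P.2 (x := ⟨x, hxP⟩) (by simpa using hx)
    ⟨y, hyP⟩
  have hc' : c • x = y := congrArg Subtype.val hc
  exact hyH (hc' ▸ H.smul_mem c hxH)

/-- A bijection of `𝔍ₖ` is sign preserving if it maps the involutions with a given `ε`-eigenspace
onto the involutions with a given `ε`-eigenspace. -/
def SignPreserving (f : kInvolutions R V k ≃ kInvolutions R' V' k) : Prop :=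
  ∀ u v ε, signSpace u.1 ε = signSpace v.1 ε ↔ signSpace (f u).1 ε = signSpace (f v).1 ε

/-- The map `φ` of Grassmannians describes the action of `f` on the eigenspaces for `1`. -/
def ActsOnPlus (f : kInvolutions R V k ≃ kInvolutions R' V' k)
    (φ : Grass R V k ≃ Grass R' V' k) : Prop :=
  ∀ u S, signSpace u.1 1 = S.1 ↔ signSpace (f u).1 1 = (φ S).1

variable {f : kInvolutions R V k ≃ kInvolutions R' V' k} {φ : Grass R V k ≃ Grass R' V' k}

omit [FiniteDimensional R V] [FiniteDimensional R' V'] in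
theorem SignPreserving.symm (h : SignPreserving f) : SignPreserving f.symm := fun u v ε => by
  rw [h, Equiv.apply_symm_apply, Equiv.apply_symm_apply]

omit [FiniteDimensional R V] [FiniteDimensional R' V'] in
theorem ActsOnPlus.symm (h : ActsOnPlus f φ) : ActsOnPlus f.symm φ.symm := fun u S => by
  rw [h, Equiv.apply_symm_apply, Equiv.apply_symm_apply]

theorem SignPreserving.exists_actsOnPlus (h2 : (2 : R) ≠ 0) (h2' : (2 : R') ≠ 0)
    (hf : SignPreserving f) : ∃ φ, ActsOnPlus f φ := by
  have hex : ∀ S : Grass R V k, ∃ u : kInvolutions R V k, signSpace u.1 1 = S.1 := fun S => by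
    obtain ⟨U, hU⟩ := S.1.exists_isCompl
    obtain ⟨u, hu, -⟩ := exists_kInvolution h2 hU S.2
    exact ⟨u, hu⟩
  have hex' : ∀ S : Grass R' V' k, ∃ u : kInvolutions R' V' k, signSpace u.1 1 = S.1 := fun S => by
    obtain ⟨U, hU⟩ := S.1.exists_isCompl
    obtain ⟨u, hu, -⟩ := exists_kInvolution h2' hU S.2
    exact ⟨u, hu⟩
  choose g hg using hex
  choose g' hg' using hex'
  have hdim : ∀ u : kInvolutions R V k, Module.finrank R (signSpace u.1 1) = k := fun u =>
    ((mem_kInvolutions_iff h2).mp u.2).2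
  have hdim' : ∀ u : kInvolutions R' V' k, Module.finrank R' (signSpace u.1 1) = k := fun u =>
    ((mem_kInvolutions_iff h2').mp u.2).2
  refine ⟨⟨fun S => ⟨_, hdim' (f (g S))⟩, fun S => ⟨_, hdim (f.symm (g' S))⟩, fun S => ?_,
    fun S => ?_⟩, fun u S => ?_⟩
  · refine Subtype.ext ?_
    change signSpace (f.symm (g' _)).1 1 = S.1
    rw [← hg S, hf, Equiv.apply_symm_apply, hg']
  · refine Subtype.ext ?_
    change signSpace (f (g _)).1 1 = S.1
    rw [← hg' S, hf.symm, Equiv.symm_apply_apply, hg]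
  · change _ ↔ _ = signSpace (f (g S)).1 1
    rw [← hf, hg]

/-- `f` acts on the complements of the eigenspace for `-1` of a given involution. -/
theorem ActsOnPlus.isCompl (h2 : (2 : R) ≠ 0) (h2' : (2 : R') ≠ 0) (hf : SignPreserving f)
    (hφ : ActsOnPlus f φ) {S : Grass R V k} {u : kInvolutions R V k}
    (h : IsCompl S.1 (signSpace u.1 (-1))) : IsCompl (φ S).1 (signSpace (f u).1 (-1)) := by
  obtain ⟨w, hw, hw'⟩ := exists_kInvolution h2 h S.2
  rw [← (hφ w S).mp hw, ← (hf w u (-1)).mp hw']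
  exact isCompl_signSpace h2' ((mem_kInvolutions_iff h2').mp (f w).2).1 1

omit [FiniteDimensional R V] [FiniteDimensional R' V'] in
theorem InducedBy.symm {j : ℕ} {φ : Grass R V j ≃ Grass R' V' j} {l : V ≃+ V'}
    (h : InducedBy φ l) : InducedBy φ.symm l.symm := fun S x => by
  rw [h, Equiv.apply_symm_apply, AddEquiv.apply_symm_apply]

/-- The eigenspace for `-1` is recovered from its complements, on which `f` acts by
`ActsOnPlus.isCompl`. -/
theorem ActsOnPlus.mem_of_inducedBy (h2 : (2 : R) ≠ 0) (h2' : (2 : R') ≠ 0) (hf : SignPreserving f)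
    (hφ : ActsOnPlus f φ) {l : V ≃+ V'} (hl : InducedBy φ l) {u : kInvolutions R V k} {x : V}
    (hx : l x ∈ signSpace (f u).1 (-1)) : x ∈ signSpace u.1 (-1) := by
  have hu := (mem_kInvolutions_iff h2).mp u.2
  by_contra hxu
  have hx0 : x ≠ 0 := fun h => hxu (h ▸ zero_mem _)
  -- a complement of the eigenspace which contains `x` is mapped to a complement containing `l x`
  obtain ⟨S, hxS, hS⟩ := ((Submodule.disjoint_span_singleton' hx0).mpr hxu).symm.exists_isCompl
  have hSk : Module.finrank R S = k := by
    have h1 := Submodule.finrank_add_eq_of_isCompl hS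
    have h3 := finrank_signSpace_add h2 hu.1 1
    rw [hu.2] at h3
    omega
  have h1 := hφ.isCompl h2 h2' hf (S := ⟨S, hSk⟩) hS
  have h3 := Submodule.disjoint_def.mp h1.disjoint (l x)
    ((hl ⟨S, hSk⟩ x).mp ((Submodule.span_singleton_le_iff_mem _ _).mp hxS)) hx
  exact hx0 (by simpa using h3)

/-- If `f` acts on the eigenspaces for `1` through `l`, then it acts on the involutions by
conjugation with `l`. -/
theorem ActsOnPlus.apply_of_inducedBy (h2 : (2 : R) ≠ 0) (h2' : (2 : R') ≠ 0)
    (hf : SignPreserving f) (hφ : ActsOnPlus f φ) {l : V ≃+ V'} (hl : InducedBy φ l)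
    (u : kInvolutions R V k) (x : V) : (f u).1.1 (l x) = l (u.1.1 x) := by
  have hu := (mem_kInvolutions_iff h2).mp u.2
  obtain ⟨y, z, hy, hz, rfl⟩ := exists_add_of_codisjoint (isCompl_signSpace h2 hu.1 1).codisjoint x
  have hplus : l y ∈ signSpace (f u).1 1 := by
    rw [(hφ u ⟨_, hu.2⟩).mp rfl]
    exact (hl ⟨_, hu.2⟩ y).mp hy
  have hminus : l z ∈ signSpace (f u).1 (-1) :=
    hφ.symm.mem_of_inducedBy h2' h2 hf.symm hl.symm (by simpa using hz)
  rw [map_add, map_add, map_add, map_add, mem_signSpace.mp hplus, mem_signSpace.mp hminus,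
    mem_signSpace.mp hy, mem_signSpace.mp hz, map_sign_smul, map_sign_smul]

end ActionOnGrassmannian

/-! ### Sign preserving commutation isomorphisms are semilinear -/

section SignPreservingIsomorphisms

variable {R V : Type*} [DivisionRing R] [AddCommGroup V] [Module R V] [FiniteDimensional R V]
variable {R' V' : Type*} [DivisionRing R'] [AddCommGroup V'] [Module R' V']
  [FiniteDimensional R' V']
variable {n k : ℕ}

/-- For `k = 1`, the map `φ` preserves collinearity: hyperplanes are the eigenspaces for `-1`, and
a line is contained in a hyperplane if and only if it is not complementary to it. -/
theorem ActsOnPlus.le_sup (h2 : (2 : R) ≠ 0) (h2' : (2 : R') ≠ 0)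
    {f : kInvolutions R V 1 ≃ kInvolutions R' V' 1} {φ : Grass R V 1 ≃ Grass R' V' 1}
    (hf : SignPreserving f) (hφ : ActsOnPlus f φ) {P Q T : Grass R V 1} (h : T.1 ≤ P.1 ⊔ Q.1) :
    (φ T).1 ≤ (φ P).1 ⊔ (φ Q).1 := by
  by_contra hcon
  obtain ⟨H, hle, hH⟩ := (Disjoint.of_notMem hcon).symm.exists_isCompl
  obtain ⟨w, hw, hw'⟩ := exists_kInvolution h2' hH.symm (φ T).2
  obtain ⟨u, rfl⟩ := f.surjective w
  have hu := (mem_kInvolutions_iff h2).mp u.2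
  have hT := (hφ u T).mpr hw
  have key : ∀ P : Grass R V 1, (φ P).1 ≤ H → P.1 ≤ signSpace u.1 (-1) := by
    intro P hP
    by_contra hPH
    have hd : IsCompl P.1 (signSpace u.1 (-1)) := by
      refine (Submodule.isCompl_iff_disjoint _ _ ?_).mpr (Disjoint.of_notMem hPH)
      rw [P.2, ← finrank_signSpace_add h2 hu.1 1, hu.2]
    have h1 := hφ.isCompl h2 h2' hf hd
    rw [hw'] at h1
    have h3 := (φ P).2
    rw [h1.disjoint.eq_bot_of_le hP, finrank_bot] at h3
    exact zero_ne_one h3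
  have h1 := h.trans (sup_le (key P (le_sup_left.trans hle)) (key Q (le_sup_right.trans hle)))
  have h3 := T.2
  rw [← hT] at h1 h3
  rw [(isCompl_signSpace h2 hu.1 1).disjoint.eq_bot_of_le h1, finrank_bot] at h3
  exact zero_ne_one h3

omit [FiniteDimensional R V] in
theorem le_finrank_inf_ker {S : Submodule R V} [FiniteDimensional R S] (ξ : V →ₗ[R] R) :
    Module.finrank R S ≤ Module.finrank R (S ⊓ LinearMap.ker ξ : Submodule R V) + 1 := by
  have h1 := LinearMap.finrank_range_add_finrank_ker (ξ.domRestrict S)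
  have h2 := Submodule.finrank_le (LinearMap.range (ξ.domRestrict S))
  rw [Module.finrank_self] at h2
  have h3 : Module.finrank R (LinearMap.ker (ξ.domRestrict S)) =
      Module.finrank R (S ⊓ LinearMap.ker ξ : Submodule R V) := by
    rw [LinearMap.ker_domRestrict, ← Submodule.finrank_map_subtype_eq, Submodule.map_comap_subtype]
  omega

/-- Involutions with the same eigenspace for `-1` are adjacent if their eigenspaces for `1` meet in
a hyperplane of each. -/
theorem adjacentPair_of_finrank_inf {j : ℕ} (h2 : (2 : R) ≠ 0) (hV : Module.finrank R V = n)
    (hn : 3 ≤ n) (hkn : j + 1 < n) (hnk : n ≠ 2 * (j + 1)) {S S' : Grass R V (j + 1)} (hS : S ≠ S')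
    (hj : Module.finrank R (S.1 ⊓ S'.1 : Submodule R V) = j) :
    ∃ u v : kInvolutions R V (j + 1), signSpace u.1 1 = S.1 ∧ signSpace v.1 1 = S'.1 ∧
      AdjacentPair InvolutionsCommute u v := by
  obtain ⟨C, hSC, hSC'⟩ := exists_common_isCompl (n - (j + 1)) S.1 S'.1
    (by rw [S.2, hV]; omega) (by rw [S'.2, hV]; omega)
  obtain ⟨u, hu, hu'⟩ := exists_kInvolution h2 hSC S.2
  obtain ⟨x, hxS', hxS⟩ := SetLike.not_le_iff_exists.mp
    (fun h => hS (Grass.eq_of_le h).symm : ¬ S'.1 ≤ S.1)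
  have hxD : x ∉ C ⊔ (S.1 ⊓ S'.1) := by
    intro h
    obtain ⟨c, hc, d, hd, rfl⟩ := Submodule.mem_sup.mp h
    have hcS' := (Submodule.add_mem_iff_left _ hd.2).mp hxS'
    rw [Submodule.disjoint_def.mp hSC'.disjoint c hcS' hc, zero_add] at hxS
    exact hxS hd.1
  obtain ⟨ξ, hξ, hξx⟩ := LinearMap.exists_extend_of_notMem
    (0 : (C ⊔ (S.1 ⊓ S'.1) : Submodule R V) →ₗ[R] R) hxD 1
  have hξ0 : ∀ y ∈ C ⊔ (S.1 ⊓ S'.1), ξ y = 0 := fun y hy => by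
    simpa using LinearMap.congr_fun hξ ⟨y, hy⟩
  obtain ⟨s, c, hs, hc, hsc⟩ := exists_add_of_codisjoint hSC.codisjoint x
  have hcu : c + c ∈ signSpace u.1 (-1) := by rw [hu']; exact add_mem hc hc
  have hξu : ∀ y ∈ signSpace u.1 (-1), ξ y = 0 := fun y hy =>
    hξ0 y (Submodule.mem_sup_left (hu' ▸ hy))
  obtain ⟨v, hv⟩ := exists_rankOneStep h2 hcu hξu
  have hfix : ∀ y ∈ S.1, u.1.1 y = y := fun y hy => by
    rw [← hu] at hy
    rw [mem_signSpace.mp hy, one_smul]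
  have hvx : v.1.1 x = x := by
    have hcx : u.1.1 c = -c := by
      rw [← hu'] at hc
      rw [mem_signSpace.mp hc, Units.neg_smul, one_smul]
    rw [hv, hξx, one_smul, ← hsc, map_add, hfix s hs, hcx]
    abel
  have hvS' : S'.1 ≤ signSpace v.1 1 := by
    have hsup : (S.1 ⊓ S'.1) ⊔ Submodule.span R {x} = S'.1 := by
      refine Submodule.eq_of_le_of_finrank_eq
        (sup_le inf_le_right ((Submodule.span_singleton_le_iff_mem _ _).mpr hxS')) ?_
      rw [finrank_sup_span_singleton (fun h : x ∈ S.1 ⊓ S'.1 => hxS h.1), hj, S'.2]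
    rw [← hsup]
    refine sup_le (fun y hy => ?_) ((Submodule.span_singleton_le_iff_mem _ _).mpr ?_)
    · rw [mem_signSpace, one_smul, hv, hξ0 y (Submodule.mem_sup_right hy), zero_smul, add_zero,
        hfix y hy.1]
    · rw [mem_signSpace, one_smul, hvx]
  have hvS := Submodule.eq_of_le_of_finrank_eq hvS'
    (S'.2.trans ((mem_kInvolutions_iff h2).mp v.2).2.symm)
  refine ⟨u, v, hu, hvS.symm, ?_⟩
  have hstep : RankOneStep (-1) u v := ⟨_, ξ, hcu, hξu, hv⟩
  refine (hstep.eq_or_adjacentPair h2 hV hn (by omega) hkn hnk).resolve_left ?_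
  rintro rfl
  exact hS (Subtype.ext (hu.symm.trans hvS.symm))

/-- The eigenspaces for `1` of adjacent involutions meet in a hyperplane of each, or agree. -/
theorem AdjacentPair.le_finrank_inf {j : ℕ} (h2 : (2 : R) ≠ 0) (hV : Module.finrank R V = n)
    (hn : 3 ≤ n) (hkn : j + 1 < n) (hnk : n ≠ 2 * (j + 1)) {u v : kInvolutions R V (j + 1)}
    (h : AdjacentPair InvolutionsCommute u v) :
    j ≤ Module.finrank R (signSpace u.1 1 ⊓ signSpace v.1 1 : Submodule R V) := by
  obtain ⟨b, s, i, l, c, -, -, -, hv⟩ := h.exists_shear h2 hV hn (by omega) hkn hnk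
  have h1 := le_finrank_inf_ker (S := signSpace u.1 1) (b.coord l)
  rw [((mem_kInvolutions_iff h2).mp u.2).2] at h1
  refine (Nat.le_of_succ_le_succ h1).trans (Submodule.finrank_mono ?_)
  rintro x ⟨hx, hxl⟩
  refine ⟨hx, ?_⟩
  rw [SetLike.mem_coe, mem_signSpace, hv, LinearMap.mem_ker.mp hxl, zero_smul, add_zero]
  exact hx

/-- A commutation isomorphism preserves the relation on the eigenspaces for `1` of meeting in a
hyperplane of each. -/
theorem ActsOnPlus.finrank_inf {j : ℕ} (h2 : (2 : R) ≠ 0) (h2' : (2 : R') ≠ 0)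
    (hV : Module.finrank R V = n) (hV' : Module.finrank R' V' = n)
    (hn : 3 ≤ n) (hkn : j + 1 < n) (hnk : n ≠ 2 * (j + 1))
    (f : (InvolutionsCommute (R := R) (V := V) (k := j + 1)) ≃r
      (InvolutionsCommute (R := R') (V := V') (k := j + 1)))
    {φ : Grass R V (j + 1) ≃ Grass R' V' (j + 1)} (hφ : ActsOnPlus f.toEquiv φ)
    {S S' : Grass R V (j + 1)} (hS : S ≠ S')
    (hj : Module.finrank R (S.1 ⊓ S'.1 : Submodule R V) = j) :
    Module.finrank R' ((φ S).1 ⊓ (φ S').1 : Submodule R' V') = j := by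
  obtain ⟨u, v, hu, hv, huv⟩ := adjacentPair_of_finrank_inf h2 hV hn hkn hnk hS hj
  have h1 := (huv.map f).le_finrank_inf h2' hV' hn hkn hnk
  have h3 : Module.finrank R' ((φ S).1 ⊓ (φ S').1 : Submodule R' V') < j + 1 :=
    (Submodule.finrank_lt_finrank_of_lt
      (inf_lt_left.mpr fun h => hS (φ.injective (Grass.eq_of_le h)))).trans_eq (φ S).2
  have hu' : signSpace (f u).1 1 = (φ S).1 := (hφ u S).mp hu
  have hv' : signSpace (f v).1 1 = (φ S').1 := (hφ v S').mp hv
  rw [hu', hv'] at h1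
  omega

/-- The triple condition of `exists_star`. The three subspaces belong to a family of at least
`j + 3` eigenspaces of pairwise commuting involutions, and the images of these are coordinate
subspaces for a single basis. -/
theorem ActsOnPlus.inf_le {j : ℕ} (h2 : (2 : R) ≠ 0) (h2' : (2 : R') ≠ 0)
    (hV : Module.finrank R V = n) (hV' : Module.finrank R' V' = n)
    (hn : 3 ≤ n) (hnk : 2 * (j + 1) < n)
    (f : (InvolutionsCommute (R := R) (V := V) (k := j + 1)) ≃r
      (InvolutionsCommute (R := R') (V := V') (k := j + 1)))
    {φ : Grass R V (j + 1) ≃ Grass R' V' (j + 1)} (hφ : ActsOnPlus f.toEquiv φ) (N : Grass R V j)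
    (S₁ S₂ S₃ : Grass R V (j + 1)) (h₁ : N.1 ≤ S₁.1) (h₂ : N.1 ≤ S₂.1) (h₃ : N.1 ≤ S₃.1)
    (h₁₂ : S₁ ≠ S₂) (h : ¬ S₃.1 ≤ S₁.1 ⊔ S₂.1) :
    Module.finrank R' ((φ S₁).1 ⊓ (φ S₂).1 : Submodule R' V') = j ∧
      (φ S₁).1 ⊓ (φ S₂).1 ≤ (φ S₃).1 := by
  have hinf := @ActsOnPlus.finrank_inf R V _ _ _ _ R' V' _ _ _ _ n j h2 h2' hV hV' hn (by omega)
    (by omega) f φ hφ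
  obtain ⟨x, hx₁, hx⟩ := SetLike.not_le_iff_exists.mp (fun h => by
    have := Submodule.finrank_mono h
    rw [S₁.2, N.2] at this
    omega : ¬ S₁.1 ≤ N.1)
  obtain ⟨y, hy₂, hy⟩ := SetLike.not_le_iff_exists.mp
    (fun h => h₁₂ (Grass.eq_of_le h).symm : ¬ S₂.1 ≤ S₁.1)
  obtain ⟨z, hz₃, hz⟩ := SetLike.not_le_iff_exists.mp h
  have hle₁ : N.1 ⊔ Submodule.span R {x} ≤ S₁.1 :=
    sup_le h₁ ((Submodule.span_singleton_le_iff_mem _ _).mpr hx₁)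
  obtain ⟨b, A, p, q, r, hA, hp, hq, hr, hpq, hpr, hqr, hbA, hbp, hbq, hbr⟩ :=
    exists_basis_coordSpace hV N hx (fun h => hy (hle₁ h))
      (fun h => hz (sup_le_sup hle₁ ((Submodule.span_singleton_le_iff_mem _ _).mpr hy₂) h))
  let S : {p // p ∉ A} → Grass R V (j + 1) := fun p => ⟨coordSpace b (insert p.1 A), by
    rw [finrank_coordSpace, Finset.card_insert_of_notMem p.2, hA]⟩
  have hS : ∀ (p : {p // p ∉ A}) (T : Grass R V (j + 1)), N.1 ≤ T.1 → b p ∈ T.1 → S p = T := by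
    intro p T hN hpT
    refine Grass.eq_of_le (Submodule.span_le.mpr ?_)
    rintro _ ⟨i, hi, rfl⟩
    rcases Finset.mem_insert.mp hi with rfl | hi
    · exact hpT
    · exact hN (hbA ▸ basis_mem_coordSpace b hi)
  have hSinf : ∀ p q, p ≠ q → Module.finrank R ((S p).1 ⊓ (S q).1 : Submodule R V) = j := by
    intro p q hpq
    rw [coordSpace_inf, finrank_coordSpace, ← hA]
    congr 1
    ext i
    have : p.1 ≠ q.1 := fun h => hpq (Subtype.ext h)
    grind
  have hSinj : Function.Injective S := by
    intro p q hpq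
    by_contra hne
    have := hSinf p q hne
    rw [hpq, inf_idem, (S q).2] at this
    omega
  let s : {p // p ∉ A} → Fin n → ℤˣ := fun p i => if i ∈ insert p.1 A then 1 else -1
  have hs : ∀ p, (Finset.univ.filter fun i => s p i = 1) = insert p.1 A := by
    intro p
    ext i
    rw [Finset.mem_filter]
    by_cases hi : i ∈ insert p.1 A
    · simp only [s, if_pos hi, hi, Finset.mem_univ, and_self]
    · simp only [s, if_neg hi, hi, iff_false, not_and]
      exact fun _ => by decide
  have hu : ∀ p, ∃ u : kInvolutions R V (j + 1), u.1 = signInvolution b (s p) := fun p =>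
    exists_frameInvolution h2 b (by rw [hs, Finset.card_insert_of_notMem p.2, hA])
  choose u hu using hu
  have huS : ∀ p, signSpace (f (u p)).1 1 = (φ (S p)).1 := fun p => (hφ (u p) (S p)).mp (by
    rw [hu, signSpace_signInvolution h2, hs])
  obtain ⟨b', hb'⟩ := exists_basis_signInvolution h2' hV' (Set.range fun p => (f (u p)).1)
    (by rintro _ ⟨p, rfl⟩; exact ((mem_kInvolutions_iff h2').mp (f (u p)).2).1) (by
      rintro _ ⟨p, rfl⟩ _ ⟨q, rfl⟩
      refine f.map_rel_iff.mpr ?_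
      change Commute (u p).1 (u q).1
      rw [hu, hu]
      exact commute_signInvolution b _ _)
  choose t ht using fun p => hb' _ ⟨p, rfl⟩
  have hφS : ∀ p, (φ (S p)).1 = coordSpace b' {i | t p i = 1} := fun p => by
    rw [← huS, ← signSpace_signInvolution h2', ← ht]
  have hS₁ := hS ⟨p, hp⟩ S₁ h₁ (by rw [hbp]; exact hx₁)
  have hS₂ := hS ⟨q, hq⟩ S₂ h₂ (by rw [hbq]; exact hy₂)
  have hS₃ := hS ⟨r, hr⟩ S₃ h₃ (by rw [hbr]; exact hz₃)
  refine ⟨hinf h₁₂ ?_, ?_⟩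
  · rw [← hS₁, ← hS₂]
    exact hSinf _ _ (by simpa using hpq)
  · rw [← hS₁, ← hS₂, ← hS₃, hφS, hφS, hφS, coordSpace_inf]
    refine coordSpace_mono _ (inter_subset_of_card_inter (j := j) ?_
      (fun p => Finset.univ.filter fun i => t p i = 1) (fun p => ?_) (fun p q hpq => ?_)
      (by simpa using hpq) (by simpa using hpr) (by simpa using hqr))
    · rw [Fintype.card_subtype_compl, Fintype.card_coe, hA, Fintype.card_fin]
      omega
    · rw [← finrank_coordSpace b', ← hφS, (φ (S p)).2]
    · rw [← finrank_coordSpace b', ← coordSpace_inf, ← hφS, ← hφS]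
      exact hinf (hSinj.ne hpq) (hSinf p q hpq)

/-- The case `k = 1` is a collineation; in the other cases `φ` descends by one dimension, which
provides the incidence structure needed for the fundamental theorem. -/
theorem ActsOnPlus.exists_inducedBy (h2 : (2 : R) ≠ 0) (h2' : (2 : R') ≠ 0)
    (hV : Module.finrank R V = n) (hV' : Module.finrank R' V' = n)
    (hn : 3 ≤ n) (hk : 0 < k) (hnk : 2 * k < n)
    (f : (InvolutionsCommute (R := R) (V := V) (k := k)) ≃r
      (InvolutionsCommute (R := R') (V := V') (k := k)))
    (hf : SignPreserving f.toEquiv) {φ : Grass R V k ≃ Grass R' V' k}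
    (hφ : ActsOnPlus f.toEquiv φ) :
    ∃ (σ : R ≃+* R') (l : V ≃+ V'), (∀ (a : R) (x : V), l (a • x) = σ a • l x) ∧
      InducedBy φ l := by
  obtain ⟨j, rfl⟩ := Nat.exists_eq_succ_of_ne_zero hk.ne'
  cases j with
  | zero =>
    refine exists_inducedBy_of_collineation (hn.trans hV.ge) φ fun P Q T =>
      ⟨hφ.le_sup h2 h2' hf, fun h => ?_⟩
    have := hφ.symm.le_sup h2' h2 hf.symm h
    rwa [Equiv.symm_apply_apply, Equiv.symm_apply_apply, Equiv.symm_apply_apply] at this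
  | succ j =>
    have hstar := fun N => exists_star (by omega) φ N (hφ.inf_le h2 h2' hV hV' hn hnk f N)
    have hstar' := fun N => exists_star (by omega) φ.symm N
      (ActsOnPlus.inf_le h2' h2 hV' hV hn hnk f.symm hφ.symm N)
    obtain ⟨ψ, hψ⟩ := exists_grass_descend (by omega) (by omega) φ hstar hstar'
    exact exists_inducedBy_of_incidence (by omega) (by omega) φ ψ hψ

omit [FiniteDimensional R V] in
theorem signSpace_neg (u : GeneralLinearGroup R V) (ε : ℤˣ) :
    signSpace (-u) ε = signSpace u (-ε) := by
  ext x
  rw [mem_signSpace, mem_signSpace, Units.val_neg, LinearMap.neg_apply, Units.neg_smul,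
    neg_eq_iff_eq_neg]

theorem neg_mem_kInvolutions (h2 : (2 : R) ≠ 0) (hV : Module.finrank R V = n)
    {u : GeneralLinearGroup R V} (hu : u ∈ kInvolutions R V k) :
    -u ∈ kInvolutions R V (n - k) := by
  rw [mem_kInvolutions_iff h2] at hu ⊢
  have h1 := finrank_signSpace_add h2 hu.1 1
  refine ⟨by rw [neg_mul_neg, hu.1], ?_⟩
  rw [signSpace_neg]
  omega

/-- The bijection `u ↦ -u` between `𝔍ₖ` and `𝔍ₙ₋ₖ`, which exchanges the two eigenspaces. -/
def negInvolutions (h2 : (2 : R) ≠ 0) (hV : Module.finrank R V = n) (hk : k ≤ n) :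
    (InvolutionsCommute (R := R) (V := V) (k := k)) ≃r
      (InvolutionsCommute (R := R) (V := V) (k := n - k)) where
  toFun u := ⟨-u.1, neg_mem_kInvolutions h2 hV u.2⟩
  invFun u := ⟨-u.1, by
    have := neg_mem_kInvolutions h2 hV u.2
    rwa [Nat.sub_sub_self hk] at this⟩
  left_inv u := Subtype.ext (neg_neg _)
  right_inv u := Subtype.ext (neg_neg _)
  map_rel_iff' := Commute.neg_left_iff.trans Commute.neg_right_iff

/-- A commutation isomorphism which preserves signs is the conjugation by a semilinear
isomorphism. -/
theorem SignPreserving.exists_semilinear (h2 : (2 : R) ≠ 0) (h2' : (2 : R') ≠ 0)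
    (hV : Module.finrank R V = n) (hV' : Module.finrank R' V' = n) (hn : 3 ≤ n) (hk : 0 < k)
    (hkn : k < n) (hnk : n ≠ 2 * k)
    (f : (InvolutionsCommute (R := R) (V := V) (k := k)) ≃r
      (InvolutionsCommute (R := R') (V := V') (k := k))) (hf : SignPreserving f.toEquiv) :
    ∃ (σ : R ≃+* R') (l : V ≃+ V'), (∀ (a : R) (x : V), l (a • x) = σ a • l x) ∧
      ∀ (u : kInvolutions R V k) (x : V), (f u).1.1 (l x) = l (u.1.1 x) := by
  -- the main case, which applies to `u ↦ -f (-u)` if `n < 2 * k`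
  have key : ∀ {k : ℕ}, 0 < k → 2 * k < n →
      ∀ f : (InvolutionsCommute (R := R) (V := V) (k := k)) ≃r
        (InvolutionsCommute (R := R') (V := V') (k := k)), SignPreserving f.toEquiv →
      ∃ (σ : R ≃+* R') (l : V ≃+ V'), (∀ (a : R) (x : V), l (a • x) = σ a • l x) ∧
        ∀ (u : kInvolutions R V k) (x : V), (f u).1.1 (l x) = l (u.1.1 x) := by
    intro k hk hkn f hf
    obtain ⟨φ, hφ⟩ := hf.exists_actsOnPlus h2 h2'
    obtain ⟨σ, l, hσ, hl⟩ := hφ.exists_inducedBy h2 h2' hV hV' hn hk hkn f hf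
    exact ⟨σ, l, hσ, hφ.apply_of_inducedBy h2 h2' hf hl⟩
  rcases lt_or_gt_of_ne hnk with h | h
  · let e := negInvolutions h2 hV hkn.le
    let e' := negInvolutions h2' hV' hkn.le
    have hf' : SignPreserving ((e.symm.trans f).trans e').toEquiv := fun u v ε => by
      have h1 := hf (e.symm u) (e.symm v) (-ε)
      change signSpace (-u.1) (-ε) = signSpace (-v.1) (-ε) ↔ _ at h1
      rw [signSpace_neg, signSpace_neg, neg_neg] at h1
      change _ ↔ signSpace (-(f (e.symm u)).1) ε = signSpace (-(f (e.symm v)).1) ε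
      rw [signSpace_neg, signSpace_neg]
      exact h1
    obtain ⟨σ, l, hσ, hl⟩ := key (by omega) (by omega) _ hf'
    refine ⟨σ, l, hσ, fun u x => neg_injective ?_⟩
    have h1 := hl (e u) x
    change (-(f (e.symm (e u))).1).1 (l x) = l ((-u.1).1 x) at h1
    rw [RelIso.symm_apply_apply, Units.val_neg, Units.val_neg, LinearMap.neg_apply,
      LinearMap.neg_apply, map_neg] at h1
    exact h1
  · exact key hk h f hf

/-- A commutation isomorphism either preserves the signs of eigenspaces or exchanges them. -/
theorem exists_sign_signSpace_map_iff (h2 : (2 : R) ≠ 0) (h2' : (2 : R') ≠ 0)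
    (hV : Module.finrank R V = n) (hV' : Module.finrank R' V' = n) (hn : 3 ≤ n) (hk : 0 < k)
    (hkn : k < n) (hnk : n ≠ 2 * k)
    (f : (InvolutionsCommute (R := R) (V := V) (k := k)) ≃r
      (InvolutionsCommute (R := R') (V := V') (k := k))) :
    ∃ η : ℤˣ, ∀ (u v : kInvolutions R V k) (ε : ℤˣ), signSpace u.1 ε = signSpace v.1 ε ↔
      signSpace (f u).1 (η * ε) = signSpace (f v).1 (η * ε) := by
  obtain ⟨η, hη⟩ := exists_sign_forall_signSpace_map h2 h2' hV hV' hn hk hkn hnk f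
  obtain ⟨θ, hθ⟩ := exists_sign_forall_signSpace_map h2' h2 hV' hV hn hk hkn hnk f.symm
  refine ⟨η, fun u v ε => ⟨hη u v ε, fun h => ?_⟩⟩
  -- the signs belonging to `f` and to its inverse agree
  obtain rfl : θ = η := by
    obtain ⟨w, hw, hne⟩ := exists_rankOneStep_ne h2 hV hn hk hkn hnk 1 u
    have h1 := (hw.signSpace_eq h2).symm
    have h3 := hθ _ _ _ (hη u w 1 h1)
    rw [RelIso.symm_apply_apply, RelIso.symm_apply_apply, mul_one] at h3
    by_contra hcon
    refine hne (kInvolutions_eq_of_signSpace_eq h2 (ε := 1) (δ := θ * η) ?_ h1 h3)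
    rintro h4
    exact hcon (by rw [← Int.units_inv_eq_self η]; exact eq_inv_of_mul_eq_one_left h4.symm)
  have h1 := hθ _ _ _ h
  rwa [RelIso.symm_apply_apply, RelIso.symm_apply_apply, ← mul_assoc, Int.units_mul_self,
    one_mul] at h1

end SignPreservingIsomorphisms

/-! ### The contragredient -/

section Contragredient

variable {R V : Type*} [DivisionRing R] [AddCommGroup V] [Module R V]
variable {n k : ℕ}

theorem contragredient_apply (g : GeneralLinearGroup R V) (ξ : V →ₗ[R] R) (x : V) :
    (contragredient g).1 ξ x = ξ ((g⁻¹).1 x) := rfl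

theorem contragredient_mul (g h : GeneralLinearGroup R V) :
    contragredient (g * h) = contragredient g * contragredient h := by
  refine Units.ext (LinearMap.ext fun ξ => LinearMap.ext fun x => ?_)
  change ξ (((g * h)⁻¹).1 x) = ξ ((h⁻¹).1 ((g⁻¹).1 x))
  rw [mul_inv_rev]
  rfl

theorem contragredient_apply_of_mul_self {u : GeneralLinearGroup R V} (hu : u * u = 1)
    (ξ : V →ₗ[R] R) (x : V) : (contragredient u).1 ξ x = ξ (u.1 x) := by
  rw [contragredient_apply, inv_eq_of_mul_eq_one_left hu]

/-- The dual basis, a basis of the dual space over the opposite ring. -/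
noncomputable def dualBasis {ι : Type*} [Finite ι] (b : Module.Basis ι R V) :
    Module.Basis ι Rᵐᵒᵖ (V →ₗ[R] R) :=
  Module.Basis.ofEquivFun
    { toFun := fun ξ i => MulOpposite.op (ξ (b i))
      invFun := fun c => b.constr ℕ fun i => (c i).unop
      map_add' := fun _ _ => rfl
      map_smul' := fun _ _ => rfl
      left_inv := fun _ => b.ext fun i => b.constr_basis ℕ _ i
      right_inv := fun c => funext fun i =>
        congrArg MulOpposite.op (b.constr_basis ℕ (fun i => (c i).unop) i) }

theorem dualBasis_apply {ι : Type*} [Finite ι] (b : Module.Basis ι R V) (i : ι) :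
    dualBasis b i = b.coord i := by
  classical
  refine b.ext fun j => ?_
  rw [dualBasis, Module.Basis.coe_ofEquivFun]
  change b.constr ℕ _ (b j) = _
  rw [b.constr_basis, b.coord_apply, b.repr_self, Finsupp.single_apply, Pi.single_apply]
  split_ifs <;> rfl

theorem finrank_dual_op [FiniteDimensional R V] :
    Module.finrank Rᵐᵒᵖ (V →ₗ[R] R) = Module.finrank R V := by
  rw [Module.finrank_eq_card_basis (dualBasis (Module.finBasis R V)), Fintype.card_fin]

theorem finiteDimensional_dual_op [FiniteDimensional R V] :
    FiniteDimensional Rᵐᵒᵖ (V →ₗ[R] R) :=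
  (dualBasis (Module.finBasis R V)).finiteDimensional_of_finite

theorem eq_of_forall_dual {x y : V} (h : ∀ ξ : V →ₗ[R] R, ξ x = ξ y) : x = y := by
  by_contra hne
  obtain ⟨ξ, -, hξ⟩ := LinearMap.exists_extend_of_notMem (0 : (⊥ : Submodule R V) →ₗ[R] R)
    (fun h : x - y ∈ (⊥ : Submodule R V) => hne (sub_eq_zero.mp h)) 1
  rw [map_sub, h, sub_self] at hξ
  exact zero_ne_one hξ

theorem contragredient_injective :
    Function.Injective (contragredient (R := R) (V := V)) := by
  intro g h hgh
  refine inv_injective (Units.ext (LinearMap.ext fun x => eq_of_forall_dual (R := R) fun ξ => ?_))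
  rw [← contragredient_apply, ← contragredient_apply, hgh]

/-- Every endomorphism of the dual space is the transpose of an endomorphism of `V`. -/
theorem exists_transpose [FiniteDimensional R V]
    (G : (V →ₗ[R] R) →ₗ[Rᵐᵒᵖ] (V →ₗ[R] R)) :
    ∃ g : V →ₗ[R] V, ∀ ξ x, ξ (g x) = G ξ x := by
  let b := Module.finBasis R V
  let g : V →ₗ[R] V := ∑ i, (G (b.coord i)).smulRight (b i)
  let T : (V →ₗ[R] R) →ₗ[Rᵐᵒᵖ] (V →ₗ[R] R) :=
    { toFun := fun ξ => ξ ∘ₗ g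
      map_add' := fun _ _ => rfl
      map_smul' := fun _ _ => rfl }
  have hT : T = G := (dualBasis b).ext fun j => by
    refine LinearMap.ext fun x => ?_
    rw [dualBasis_apply]
    change b.coord j (g x) = _
    rw [LinearMap.sum_apply, map_sum, Finset.sum_eq_single j]
    · rw [LinearMap.smulRight_apply, map_smul, b.coord_apply, b.repr_self, Finsupp.single_eq_same,
        smul_eq_mul, mul_one]
    · intro i _ hij
      rw [LinearMap.smulRight_apply, map_smul, b.coord_apply, b.repr_self,
        Finsupp.single_eq_of_ne hij.symm, smul_zero]
    · exact fun h => absurd (Finset.mem_univ j) h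
  exact ⟨g, fun ξ x => LinearMap.congr_fun (LinearMap.congr_fun hT ξ) x⟩

theorem contragredient_surjective [FiniteDimensional R V] :
    Function.Surjective (contragredient (R := R) (V := V)) := by
  intro G
  obtain ⟨g, hg⟩ := exists_transpose G.1
  obtain ⟨h, hh⟩ := exists_transpose (G⁻¹).1
  have hGG : ∀ ξ, G.1 ((G⁻¹).1 ξ) = ξ := fun ξ => LinearMap.congr_fun G.mul_inv ξ
  have hGG' : ∀ ξ, (G⁻¹).1 (G.1 ξ) = ξ := fun ξ => LinearMap.congr_fun G.inv_mul ξ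
  refine ⟨⟨h, g, LinearMap.ext fun x => eq_of_forall_dual (R := R) fun ξ => ?_,
    LinearMap.ext fun x => eq_of_forall_dual (R := R) fun ξ => ?_⟩, Units.ext (LinearMap.ext fun ξ =>
      LinearMap.ext fun x => hg ξ x)⟩
  · change ξ (h (g x)) = ξ x
    rw [hh, hg, hGG]
  · change ξ (g (h x)) = ξ x
    rw [hg, hh, hGG']

/-- The contragredient as an isomorphism of groups. -/
noncomputable def contragredientEquiv [FiniteDimensional R V] :
    GeneralLinearGroup R V ≃* GeneralLinearGroup Rᵐᵒᵖ (V →ₗ[R] R) :=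
  MulEquiv.ofBijective (MonoidHom.mk' contragredient contragredient_mul)
    ⟨contragredient_injective, contragredient_surjective⟩

theorem contragredient_signInvolution {ι : Type*} [Finite ι] (b : Module.Basis ι R V)
    (s : ι → ℤˣ) : contragredient (signInvolution b s) = signInvolution (dualBasis b) s := by
  refine eq_signInvolution fun i => LinearMap.ext fun x => ?_
  rw [contragredient_apply_of_mul_self (signInvolution_mul_self b s), dualBasis_apply,
    coord_signInvolution]
  rfl

theorem op_two_ne_zero (h2 : (2 : R) ≠ 0) : (2 : Rᵐᵒᵖ) ≠ 0 := fun h =>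
  h2 (by simpa using congrArg MulOpposite.unop h)

/-- The contragredient of a diagonal involution is diagonal in the dual basis, with the same signs.
-/
theorem contragredient_mem_iff [FiniteDimensional R V] (h2 : (2 : R) ≠ 0)
    {u : GeneralLinearGroup R V} :
    contragredient u ∈ kInvolutions Rᵐᵒᵖ (V →ₗ[R] R) k ↔ u ∈ kInvolutions R V k := by
  have key : u * u = 1 → (contragredient u ∈ kInvolutions Rᵐᵒᵖ (V →ₗ[R] R) k ↔
      u ∈ kInvolutions R V k) := by
    intro hu
    obtain ⟨b, hb⟩ := exists_basis_signInvolution h2 rfl {u} (by rintro _ rfl; exact hu)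
      (by rintro _ rfl _ rfl; exact Commute.refl _)
    obtain ⟨s, rfl⟩ := hb u rfl
    rw [contragredient_signInvolution, signInvolution_mem_iff (op_two_ne_zero h2),
      signInvolution_mem_iff h2]
  refine ⟨fun h => (key ?_).mp h, fun h => (key h.1).mpr h⟩
  refine contragredientEquiv.injective ?_
  rw [map_mul, map_one]
  exact h.1

/-- The contragredient as a bijection between the involutions of `V` and of its dual space. -/
noncomputable def contragredientInvolutions [FiniteDimensional R V] (h2 : (2 : R) ≠ 0) :
    (InvolutionsCommute (R := R) (V := V) (k := k)) ≃r
      (InvolutionsCommute (R := Rᵐᵒᵖ) (V := V →ₗ[R] R) (k := k)) where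
  toEquiv := contragredientEquiv.toEquiv.subtypeEquiv fun _ => (contragredient_mem_iff h2).symm
  map_rel_iff' := by
    intro u v
    exact commute_map_iff (f := contragredientEquiv (R := R) (V := V)) contragredientEquiv.injective

/-- The eigenspaces of the contragredient are the annihilators of the eigenspaces for the other
sign. -/
theorem mem_signSpace_contragredient (h2 : (2 : R) ≠ 0) {u : GeneralLinearGroup R V}
    (hu : u * u = 1) {ε : ℤˣ} {ξ : V →ₗ[R] R} :
    ξ ∈ signSpace (contragredient u) (-ε) ↔ ∀ x ∈ signSpace u ε, ξ x = 0 := by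
  rw [mem_signSpace]
  constructor
  · intro h x hx
    have h1 := LinearMap.congr_fun h x
    rw [contragredient_apply_of_mul_self hu, mem_signSpace.mp hx, map_sign_smul] at h1
    exact eq_zero_of_sign_smul_eq h2 h1
  · intro h
    refine LinearMap.ext fun x => ?_
    rw [contragredient_apply_of_mul_self hu]
    obtain ⟨y, z, hy, hz, rfl⟩ := exists_add_of_codisjoint (isCompl_signSpace h2 hu ε).codisjoint x
    rw [map_add, map_add, mem_signSpace.mp hy, mem_signSpace.mp hz, map_sign_smul, map_sign_smul,
      h y hy, smul_zero, zero_add]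
    change _ = (-ε) • ξ (y + z)
    rw [map_add, h y hy, zero_add]

theorem signSpace_contragredient_eq_iff (h2 : (2 : R) ≠ 0) {u v : GeneralLinearGroup R V}
    (hu : u * u = 1) (hv : v * v = 1) (ε : ℤˣ) :
    signSpace (contragredient u) (-ε) = signSpace (contragredient v) (-ε) ↔
      signSpace u ε = signSpace v ε := by
  have key : ∀ {u v : GeneralLinearGroup R V}, u * u = 1 → v * v = 1 →
      signSpace (contragredient u) (-ε) = signSpace (contragredient v) (-ε) →
      signSpace u ε ≤ signSpace v ε := by
    intro u v hu hv h x hx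
    by_contra hxv
    obtain ⟨ξ, hξ, hξx⟩ := LinearMap.exists_extend_of_notMem
      (0 : signSpace v ε →ₗ[R] R) hxv 1
    have h1 : ξ ∈ signSpace (contragredient u) (-ε) := by
      rw [h, mem_signSpace_contragredient h2 hv]
      intro y hy
      simpa using LinearMap.congr_fun hξ ⟨y, hy⟩
    rw [(mem_signSpace_contragredient h2 hu).mp h1 x hx] at hξx
    exact zero_ne_one hξx
  refine ⟨fun h => le_antisymm (key hu hv h) (key hv hu h.symm), fun h => ?_⟩
  ext ξ
  rw [mem_signSpace_contragredient h2 hu, mem_signSpace_contragredient h2 hv, h]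

end Contragredient

/-! ### Conjugation by semilinear isomorphisms -/

section Conjugation

variable {R V : Type*} [DivisionRing R] [AddCommGroup V] [Module R V]
variable {R' V' : Type*} [DivisionRing R'] [AddCommGroup V'] [Module R' V']

/-- A semilinear isomorphism as a bundled semilinear equivalence. -/
def semilinearEquiv (σ : R ≃+* R') (l : V ≃+ V') (hl : ∀ (a : R) (x : V), l (a • x) = σ a • l x) :
    haveI := RingHomInvPair.of_ringEquiv σ
    haveI := RingHomInvPair.symm (σ : R →+* R') (σ.symm : R' →+* R)
    V ≃ₛₗ[(σ : R →+* R')] V' :=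
  haveI := RingHomInvPair.of_ringEquiv σ
  haveI := RingHomInvPair.symm (σ : R →+* R') (σ.symm : R' →+* R)
  { l with map_smul' := hl }

/-- Conjugation with a semilinear isomorphism. -/
def conjGL {σ : R →+* R'} {σ' : R' →+* R} [RingHomInvPair σ σ'] [RingHomInvPair σ' σ]
    (l : V ≃ₛₗ[σ] V') : GeneralLinearGroup R V ≃* GeneralLinearGroup R' V' :=
  Units.mapEquiv l.conjRingEquiv.toMulEquiv

theorem conjGL_apply {σ : R →+* R'} {σ' : R' →+* R} [RingHomInvPair σ σ'] [RingHomInvPair σ' σ]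
    (l : V ≃ₛₗ[σ] V') (g : GeneralLinearGroup R V) (x : V') :
    (conjGL l g).1 x = l (g.1 (l.symm x)) := rfl

theorem conjGL_symm_apply {σ : R →+* R'} {σ' : R' →+* R} [RingHomInvPair σ σ']
    [RingHomInvPair σ' σ] (l : V ≃ₛₗ[σ] V') (g : GeneralLinearGroup R' V') (x : V) :
    ((conjGL l).symm g).1 x = l.symm (g.1 (l x)) := rfl

theorem kInvolutions_subsingleton [FiniteDimensional R V] (h2 : (2 : R) ≠ 0) {k : ℕ}
    (hk : k = 0 ∨ k = Module.finrank R V) (u v : kInvolutions R V k) : u = v := by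
  have hu := (mem_kInvolutions_iff h2).mp u.2
  have hv := (mem_kInvolutions_iff h2).mp v.2
  have hu' := finrank_signSpace_add h2 hu.1 1
  have hv' := finrank_signSpace_add h2 hv.1 1
  rw [hu.2] at hu'
  rw [hv.2] at hv'
  refine kInvolutions_eq_of_signSpace_eq h2 (ε := 1) (δ := -1) (by decide) ?_ ?_
  · rcases hk with rfl | hk
    · rw [Submodule.finrank_eq_zero.mp hu.2, Submodule.finrank_eq_zero.mp hv.2]
    · rw [Submodule.eq_top_of_finrank_eq (hu.2.trans hk),
        Submodule.eq_top_of_finrank_eq (hv.2.trans hk)]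
  · rcases hk with rfl | hk
    · rw [zero_add] at hu' hv'
      rw [Submodule.eq_top_of_finrank_eq hu', Submodule.eq_top_of_finrank_eq hv']
    · rw [Submodule.finrank_eq_zero.mp (by omega : Module.finrank R (signSpace u.1 (-1)) = 0),
        Submodule.finrank_eq_zero.mp (by omega : Module.finrank R (signSpace v.1 (-1)) = 0)]

end Conjugation

theorem corollary1 {R V : Type*} [DivisionRing R] [AddCommGroup V] [Module R V]
    [FiniteDimensional R V] (n k : ℕ) (hdim : Module.finrank R V = n) (hn : 3 ≤ n)
    (hk : k ≤ n) (hchar : ringChar R ≠ 2) (hnk : n ≠ 2 * k)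
    (f : kInvolutions R V k ≃ kInvolutions R V k) (hf : CommutativityPreserving f) :
    ∃ F : LinearMap.GeneralLinearGroup R V ≃* LinearMap.GeneralLinearGroup R V,
      (∀ u : kInvolutions R V k,
        F (u : LinearMap.GeneralLinearGroup R V) = (f u : LinearMap.GeneralLinearGroup R V)) ∧
      ((∃ (σ σ' : R →+* R) (_ : RingHomInvPair σ σ') (_ : RingHomInvPair σ' σ) (l : V ≃ₛₗ[σ] V),
          ∀ (g : LinearMap.GeneralLinearGroup R V) (x : V),
            (F g).val x = l (g.val (l.symm x))) ∨
        (∃ (σ : R →+* Rᵐᵒᵖ) (σ' : Rᵐᵒᵖ →+* R) (_ : RingHomInvPair σ σ') (_ : RingHomInvPair σ' σ)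
            (s : V ≃ₛₗ[σ] (V →ₗ[R] R)),
          ∀ (g : LinearMap.GeneralLinearGroup R V) (x : V),
            (F g).val x = s.symm ((contragredient g).val (s x)))) := by
  have h2 : (2 : R) ≠ 0 := Ring.two_ne_zero hchar
  by_cases hk0 : k = 0 ∨ k = n
  · -- there is only one such involution, and `F = 1` will do
    refine ⟨MulEquiv.refl _, fun u => congrArg Subtype.val
      (kInvolutions_subsingleton h2 (hdim ▸ hk0) u (f u)), Or.inl ⟨RingHom.id R, RingHom.id R,
      inferInstance, inferInstance, LinearEquiv.refl R V, fun g x => rfl⟩⟩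
  obtain ⟨hk0, hkn⟩ := not_or.mp hk0
  have hk0 : 0 < k := Nat.pos_of_ne_zero hk0
  have hkn : k < n := lt_of_le_of_ne hk hkn
  let e : (InvolutionsCommute (R := R) (V := V) (k := k)) ≃r
      (InvolutionsCommute (R := R) (V := V) (k := k)) :=
    ⟨f, fun {u v} => ⟨fun h => by
      have := hf.2 (f u) (f v) h
      rwa [Equiv.symm_apply_apply, Equiv.symm_apply_apply] at this, hf.1 u v⟩⟩
  obtain ⟨η, hη⟩ := exists_sign_signSpace_map_iff h2 h2 hdim hdim hn hk0 hkn hnk e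
  rcases Int.units_eq_one_or η with rfl | rfl
  · have he : SignPreserving e.toEquiv := fun u v ε => by
      have := hη u v ε
      rwa [one_mul] at this
    obtain ⟨σ, l, hσ, hl⟩ := he.exists_semilinear h2 h2 hdim hdim hn hk0 hkn hnk e
    have := RingHomInvPair.of_ringEquiv σ
    have := RingHomInvPair.symm (σ : R →+* R) (σ.symm : R →+* R)
    let L := semilinearEquiv σ l hσ
    refine ⟨conjGL L, fun u => GeneralLinearGroup.ext_apply fun x => ?_,
      Or.inl ⟨σ, σ.symm, _, _, L, conjGL_apply L⟩⟩
    rw [conjGL_apply]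
    change l (u.1.1 (l.symm x)) = (e u).1.1 x
    rw [← hl, AddEquiv.apply_symm_apply]
  · have := finiteDimensional_dual_op (R := R) (V := V)
    let c : (InvolutionsCommute (R := R) (V := V) (k := k)) ≃r _ :=
      e.symm.trans (contragredientInvolutions h2)
    have hc : SignPreserving c.toEquiv := fun u v ε => by
      have h1 := hη (e.symm u) (e.symm v) (-ε)
      rw [RelIso.apply_symm_apply, RelIso.apply_symm_apply, neg_mul_neg, one_mul] at h1
      rw [← h1, ← signSpace_contragredient_eq_iff h2
        (e.symm u).2.1 (e.symm v).2.1, neg_neg]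
      rfl
    obtain ⟨σ, l, hσ, hl⟩ := hc.exists_semilinear h2 (op_two_ne_zero h2) hdim
      (finrank_dual_op.trans hdim) hn hk0 hkn hnk c
    have := RingHomInvPair.of_ringEquiv σ
    have := RingHomInvPair.symm (σ : R →+* Rᵐᵒᵖ) (σ.symm : Rᵐᵒᵖ →+* R)
    let L := semilinearEquiv σ l hσ
    refine ⟨contragredientEquiv.trans (conjGL L).symm,
      fun u => GeneralLinearGroup.ext_apply fun x => ?_,
      Or.inr ⟨σ, σ.symm, _, _, L, fun g x => conjGL_symm_apply L _ x⟩⟩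
    change l.symm ((contragredient u.1).1 (l x)) = (e u).1.1 x
    have h1 := hl (e u) x
    change (contragredient (e.symm (e u)).1).1 (l x) = _ at h1
    rw [RelIso.symm_apply_apply] at h1
    rw [h1, AddEquiv.symm_apply_apply]
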